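/- **Model.** A system has $m$ identical servers and an infinite buffer ($B=\infty$) and starts empty at time $0$. The input $\mathcal I$ consists of $n\in\{0,1,2,\dots\}\cup\{\infty\}$ packets; packet $i$ is generated at time $s_i$ and arrives at time $a_i$, where $0\le s_1\le s_2\le\cdots$ and $s_i\le a_i$; the arrival order need not be the generation order. Only finitely many packets arrive in each bounded time interval. Each server serves at most one packet at a time and each packet is served by at most one server at a time. Preemption is allowed at any time; a preempted packet returns to the buffer. Each service started on a server has its own service time; all these service times are i.i.d. exponential with rate $\mu>0$. A service that is not preempted ends, with the delivery of its packet, when its service time has elapsed. A *causal policy* decides which packets the servers serve as a (measurable) function of the history and current state of the system and possibly of a random seed independent of the service times; it does not see the service times of unfinished services. Almost surely it makes finitely many decisions in bounded time. $\Pi$ is the set of causal policies. A policy is *work-conserving* if, almost surely, no server is ever idle while a packet is waiting. A *prmp-LGFS* (preemptive last-generated-first-served) policy acts only at arrivals and deliveries, is work-conserving, always keeps in service packets such that no waiting packet has a larger generation time than a packet in service (ties broken arbitrarily), and interrupts an ongoing service only to replace the packet by one with a strictly larger generation time. For $\pi\in\Pi$ let $c_i\in[0,\infty]$ be the delivery time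 of packet $i$, $\gamma_\pi(t)=\#\{i:c_i\le t\}$ the number of packets delivered by time $t$, $N_\pi(t)=\#\{i:a_i\le t<c_i\}$ the number of packets in the system, and $A(t)=\#\{i:a_i\le t\}$. For processes, $X\le_{\rm st}Y$ means $\mathbb P((X(t_1),\dots,X(t_r))\in U)\le\mathbb P((Y(t_1),\dots,Y(t_r))\in U)$ for all $t_1<\dots<t_r$ and all upper sets $U$. The throughput on $[0,T]$ is $\mathbb E[\gamma_\pi(T)]/T$. The mean delay on $[0,T]$ is $D_\pi(T)=\frac1{A(T)}\mathbb E\sum_{i:a_i\le T}(\min(c_i,T)-a_i)$ (and $0$ if $A(T)=0$). A policy $\pi^*\in\Pi$ is *throughput-optimal* if for all $\pi\in\Pi$: $\gamma_\pi\le_{\rm st}\gamma_{\pi^*}$, its throughput on $[0,T]$ is at least that of $\pi$ for every $T>0$, and so are the $\liminf$ and $\limsup$ of its throughput as $T\to\infty$. It is *mean-delay-optimal* if for all $\pi\in\Pi$: $N_{\pi^*}\le_{\rm st}N_\pi$; $D_{\pi^*}(T)\le D_\pi(T)$ for every $T\geq 0$; the $\liminf$ and $\limsup$ of $D_{\pi^*}(T)$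 as $T\to\infty$ are at most those of $D_\pi(T)$; and $\sum_i\mathbb E[c_i-a_i]$ is at most its value under $\pi$, hence, for finite $n\ge1$, so is the mean delay per packet $\frac1n\sum_{i=1}^n\mathbb E[c_i-a_i]$. **Theorem 2.** For every such input $\mathcal I$ (with $B=\infty$), prmp-LGFS policies exist, and each of them belongs to $\Pi$, is work-conserving, and is throughput-optimal and mean-delay-optimal among all policies in $\Pi$. Moreover, for any two work-conserving policies $\pi,\pi'\in\Pi$ the processes $\{(N_\pi(t),\gamma_\pi(t)),t\ge0\}$ and $\{(N_{\pi'}(t),\gamma_{\pi'}(t)),t\ge0\}$ have the same distribution, and every work-conserving policy in $\Pi$ is throughput-optimal and mean-delay-optimal. -/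

import Mathlib

open MeasureTheory ProbabilityTheory Filter Topology
open scoped NNReal ENNReal

/-- The discrete σ-algebra on `Option ℕ` (a packet index, or `none`). -/
instance instMeasurableSpaceOptionNat : MeasurableSpace (Option ℕ) := ⊤

namespace UpdateSystem

/-- The input of the system with an infinite buffer: the number `n` of packets (possibly infinite),
the generation times and the arrival times of the packets `0, 1, …` below `n` (the values at
indices `≥ n` are never used). Finitely many packets arrive in every bounded time interval. -/
structure Input where
  n : ℕ∞
  gen : ℕ → ℝ≥0
  arr : ℕ → ℝ≥0
  gen_mono : ∀ i j : ℕ, i ≤ j → (j : ℕ∞) < n → gen i ≤ gen j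
  gen_le_arr : ∀ i : ℕ, (i : ℕ∞) < n → gen i ≤ arr i
  finite_arrivals : ∀ T : ℝ≥0, {i : ℕ | (i : ℕ∞) < n ∧ arr i ≤ T}.Finite

/-- What can be seen at a decision epoch: the time of the epoch; for each server, the packet whose
service it completes at this epoch (`none` if there is no completion); and, for each server, the
packet that it was serving just before and that is still unfinished (`none` if there is none). -/
abbrev Obs (m : ℕ) : Type := ℝ≥0∞ × (Fin m → Option ℕ) × (Fin m → Option ℕ)

variable {m : ℕ}

def Obs.time (o : Obs m) : ℝ≥0∞ := o.1
def Obs.delivered (o : Obs m) : Fin m → Option ℕ := o.2.1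
def Obs.serving (o : Obs m) : Fin m → Option ℕ := o.2.2

/-- The history at epoch `k`: the observations of epochs `0, …, k`. -/
abbrev Hist (m k : ℕ) : Type := Fin (k + 1) → Obs m

/-- The current observation. -/
def Hist.now {k : ℕ} (h : Hist m k) : Obs m := h (Fin.last k)

/-- The packets that have arrived and have not been delivered, according to a history. -/
def Input.inSystem (I : Input) {k : ℕ} (h : Hist m k) : Set ℕ :=
  {i | (i : ℕ∞) < I.n ∧ (I.arr i : ℝ≥0∞) ≤ h.now.time ∧ ∀ l j, (h l).delivered j ≠ some i}

/-- A causal scheduling policy for the input `I` and `m` servers. At every decision epoch it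
chooses, from the history and a randomization seed in `Ξ`, the packet that each server serves from
now on (`none`: the server idles), and a delay after which it wants to decide again if nothing
happens before. The decision epochs are time `0`, the arrival times, the service completions and
the review times chosen in this way; so preemption is possible at any time. Only packets that are in
the system can be served, and no packet is served by two servers at once. (An epoch at time `⊤`
stands for "no further epoch".) -/
structure Policy (I : Input) (m : ℕ) (Ξ : Type*) [MeasurableSpace Ξ] where
  assign : (k : ℕ) → Ξ → Hist m k → Fin m → Option ℕ
  review : (k : ℕ) → Ξ → Hist m k → ℝ≥0∞
  measurable_assign : ∀ k, Measurable fun p : Ξ × Hist m k => assign k p.1 p.2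
  measurable_review : ∀ k, Measurable fun p : Ξ × Hist m k => review k p.1 p.2
  review_pos : ∀ k e h, 0 < review k e h
  assign_mem : ∀ k e (h : Hist m k), h.now.time ≠ ⊤ →
    ∀ j i, assign k e h j = some i → i ∈ I.inSystem h
  assign_inj : ∀ k e (h : Hist m k), h.now.time ≠ ⊤ →
    ∀ j j' i, assign k e h j = some i → assign k e h j' = some i → j = j'

/-- The first arrival time after `T` (`⊤` if there is none). -/
noncomputable def Input.nextArrival (I : Input) (T : ℝ≥0∞) : ℝ≥0∞ :=
  sInf {t | ∃ i : ℕ, (i : ℕ∞) < I.n ∧ t = I.arr i ∧ T < t}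

/-- The full state at epoch `k`, before the decision of epoch `k`: the visible history and, hidden
from the policy, the time at which each ongoing service is going to be completed if it is not
preempted. -/
structure SysState (m k : ℕ) where
  hist : Hist m k
  finish : Fin m → ℝ≥0∞

/-- The realization of the primitive random elements: the seed of the policy, and the service times;
`x k j` is the service time of a service that server `j` starts at epoch `k`. -/
abbrev Outcome (m : ℕ) (Ξ : Type*) : Type _ := Ξ × (ℕ → Fin m → ℝ)

section Dynamics

variable {I : Input} {Ξ : Type*} [MeasurableSpace Ξ]

/-- The completion times after the decision of epoch `k`, if no server is preempted from now on. An
ongoing service continues if its server keeps its packet; otherwise a new service starts, with a new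
service time. -/
noncomputable def Policy.newFinish (π : Policy I m Ξ) {k : ℕ} (e : Ξ) (x : Fin m → ℝ)
    (S : SysState m k) (j : Fin m) : ℝ≥0∞ :=
  if π.assign k e S.hist j = none then ⊤
  else if π.assign k e S.hist j = S.hist.now.serving j then S.finish j
  else S.hist.now.time + ENNReal.ofReal (x j)

/-- The time of the next epoch: the next arrival, review or service completion. -/
noncomputable def Policy.nextTime (π : Policy I m Ξ) {k : ℕ} (e : Ξ) (x : Fin m → ℝ)
    (S : SysState m k) : ℝ≥0∞ :=
  min (I.nextArrival S.hist.now.time)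
    (min (S.hist.now.time + π.review k e S.hist) (⨅ j, π.newFinish e x S j))

/-- The packets delivered by the servers at the next epoch. -/
noncomputable def Policy.nextDelivered (π : Policy I m Ξ) {k : ℕ} (e : Ξ) (x : Fin m → ℝ)
    (S : SysState m k) (j : Fin m) : Option ℕ :=
  open Classical in
  if π.newFinish e x S j ≤ π.nextTime e x S ∧ π.nextTime e x S ≠ ⊤ then π.assign k e S.hist j
  else none

/-- The packets still under service at the next epoch, before the decision taken there. -/
noncomputable def Policy.nextServing (π : Policy I m Ξ) {k : ℕ} (e : Ξ) (x : Fin m → ℝ)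
    (S : SysState m k) (j : Fin m) : Option ℕ :=
  if π.nextDelivered e x S j = none then π.assign k e S.hist j else none

/-- The evolution of the system, started empty at time `0`. -/
noncomputable def Policy.run (π : Policy I m Ξ) (w : Outcome m Ξ) : (k : ℕ) → SysState m k
  | 0 => { hist := fun _ => (0, fun _ => none, fun _ => none), finish := fun _ => ⊤ }
  | k + 1 =>
    { hist := Fin.snoc (π.run w k).hist
        (π.nextTime w.1 (w.2 k) (π.run w k), π.nextDelivered w.1 (w.2 k) (π.run w k),
          π.nextServing w.1 (w.2 k) (π.run w k))
      finish := π.newFinish w.1 (w.2 k) (π.run w k) }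

/-- The observation at epoch `k`. -/
noncomputable def Policy.obs (π : Policy I m Ξ) (w : Outcome m Ξ) (k : ℕ) : Obs m :=
  (π.run w k).hist.now

/-- The assignment chosen at epoch `k`. -/
noncomputable def Policy.decision (π : Policy I m Ξ) (w : Outcome m Ξ) (k : ℕ) : Fin m → Option ℕ :=
  π.assign k w.1 (π.run w k).hist

/-- The packets in the system at epoch `k` that are not put in service by the decision taken
there. -/
def Policy.waiting (π : Policy I m Ξ) (w : Outcome m Ξ) (k : ℕ) : Set ℕ :=
  {i | i ∈ I.inSystem (π.run w k).hist ∧ ∀ j, π.decision w k j ≠ some i}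

/-- The time `c_i` at which packet `i` is delivered (`⊤` if it never is). -/
noncomputable def Policy.completion (π : Policy I m Ξ) (w : Outcome m Ξ) (i : ℕ) : ℝ≥0∞ :=
  sInf {t | ∃ k j, (π.obs w k).delivered j = some i ∧ t = (π.obs w k).time}

/-- `γ(t)`, the number of packets delivered up to time `t`. -/
noncomputable def Policy.deliveredCount (π : Policy I m Ξ) (w : Outcome m Ξ) (t : ℝ≥0) : ℕ :=
  {i : ℕ | (i : ℕ∞) < I.n ∧ π.completion w i ≤ t}.ncard

/-- `N(t)`, the number of packets in the system at time `t`. -/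
noncomputable def Policy.queueLength (π : Policy I m Ξ) (w : Outcome m Ξ) (t : ℝ≥0) : ℕ :=
  {i : ℕ | (i : ℕ∞) < I.n ∧ I.arr i ≤ t ∧ (t : ℝ≥0∞) < π.completion w i}.ncard

end Dynamics

/-- The number of packets that arrive up to time `T`. -/
noncomputable def Input.arrivalCount (I : Input) (T : ℝ≥0) : ℕ :=
  {i : ℕ | (i : ℕ∞) < I.n ∧ I.arr i ≤ T}.ncard

section Random

variable {I : Input} {Ξ : Type*} [MeasurableSpace Ξ] {Ω : Type*} [MeasurableSpace Ω]

/-- Membership in the class of causal policies: almost surely there are only finitely many decision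
epochs in every bounded time interval. -/
def Policy.Admissible (π : Policy I m Ξ) (P : Measure Ω) (W : Ω → Outcome m Ξ) : Prop :=
  ∀ᵐ ω ∂P, Tendsto (fun k => (π.obs (W ω) k).time) atTop (𝓝 ⊤)

/-- No server is idle while packets are waiting. -/
def Policy.WorkConserving (π : Policy I m Ξ) (P : Measure Ω) (W : Ω → Outcome m Ξ) : Prop :=
  ∀ᵐ ω ∂P, ∀ k, (π.obs (W ω) k).time ≠ ⊤ →
    ∀ j, π.decision (W ω) k j = none → π.waiting (W ω) k = ∅

/-- The preemptive Last Generated First Served rule, with arbitrary tie-breaking: decisions are only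
made at arrivals and deliveries; no server idles while packets are waiting; no waiting packet is
fresher than a packet under service; and an ongoing service is interrupted only in favour of a
strictly fresher packet, the preempted packet going back to the queue. -/
def Policy.IsPrmpLGFS (π : Policy I m Ξ) (P : Measure Ω) (W : Ω → Outcome m Ξ) : Prop :=
  ∀ᵐ ω ∂P, ∀ k, (π.obs (W ω) k).time ≠ ⊤ →
    π.review k (W ω).1 (π.run (W ω) k).hist = ⊤ ∧
    (∀ j, π.decision (W ω) k j = none → π.waiting (W ω) k = ∅) ∧
    (∀ j i, π.decision (W ω) k j = some i → ∀ i' ∈ π.waiting (W ω) k, I.gen i' ≤ I.gen i) ∧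
    (∀ j i, (π.obs (W ω) k).serving j = some i →
      π.decision (W ω) k j = some i ∨
      (i ∈ π.waiting (W ω) k ∧ ∃ i', π.decision (W ω) k j = some i' ∧ I.gen i < I.gen i'))

/-- Stochastic ordering of processes indexed by `[0, ∞)`: the finite-dimensional distributions
are ordered on all upper sets. -/
def StochLE (P : Measure Ω) (X Y : ℝ≥0 → Ω → ℕ) : Prop :=
  ∀ (r : ℕ) (t : Fin r → ℝ≥0), StrictMono t → ∀ U : Set (Fin r → ℕ), IsUpperSet U →
    P {ω | (fun l => X (t l) ω) ∈ U} ≤ P {ω | (fun l => Y (t l) ω) ∈ U}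

/-- The throughput on `[0, T]`: the expected number of deliveries per unit of time. -/
noncomputable def Policy.throughput (π : Policy I m Ξ) (P : Measure Ω) (W : Ω → Outcome m Ξ)
    (T : ℝ≥0) : ℝ≥0∞ :=
  (∫⁻ ω, (π.deliveredCount (W ω) T : ℝ≥0∞) ∂P) / T

/-- The mean delay on `[0, T]`: the expected time spent in the system during `[0, T]`, averaged
over the packets that arrive in `[0, T]`. -/
noncomputable def Policy.meanDelayUpTo (π : Policy I m Ξ) (P : Measure Ω) (W : Ω → Outcome m Ξ)
    (T : ℝ≥0) : ℝ≥0∞ :=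
  open Classical in
  (∑' i : ℕ, if (i : ℕ∞) < I.n ∧ I.arr i ≤ T then
      ∫⁻ ω, (min (π.completion (W ω) i) T - I.arr i) ∂P else 0) / I.arrivalCount T

/-- The sum over all packets of the expected delays `c_i - a_i`. -/
noncomputable def Policy.totalDelay (π : Policy I m Ξ) (P : Measure Ω) (W : Ω → Outcome m Ξ) :
    ℝ≥0∞ :=
  open Classical in
  ∑' i : ℕ, if (i : ℕ∞) < I.n then ∫⁻ ω, (π.completion (W ω) i - I.arr i) ∂P else 0

/-- `π` maximizes the throughput among all causal policies: its delivery process is stochastically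
largest, and so are its throughput on every horizon and its long-run throughput. -/
def Policy.ThroughputOptimal (π : Policy I m Ξ) (P : Measure Ω) (W : Ω → Outcome m Ξ) : Prop :=
  ∀ π' : Policy I m Ξ, π'.Admissible P W →
    StochLE P (fun t ω => π'.deliveredCount (W ω) t) (fun t ω => π.deliveredCount (W ω) t) ∧
    (∀ T : ℝ≥0, 0 < T → π'.throughput P W T ≤ π.throughput P W T) ∧
    liminf (π'.throughput P W) atTop ≤ liminf (π.throughput P W) atTop ∧
    limsup (π'.throughput P W) atTop ≤ limsup (π.throughput P W) atTop

/-- `π` minimizes the mean delay among all causal policies: its queue-length process is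
stochastically smallest; its mean delay on every horizon and its long-run mean delay are smallest;
the total expected delay is smallest; and, if there are finitely many packets, so is the mean delay
per packet. -/
def Policy.MeanDelayOptimal (π : Policy I m Ξ) (P : Measure Ω) (W : Ω → Outcome m Ξ) : Prop :=
  ∀ π' : Policy I m Ξ, π'.Admissible P W →
    StochLE P (fun t ω => π.queueLength (W ω) t) (fun t ω => π'.queueLength (W ω) t) ∧
    (∀ T : ℝ≥0, π.meanDelayUpTo P W T ≤ π'.meanDelayUpTo P W T) ∧
    liminf (π.meanDelayUpTo P W) atTop ≤ liminf (π'.meanDelayUpTo P W) atTop ∧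
    limsup (π.meanDelayUpTo P W) atTop ≤ limsup (π'.meanDelayUpTo P W) atTop ∧
    π.totalDelay P W ≤ π'.totalDelay P W ∧
    (∀ n : ℕ, I.n = n → π.totalDelay P W / n ≤ π'.totalDelay P W / n)

end Random

end UpdateSystem

/-! The right clock is work: the total service effort spent by all servers, measured in server-time.
While `b` servers are busy, the next completion comes after the minimum of `b` independent
exponential residuals, so the work until a delivery has the law of one service time, whatever `b`
is. Preemptions, reviews and arrivals cannot change this, because exponential residuals restart
afresh. Hence, under every causal policy, the amounts of work between successive deliveries are
i.i.d. exponential (`Policy.map_combine_record`). This rests on `Policy.map_visible_residual`: at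
every epoch the residual services are i.i.d. and independent of everything the policy sees. Its
inductive step is `lintegral_residual`, memorylessness at the first completion.

What remains is deterministic. Fix the amounts of work `E`. With `i` packets delivered at time `s`,
at most `min m (A(s) - i)` servers can be busy, and exactly that many are busy under work
conservation. A policy that always works at this maximal rate has delivery times determined by `E`
(`idealTime`). No policy with the same `E` delivers earlier (`Policy.idealTime_le`), and a
work-conserving one delivers no later (`Policy.time_le_idealTime`). So each `γ` is bounded by
`idealCount E`, with equality under work conservation, and `E` has the same law for all policies.
Different policies need not be coupled to each other: they are compared through the product law of
`E`.

This orders the delivery processes stochastically and makes all work-conserving ones equal in law.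
Since `N = A - γ`, the queue lengths are ordered the other way. Expected throughput follows by
taking means, and delay because the summed delays are the time integral of the queue length
(`Policy.tsum_delay_eq`).

Generation times play no role in optimality: a prmp-LGFS policy matters only as a work-conserving
policy without reviews, and the absence of reviews makes it admissible. Generation times enter only
in the construction of such a policy (`exists_isLGFSAssignment`). -/

namespace UpdateSystem

/-! ### Memoryless laws on `[0, ∞]` and the exponential service law. -/

section Memoryless

/-- A law on `[0, ∞]` whose tail is multiplicative. -/
def Memoryless (ρ : Measure ℝ≥0∞) : Prop :=
  ∀ c d, ρ (Set.Ioi (c + d)) = ρ (Set.Ioi c) * ρ (Set.Ioi d)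

/-- No half-line `Set.Ioi c` contains `0`, so the mass at `0` is pinned down by the total mass. -/
lemma measure_ext_of_Ioi {κ κ' : Measure ℝ≥0∞} [IsFiniteMeasure κ]
    (huniv : κ Set.univ = κ' Set.univ) (h : ∀ c, κ (Set.Ioi c) = κ' (Set.Ioi c)) : κ = κ' := by
  refine ext_of_generate_finite (Set.range Set.Ioi) ?_ isPiSystem_Ioi ?_ huniv
  · rw [← borel_eq_generateFrom_Ioi]
    exact BorelSpace.measurable_eq
  · rintro _ ⟨c, rfl⟩
    exact h c

/-- The law of a service time, with values in `[0, ∞]`. -/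
noncomputable def serviceLaw (μ : ℝ) : Measure ℝ≥0∞ := (expMeasure μ).map ENNReal.ofReal

lemma isProbabilityMeasure_serviceLaw {μ : ℝ} (hμ : 0 < μ) :
    IsProbabilityMeasure (serviceLaw μ) := by
  have := isProbabilityMeasure_expMeasure hμ
  exact Measure.isProbabilityMeasure_map ENNReal.measurable_ofReal.aemeasurable

lemma serviceLaw_Ioi {μ : ℝ} (hμ : 0 < μ) (c : ℝ≥0) :
    serviceLaw μ (Set.Ioi (c : ℝ≥0∞)) = ENNReal.ofReal (Real.exp (-(μ * c))) := by
  have := isProbabilityMeasure_expMeasure hμ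
  have hpre : ENNReal.ofReal ⁻¹' Set.Ioi (c : ℝ≥0∞) = (Set.Iic (c : ℝ))ᶜ := by
    ext x
    simp only [Set.mem_preimage, Set.mem_Ioi, Set.mem_compl_iff, Set.mem_Iic, not_le]
    rw [← ENNReal.ofReal_coe_nnreal]
    by_cases hx : 0 < x
    · exact ENNReal.ofReal_lt_ofReal_iff hx
    · have h0 : ENNReal.ofReal x = 0 := ENNReal.ofReal_eq_zero.2 (not_lt.1 hx)
      rw [h0]
      constructor
      · intro h
        simp at h
      · intro h
        exact absurd (c.2.trans_lt h) hx
  have hcdf : expMeasure μ (Set.Iic (c : ℝ)) = ENNReal.ofReal (1 - Real.exp (-(μ * c))) := by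
    rw [← ofReal_cdf, cdf_expMeasure_eq hμ, if_pos (NNReal.coe_nonneg c)]
  rw [serviceLaw, Measure.map_apply ENNReal.measurable_ofReal measurableSet_Ioi, hpre,
    prob_compl_eq_one_sub measurableSet_Iic, hcdf, ← ENNReal.ofReal_one,
    ← ENNReal.ofReal_sub _ (by
      rw [sub_nonneg, Real.exp_le_one_iff, Left.neg_nonpos_iff]
      exact mul_nonneg hμ.le c.2)]
  congr 1
  ring

lemma memoryless_serviceLaw {μ : ℝ} (hμ : 0 < μ) : Memoryless (serviceLaw μ) := by
  intro c d
  induction c using ENNReal.recTopCoe with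
  | top => simp
  | coe c =>
    induction d using ENNReal.recTopCoe with
    | top => simp
    | coe d =>
      rw [← ENNReal.coe_add, serviceLaw_Ioi hμ, serviceLaw_Ioi hμ, serviceLaw_Ioi hμ,
        ← ENNReal.ofReal_mul (Real.exp_pos _).le, ← Real.exp_add]
      congr 2
      push_cast
      ring

lemma nullSingletonClass_serviceLaw {μ : ℝ} (hμ : 0 < μ) : NullSingletonClass (serviceLaw μ) := by
  have := isProbabilityMeasure_expMeasure hμ
  have hna : NullSingletonClass (expMeasure μ) := by
    rw [expMeasure, gammaMeasure]
    infer_instance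
  have hneg : expMeasure μ (Set.Iic 0) = 0 := by
    rw [← ofReal_cdf, cdf_expMeasure_eq hμ]
    simp
  refine ⟨fun c => ?_⟩
  rw [serviceLaw, Measure.map_apply ENNReal.measurable_ofReal (measurableSet_singleton c)]
  -- `ENNReal.ofReal` collapses the negative half-line to `0`, so the fibre over `0` is not a point;
  -- the exponential law does not charge that half-line.
  refine measure_mono_null (t := Set.Iic 0 ∪ {c.toReal}) ?_ ?_
  · intro x hx
    by_cases h0 : x ≤ 0
    · exact Or.inl h0
    · right
      have hx' : ENNReal.ofReal x = c := hx
      rw [Set.mem_singleton_iff, ← hx', ENNReal.toReal_ofReal (not_le.1 h0).le]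
  · exact measure_union_null hneg (measure_singleton _)

variable {ρ : Measure ℝ≥0∞} [IsProbabilityMeasure ρ]

lemma measure_Ioi_zero [NullSingletonClass ρ] : ρ (Set.Ioi 0) = 1 := by
  have h0 : (Set.Ioi (0 : ℝ≥0∞)) = {0}ᶜ := by
    ext x
    simp [pos_iff_ne_zero]
  rw [h0, prob_compl_eq_one_sub (measurableSet_singleton _), measure_singleton, tsub_zero]

/-- The left side is the probability that `b` independent services all exceed `c`. In terms of work
`b * c` this is the tail of a single service, which is why work is a clock independent of the number
of busy servers. At `b = 0` the absence of an atom at `0` is needed. -/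
lemma Memoryless.tail_pow (h : Memoryless ρ) [NullSingletonClass ρ] (c : ℝ≥0∞) (b : ℕ) :
    ρ (Set.Ioi c) ^ b = ρ (Set.Ioi (b * c)) := by
  induction b with
  | zero => simp [measure_Ioi_zero]
  | succ b ih => rw [pow_succ, ih, ← h, Nat.cast_succ, add_mul, one_mul]

/-- Tails determine a finite measure, so the multiplicative rule for tails passes to all events
about the overshoot beyond `c`. -/
lemma Memoryless.measure_Ioi_inter (h : Memoryless ρ) (c : ℝ≥0∞) {s : Set ℝ≥0∞}
    (hs : MeasurableSet s) :
    ρ (Set.Ioi c ∩ (fun r => r - c) ⁻¹' s) = ρ (Set.Ioi c) * ρ s := by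
  have hm : Measurable fun r : ℝ≥0∞ => r - c := measurable_id.sub_const c
  have key : (ρ.restrict (Set.Ioi c)).map (fun r => r - c) = ρ (Set.Ioi c) • ρ := by
    refine measure_ext_of_Ioi ?_ fun d => ?_
    · rw [Measure.map_apply hm MeasurableSet.univ]
      simp
    · rw [Measure.map_apply hm measurableSet_Ioi,
        Measure.restrict_apply (hm measurableSet_Ioi), Measure.smul_apply, smul_eq_mul, ← h]
      congr 1
      ext r
      simp only [Set.mem_inter_iff, Set.mem_preimage, Set.mem_Ioi]
      rw [lt_tsub_iff_left]
      exact ⟨fun hr => hr.1, fun hr => ⟨hr, le_self_add.trans_lt hr⟩⟩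
  have := congrArg (fun κ : Measure ℝ≥0∞ => κ s) key
  rw [Measure.map_apply hm hs, Measure.restrict_apply (hm hs), Measure.smul_apply,
    smul_eq_mul, Set.inter_comm] at this
  exact this

end Memoryless

/-! ### Resampling one coordinate of a product measure. -/

section Update

variable {ρ : Measure ℝ≥0∞} [IsProbabilityMeasure ρ]

lemma map_update_pi {ι : Type*} [Fintype ι] [DecidableEq ι] (i : ι) :
    (ρ.prod (Measure.pi fun _ : ι => ρ)).map (fun p => Function.update p.2 i p.1) =
      Measure.pi fun _ : ι => ρ := by
  have hm : Measurable fun p : ℝ≥0∞ × (ι → ℝ≥0∞) => Function.update p.2 i p.1 :=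
    measurable_update'.comp (measurable_snd.prodMk measurable_fst)
  symm
  refine Measure.pi_eq fun s hs => ?_
  rw [Measure.map_apply hm (MeasurableSet.univ_pi hs)]
  have : (fun p : ℝ≥0∞ × (ι → ℝ≥0∞) => Function.update p.2 i p.1) ⁻¹' Set.univ.pi s =
      s i ×ˢ Set.univ.pi (Function.update s i Set.univ) := by
    ext ⟨r, R⟩
    simp only [Set.mem_preimage, Set.mem_univ_pi, Set.mem_prod]
    constructor
    · intro h
      refine ⟨by simpa using h i, fun j => ?_⟩
      by_cases hj : j = i
      · subst hj; simp
      · simpa [hj] using h j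
    · rintro ⟨h1, h2⟩ j
      by_cases hj : j = i
      · subst hj; simpa using h1
      · simpa [hj] using h2 j
  rw [this, Measure.prod_prod, Measure.pi_pi, ← Finset.mul_prod_erase _ _ (Finset.mem_univ i),
    ← Finset.mul_prod_erase _ _ (Finset.mem_univ i)]
  simp only [Function.update_self, measure_univ, one_mul]
  congr 1
  refine Finset.prod_congr rfl fun j hj => ?_
  rw [Function.update_of_ne (Finset.ne_of_mem_erase hj)]

lemma map_update_infinitePi (i : ℕ) :
    (ρ.prod (Measure.infinitePi fun _ : ℕ => ρ)).map (fun p => Function.update p.2 i p.1) =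
      Measure.infinitePi fun _ : ℕ => ρ := by
  have hm : Measurable fun p : ℝ≥0∞ × (ℕ → ℝ≥0∞) => Function.update p.2 i p.1 :=
    measurable_update'.comp (measurable_snd.prodMk measurable_fst)
  refine Measure.eq_infinitePi _ fun s t ht => ?_
  rw [Measure.map_apply hm (MeasurableSet.pi s.countable_toSet fun j _ => ht j)]
  by_cases hi : i ∈ s
  · have : (fun p : ℝ≥0∞ × (ℕ → ℝ≥0∞) => Function.update p.2 i p.1) ⁻¹' (s : Set ℕ).pi t =
        t i ×ˢ ((s.erase i : Finset ℕ) : Set ℕ).pi t := by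
      ext ⟨r, R⟩
      simp only [Set.mem_preimage, Set.mem_pi, Set.mem_prod, Finset.mem_coe, Finset.mem_erase]
      constructor
      · intro h
        exact ⟨by simpa using h i hi, fun j hj => by simpa [hj.1] using h j hj.2⟩
      · rintro ⟨h1, h2⟩ j hj
        by_cases hji : j = i
        · subst hji; simpa using h1
        · simpa [hji] using h2 j ⟨hji, hj⟩
    rw [this, Measure.prod_prod, Measure.infinitePi_pi _ fun j _ => ht j,
      Finset.mul_prod_erase _ (fun j => ρ (t j)) hi]
  · have : (fun p : ℝ≥0∞ × (ℕ → ℝ≥0∞) => Function.update p.2 i p.1) ⁻¹' (s : Set ℕ).pi t =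
        Set.univ ×ˢ (s : Set ℕ).pi t := by
      ext ⟨r, R⟩
      simp only [Set.mem_preimage, Set.mem_pi, Set.mem_prod, Finset.mem_coe, Set.mem_univ,
        true_and]
      refine forall₂_congr fun j hj => ?_
      rw [Function.update_of_ne (ne_of_mem_of_not_mem hj hi)]
    rw [this, Measure.prod_prod, measure_univ, one_mul, Measure.infinitePi_pi _ fun j _ => ht j]

/-- Isolates one coordinate as an outer integration variable: the service that completes, or one of
two tied services. -/
lemma lintegral_update_pi {ι : Type*} [Fintype ι] [DecidableEq ι] (i : ι)
    {f : (ι → ℝ≥0∞) → ℝ≥0∞} (hf : Measurable f) :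
    ∫⁻ R, f R ∂(Measure.pi fun _ : ι => ρ) =
      ∫⁻ r, ∫⁻ R, f (Function.update R i r) ∂(Measure.pi fun _ : ι => ρ) ∂ρ := by
  have hm : Measurable fun p : ℝ≥0∞ × (ι → ℝ≥0∞) => Function.update p.2 i p.1 :=
    measurable_update'.comp (measurable_snd.prodMk measurable_fst)
  conv_lhs => rw [← map_update_pi (ρ := ρ) i]
  rw [lintegral_map hf hm, lintegral_prod]
  exact (hf.comp hm).aemeasurable

lemma lintegral_update_infinitePi (i : ℕ) {f : (ℕ → ℝ≥0∞) → ℝ≥0∞} (hf : Measurable f) :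
    ∫⁻ R, f R ∂(Measure.infinitePi fun _ : ℕ => ρ) =
      ∫⁻ r, ∫⁻ R, f (Function.update R i r) ∂(Measure.infinitePi fun _ : ℕ => ρ) ∂ρ := by
  have hm : Measurable fun p : ℝ≥0∞ × (ℕ → ℝ≥0∞) => Function.update p.2 i p.1 :=
    measurable_update'.comp (measurable_snd.prodMk measurable_fst)
  conv_lhs => rw [← map_update_infinitePi (ρ := ρ) i]
  rw [lintegral_map hf hm, lintegral_prod]
  exact (hf.comp hm).aemeasurable

end Update

/-! ### Residuals of several independent memoryless services at a fixed level. -/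

section ProductMemoryless

variable {ρ : Measure ℝ≥0∞} [IsProbabilityMeasure ρ] {ι : Type*} [Fintype ι] [DecidableEq ι]

omit [Fintype ι] in
lemma measurable_piecewise_sub (C : Finset ι) (c : ℝ≥0∞) :
    Measurable fun p : (ι → ℝ≥0∞) × (ι → ℝ≥0∞) =>
      C.piecewise (fun j => p.1 j - c) p.2 := by
  refine measurable_pi_iff.2 fun j => ?_
  by_cases hj : j ∈ C
  · simp only [Finset.piecewise_eq_of_mem _ _ _ hj]
    exact Measurable.sub_const (f := fun p : (ι → ℝ≥0∞) × (ι → ℝ≥0∞) => p.1 j)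
      ((measurable_pi_apply j).comp measurable_fst) c
  · simp only [Finset.piecewise_eq_of_notMem _ _ _ hj]
    exact (measurable_pi_apply j).comp measurable_snd

omit [Fintype ι] [DecidableEq ι] in
lemma measurableSet_forall_lt (B : Finset ι) (c : ℝ≥0∞) :
    MeasurableSet {R : ι → ℝ≥0∞ | ∀ j ∈ B, c < R j} := by
  have : {R : ι → ℝ≥0∞ | ∀ j ∈ B, c < R j} = (B : Set ι).pi fun _ => Set.Ioi c := by
    ext R
    simp [Set.mem_pi]
  rw [this]
  exact MeasurableSet.pi B.countable_toSet fun _ _ => measurableSet_Ioi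

/-- Residuals beyond `c` of a part `C` of the coordinates that exceed `c`, completed by fresh
coordinates, are again independent: the resulting measure does not depend on `C`. -/
lemma map_piecewise_sub_restrict (h : Memoryless ρ) {B C : Finset ι} (hC : C ⊆ B) (c : ℝ≥0∞) :
    (((Measure.pi fun _ : ι => ρ).prod (Measure.pi fun _ : ι => ρ)).restrict
      ({R | ∀ j ∈ B, c < R j} ×ˢ Set.univ)).map
        (fun p => C.piecewise (fun j => p.1 j - c) p.2) =
      Measure.pi fun j => (if j ∈ B then ρ (Set.Ioi c) else 1) • ρ := by
  have hfin : ∀ j, IsFiniteMeasure ((if j ∈ B then ρ (Set.Ioi c) else 1) • ρ) := fun j =>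
    Measure.smul_finite ρ (by split_ifs <;> simp)
  symm
  refine Measure.pi_eq fun s hs => ?_
  rw [Measure.map_apply (measurable_piecewise_sub C c) (MeasurableSet.univ_pi hs),
    Measure.restrict_apply (measurable_piecewise_sub C c (MeasurableSet.univ_pi hs))]
  have : (fun p : (ι → ℝ≥0∞) × (ι → ℝ≥0∞) => C.piecewise (fun j => p.1 j - c) p.2) ⁻¹'
        Set.univ.pi s ∩ ({R | ∀ j ∈ B, c < R j} ×ˢ Set.univ) =
      (Set.univ.pi fun j => if j ∈ C then Set.Ioi c ∩ (fun r => r - c) ⁻¹' s j else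
        if j ∈ B then Set.Ioi c else Set.univ) ×ˢ
      (Set.univ.pi fun j => if j ∈ C then Set.univ else s j) := by
    ext ⟨R, Y⟩
    simp only [Set.mem_inter_iff, Set.mem_preimage, Set.mem_univ_pi, Set.mem_prod,
      Set.mem_ofPred_eq, Set.mem_univ, and_true]
    rw [← forall_and, ← forall_and]
    refine forall_congr' fun j => ?_
    by_cases hjC : j ∈ C
    · simp [hjC, hC hjC, and_comm]
    · by_cases hjB : j ∈ B <;> simp [hjC, hjB, and_comm]
  rw [this, Measure.prod_prod, Measure.pi_pi, Measure.pi_pi, ← Finset.prod_mul_distrib]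
  refine Finset.prod_congr rfl fun j _ => ?_
  rw [Measure.smul_apply, smul_eq_mul]
  by_cases hjC : j ∈ C
  · simp only [hjC, hC hjC, if_true, measure_univ, mul_one]
    exact h.measure_Ioi_inter c (hs j)
  · by_cases hjB : j ∈ B <;> simp [hjC, hjB]

lemma lintegral_piecewise_sub (h : Memoryless ρ) {B C : Finset ι} (hC : C ⊆ B) (c : ℝ≥0∞)
    {ψ : (ι → ℝ≥0∞) → ℝ≥0∞} (hψ : Measurable ψ) :
    ∫⁻ R in {R | ∀ j ∈ B, c < R j},
        ∫⁻ Y, ψ (C.piecewise (fun j => R j - c) Y) ∂(Measure.pi fun _ => ρ)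
        ∂(Measure.pi fun _ : ι => ρ) =
      ∫⁻ _ in {R | ∀ j ∈ B, c < R j}, ∫⁻ Y, ψ Y ∂(Measure.pi fun _ => ρ)
        ∂(Measure.pi fun _ : ι => ρ) := by
  have key : ∀ C : Finset ι, C ⊆ B →
      ∫⁻ R in {R | ∀ j ∈ B, c < R j},
        ∫⁻ Y, ψ (C.piecewise (fun j => R j - c) Y) ∂(Measure.pi fun _ => ρ)
        ∂(Measure.pi fun _ : ι => ρ) =
      ∫⁻ y, ψ y ∂(Measure.pi fun j => (if j ∈ B then ρ (Set.Ioi c) else 1) • ρ) := by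
    intro C hC
    rw [← map_piecewise_sub_restrict h hC c, lintegral_map hψ (measurable_piecewise_sub C c),
      ← Measure.prod_restrict, Measure.restrict_univ, lintegral_prod]
    exact (hψ.comp (measurable_piecewise_sub C c)).aemeasurable
  -- With `C = ∅` nothing of `R` is kept, so the common value is the integral with all coordinates
  -- fresh.
  rw [key C hC, ← key ∅ (Finset.empty_subset B)]
  simp

end ProductMemoryless

/-! ### The first completion among the busy servers, before a horizon `D`. -/

section FirstCompletion

variable {ι : Type*} [Fintype ι] [DecidableEq ι]

/-- The time until the first completion among the servers in `B`, or until `D`. -/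
noncomputable def firstTime (B : Finset ι) (D : ℝ≥0∞) (R : ι → ℝ≥0∞) : ℝ≥0∞ := D ⊓ B.inf R

/-- The servers that complete their service at the first completion time. -/
noncomputable def firstSet (B : Finset ι) (D : ℝ≥0∞) (R : ι → ℝ≥0∞) : Finset ι :=
  {j ∈ B | R j ≤ firstTime B D R}

omit [Fintype ι] [DecidableEq ι] in
lemma firstTime_le {B : Finset ι} {j : ι} (hj : j ∈ B) (D : ℝ≥0∞) (R : ι → ℝ≥0∞) :
    firstTime B D R ≤ R j :=
  inf_le_right.trans (Finset.inf_le hj)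

omit [Fintype ι] [DecidableEq ι] in
lemma eq_firstTime_of_mem {B : Finset ι} {D : ℝ≥0∞} {R : ι → ℝ≥0∞} {j : ι}
    (hj : j ∈ firstSet B D R) : R j = firstTime B D R :=
  le_antisymm (Finset.mem_filter.1 hj).2 (firstTime_le (Finset.mem_filter.1 hj).1 D R)

-- The inequality is strict because a service that ends exactly at the horizon counts as completed.
omit [Fintype ι] [DecidableEq ι] in
lemma firstSet_eq_empty_iff {B : Finset ι} {D : ℝ≥0∞} {R : ι → ℝ≥0∞} :
    firstSet B D R = ∅ ↔ ∀ j ∈ B, D < R j := by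
  constructor
  · intro h j hj
    by_contra hlt
    have hne : B.Nonempty := ⟨j, hj⟩
    obtain ⟨j', hj', he⟩ := Finset.exists_mem_eq_inf B hne R
    have : j' ∈ firstSet B D R := by
      refine Finset.mem_filter.2 ⟨hj', le_inf ?_ he.ge⟩
      exact (he.ge.trans (Finset.inf_le hj)).trans (not_lt.1 hlt)
    simp [h] at this
  · intro h
    refine Finset.filter_eq_empty_iff.2 fun j hj hle => ?_
    exact absurd (hle.trans inf_le_left) (not_le.2 (h j hj))

omit [Fintype ι] [DecidableEq ι] in
lemma firstTime_of_empty {B : Finset ι} {D : ℝ≥0∞} {R : ι → ℝ≥0∞}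
    (h : firstSet B D R = ∅) : firstTime B D R = D :=
  inf_eq_left.2 (Finset.le_inf fun j hj => (firstSet_eq_empty_iff.1 h j hj).le)

omit [Fintype ι] in
lemma firstSet_eq_singleton_iff {B : Finset ι} {D : ℝ≥0∞} {R : ι → ℝ≥0∞} {i : ι} (hi : i ∈ B) :
    firstSet B D R = {i} ↔ R i ≤ D ∧ ∀ j ∈ B.erase i, R i < R j := by
  constructor
  · intro h
    have hmem : i ∈ firstSet B D R := by simp [h]
    have he := eq_firstTime_of_mem hmem
    refine ⟨he.le.trans inf_le_left, fun j hj => ?_⟩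
    rw [he]
    refine lt_of_le_of_ne (firstTime_le (Finset.mem_of_mem_erase hj) D R) fun hcon => ?_
    have : j ∈ firstSet B D R := Finset.mem_filter.2 ⟨Finset.mem_of_mem_erase hj, hcon.ge⟩
    rw [h, Finset.mem_singleton] at this
    exact Finset.ne_of_mem_erase hj this
  · rintro ⟨h1, h2⟩
    have he : firstTime B D R = R i := by
      refine le_antisymm (firstTime_le hi D R) (le_inf h1 (Finset.le_inf fun j hj => ?_))
      by_cases hji : j = i
      · rw [hji]
      · exact (h2 j (Finset.mem_erase.2 ⟨hji, hj⟩)).le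
    ext j
    simp only [firstSet, Finset.mem_filter, Finset.mem_singleton, he]
    constructor
    · rintro ⟨hj, hle⟩
      by_contra hji
      exact absurd hle (not_le.2 (h2 j (Finset.mem_erase.2 ⟨hji, hj⟩)))
    · rintro rfl
      exact ⟨hi, le_rfl⟩

omit [Fintype ι] [DecidableEq ι] in
lemma measurable_firstTime (B : Finset ι) :
    Measurable fun p : ℝ≥0∞ × (ι → ℝ≥0∞) => firstTime B p.1 p.2 := by
  refine measurable_fst.inf ?_
  have : Measurable fun R : ι → ℝ≥0∞ => B.inf R := by
    classical
    induction B using Finset.induction_on with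
    | empty => simp
    | insert j B _ ih =>
      simp only [Finset.inf_insert]
      exact (measurable_pi_apply j).inf ih
  exact this.comp measurable_snd

lemma measurableSet_firstSet (B S : Finset ι) :
    MeasurableSet {p : ℝ≥0∞ × (ι → ℝ≥0∞) | firstSet B p.1 p.2 = S} := by
  have : {p : ℝ≥0∞ × (ι → ℝ≥0∞) | firstSet B p.1 p.2 = S} =
      ⋂ j, {p | (j ∈ B ∧ p.2 j ≤ firstTime B p.1 p.2) ↔ j ∈ S} := by
    ext p
    simp only [Set.mem_ofPred_eq, Set.mem_iInter, Finset.ext_iff, firstSet, Finset.mem_filter]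
  rw [this]
  refine MeasurableSet.iInter fun j => ?_
  have h1 : MeasurableSet {p : ℝ≥0∞ × (ι → ℝ≥0∞) | p.2 j ≤ firstTime B p.1 p.2} :=
    measurableSet_le ((measurable_pi_apply j).comp measurable_snd) (measurable_firstTime B)
  by_cases hB : j ∈ B <;> by_cases hS : j ∈ S
  · simpa [hB, hS] using h1
  · simp only [hB, hS, true_and, iff_false]
    exact h1.compl
  · simp [hB, hS]
  · simp [hB, hS]

variable {ρ : Measure ℝ≥0∞} [IsProbabilityMeasure ρ] [NullSingletonClass ρ]

/-- A law without atoms gives no ties: with the other coordinates fixed, coordinate `i` would have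
to hit a single point. -/
lemma ae_injective_pi : ∀ᵐ R ∂(Measure.pi fun _ : ι => ρ), Function.Injective R := by
  have h : ∀ i j : ι, i ≠ j → ∀ᵐ R ∂(Measure.pi fun _ : ι => ρ), R i ≠ R j := by
    intro i j hij
    have hms : MeasurableSet {R : ι → ℝ≥0∞ | R i = R j} :=
      measurableSet_eq_fun (measurable_pi_apply i) (measurable_pi_apply j)
    have : (Measure.pi fun _ : ι => ρ) {R : ι → ℝ≥0∞ | R i = R j} = 0 := by
      rw [← lintegral_indicator_one hms,
        lintegral_update_pi (ρ := ρ) i (measurable_one.indicator hms)]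
      rw [lintegral_lintegral_swap]
      · refine (lintegral_congr fun R => ?_).trans lintegral_zero
        have hs : (fun r => ({R : ι → ℝ≥0∞ | R i = R j}.indicator 1 (Function.update R i r) : ℝ≥0∞))
            = ({R j} : Set ℝ≥0∞).indicator 1 := by
          funext r
          simp [Set.indicator, Function.update_of_ne hij.symm]
        rw [hs, lintegral_indicator_one (measurableSet_singleton _), measure_singleton]
      · exact ((measurable_one.indicator hms).comp (measurable_update'.comp
          (measurable_snd.prodMk measurable_fst))).aemeasurable
    rw [ae_iff]
    simpa using this
  have h' : ∀ᵐ R ∂(Measure.pi fun _ : ι => ρ), ∀ i j : ι, i ≠ j → R i ≠ R j := by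
    rw [ae_all_iff]
    intro i
    rw [ae_all_iff]
    intro j
    by_cases hij : i = j
    · simp [hij]
    · filter_upwards [h i j hij] with R hR _ using hR
  filter_upwards [h'] with R hR i j hij
  by_contra hne
  exact hR i j hne hij

omit [Fintype ι] [DecidableEq ι] in
lemma firstSet_card_le_one {B : Finset ι} {D : ℝ≥0∞} {R : ι → ℝ≥0∞}
    (hR : Function.Injective R) : (firstSet B D R).card ≤ 1 :=
  Finset.card_le_one.2 fun _ hi _ hj =>
    hR ((eq_firstTime_of_mem hi).trans (eq_firstTime_of_mem hj).symm)

omit [Fintype ι] in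
lemma measurable_residual {C : ℝ≥0∞ → Finset ι}
    (hC : ∀ j, MeasurableSet {l | j ∈ C l}) {T : (ι → ℝ≥0∞) → ℝ≥0∞} (hT : Measurable T) :
    Measurable fun p : (ι → ℝ≥0∞) × (ι → ℝ≥0∞) =>
      (C (T p.1)).piecewise (fun j => p.1 j - T p.1) p.2 := by
  refine measurable_pi_iff.2 fun j => ?_
  simp only [Finset.piecewise]
  refine Measurable.ite ?_ ?_ ?_
  · exact (hT.comp measurable_fst) (hC j)
  · exact ((measurable_pi_apply j).comp measurable_fst).sub (hT.comp measurable_fst)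
  · exact (measurable_pi_apply j).comp measurable_snd

/-- Memorylessness at the first completion: given the time and the servers of the first
completion, the residuals of surviving services are again independent with law `ρ`. -/
theorem lintegral_residual (h : Memoryless ρ) (B : Finset ι) (D : ℝ≥0∞)
    (C : Finset ι → ℝ≥0∞ → Finset ι) (hC : ∀ S l, C S l ⊆ B \ S)
    (hCm : ∀ S j, MeasurableSet {l | j ∈ C S l})
    (φ : Finset ι → ℝ≥0∞ → (ι → ℝ≥0∞) → ℝ≥0∞)
    (hφ : ∀ S, Measurable fun p : ℝ≥0∞ × (ι → ℝ≥0∞) => φ S p.1 p.2) :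
    ∫⁻ R, ∫⁻ Y, φ (firstSet B D R) (firstTime B D R)
        ((C (firstSet B D R) (firstTime B D R)).piecewise (fun j => R j - firstTime B D R) Y)
        ∂(Measure.pi fun _ => ρ) ∂(Measure.pi fun _ : ι => ρ) =
      ∫⁻ R, ∫⁻ Y, φ (firstSet B D R) (firstTime B D R) Y
        ∂(Measure.pi fun _ => ρ) ∂(Measure.pi fun _ : ι => ρ) := by
  set κ : Measure (ι → ℝ≥0∞) := Measure.pi fun _ : ι => ρ with hκ
  have hSet : ∀ S, MeasurableSet {R : ι → ℝ≥0∞ | firstSet B D R = S} := fun S =>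
    (measurable_const.prodMk measurable_id) (measurableSet_firstSet B S)
  -- The first completion time is random, so memorylessness at a fixed level does not apply
  -- directly. On each piece of this partition by the completing set, the time becomes either the
  -- constant `D` or a single coordinate.
  have hsplit : ∀ f : Finset ι → (ι → ℝ≥0∞) → ℝ≥0∞,
      ∫⁻ R, f (firstSet B D R) R ∂κ = ∑ S, ∫⁻ R in {R | firstSet B D R = S}, f S R ∂κ := by
    intro f
    have hu : (⋃ S : Finset ι, {R : ι → ℝ≥0∞ | firstSet B D R = S}) = Set.univ := by
      ext R; simp
    rw [← setLIntegral_univ, ← hu, lintegral_iUnion hSet, tsum_fintype]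
    · refine Finset.sum_congr rfl fun S _ => setLIntegral_congr_fun (hSet S) fun R hR => ?_
      simp only [Set.mem_ofPred_eq] at hR
      simp only [hR]
    · intro S S' hne
      refine Set.disjoint_left.2 fun R h1 h2 => hne ?_
      exact h1.symm.trans h2
  rw [hsplit fun S R => ∫⁻ Y, φ S (firstTime B D R)
      ((C S (firstTime B D R)).piecewise (fun j => R j - firstTime B D R) Y) ∂κ,
    hsplit fun S R => ∫⁻ Y, φ S (firstTime B D R) Y ∂κ]
  refine Finset.sum_congr rfl fun S _ => ?_
  rcases Nat.lt_trichotomy S.card 1 with hS | hS | hS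
  -- No completion: all services of `B` exceed the constant `D`.
  · obtain rfl : S = ∅ := Finset.card_eq_zero.1 (by omega)
    have he : {R : ι → ℝ≥0∞ | firstSet B D R = ∅} = {R | ∀ j ∈ B, D < R j} := by
      ext R; exact firstSet_eq_empty_iff
    have h1 := lintegral_piecewise_sub h (B := B) (C := C ∅ D)
      ((hC ∅ D).trans Finset.sdiff_subset) D (ψ := φ ∅ D)
      ((hφ ∅).comp (measurable_const.prodMk measurable_id))
    rw [← he] at h1
    refine Eq.trans (setLIntegral_congr_fun (hSet ∅) fun R hR => ?_)
      (h1.trans (setLIntegral_congr_fun (hSet ∅) fun R hR => ?_))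
    · have hR' : firstTime B D R = D := firstTime_of_empty hR
      rw [hR']
    · have hR' : firstTime B D R = D := firstTime_of_empty hR
      simp only [hR']
      rfl
  · obtain ⟨i, rfl⟩ := Finset.card_eq_one.1 hS
    by_cases hi : i ∈ B
    swap
    · have he : {R : ι → ℝ≥0∞ | firstSet B D R = {i}} = ∅ := by
        ext R
        simp only [Set.mem_ofPred_eq, Set.mem_empty_iff_false, iff_false]
        intro hR
        have : i ∈ firstSet B D R := by simp [hR]
        exact hi (Finset.mem_filter.1 this).1
      simp [he]
    -- A single completion, by `i`: its service time `r` is integrated last, and given `r ≤ D` the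
    -- event says that the other services of `B` exceed the now constant level `r`.
    have hind : ∀ F : (ι → ℝ≥0∞) → ℝ≥0∞ → (ι → ℝ≥0∞) → ℝ≥0∞,
        Measurable (fun p : (ι → ℝ≥0∞) × (ι → ℝ≥0∞) => F p.1 (p.1 i) p.2) →
        ∫⁻ R in {R | firstSet B D R = {i}}, ∫⁻ Y, F R (firstTime B D R) Y ∂κ ∂κ =
        ∫⁻ r, (Set.Iic D).indicator (fun r => ∫⁻ R in {R | ∀ j ∈ B.erase i, r < R j},
          ∫⁻ Y, F (Function.update R i r) r Y ∂κ ∂κ) r ∂ρ := by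
      intro F hF
      have h1 : ∫⁻ R in {R | firstSet B D R = {i}}, ∫⁻ Y, F R (firstTime B D R) Y ∂κ ∂κ =
          ∫⁻ R in {R | firstSet B D R = {i}}, ∫⁻ Y, F R (R i) Y ∂κ ∂κ := by
        refine setLIntegral_congr_fun (hSet {i}) fun R hR => ?_
        have : i ∈ firstSet B D R := by
          have hR' : firstSet B D R = {i} := hR
          simp [hR']
        simp only [eq_firstTime_of_mem this]
      rw [h1, ← lintegral_indicator (hSet {i}), hκ, lintegral_update_pi i
        (hF.lintegral_prod_right'.indicator (hSet {i})), ← hκ]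
      refine lintegral_congr fun r => ?_
      by_cases hr : r ≤ D
      · rw [Set.indicator_of_mem (Set.mem_Iic.2 hr), ← lintegral_indicator
          (measurableSet_forall_lt (B.erase i) r)]
        refine lintegral_congr fun R => ?_
        have : Function.update R i r ∈ {R : ι → ℝ≥0∞ | firstSet B D R = {i}} ↔
            R ∈ {R : ι → ℝ≥0∞ | ∀ j ∈ B.erase i, r < R j} := by
          rw [Set.mem_ofPred_eq, firstSet_eq_singleton_iff hi]
          simp only [Function.update_self, hr, true_and, Set.mem_ofPred_eq]
          refine forall₂_congr fun j hj => ?_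
          rw [Function.update_of_ne (Finset.ne_of_mem_erase hj)]
        by_cases hR : R ∈ {R : ι → ℝ≥0∞ | ∀ j ∈ B.erase i, r < R j}
        · rw [Set.indicator_of_mem hR, Set.indicator_of_mem (this.2 hR)]
          simp only [Function.update_self]
        · rw [Set.indicator_of_notMem hR, Set.indicator_of_notMem (fun h => hR (this.1 h))]
      · rw [Set.indicator_of_notMem (fun h => hr (Set.mem_Iic.1 h))]
        refine (lintegral_congr fun R => ?_).trans lintegral_zero
        refine Set.indicator_of_notMem (fun h => hr ?_) _
        have := ((firstSet_eq_singleton_iff hi).1 h).1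
        rwa [Function.update_self] at this
    rw [hind (fun R t Y => φ {i} t ((C {i} t).piecewise (fun j => R j - t) Y)),
      hind (fun R t Y => φ {i} t Y)]
    · refine lintegral_congr fun r => ?_
      by_cases hr : r ∈ Set.Iic D
      swap
      · rw [Set.indicator_of_notMem hr, Set.indicator_of_notMem hr]
      rw [Set.indicator_of_mem hr, Set.indicator_of_mem hr]
      have hsub : C {i} r ⊆ B.erase i := by
        rw [← Finset.sdiff_singleton_eq_erase]
        exact hC _ _
      rw [← lintegral_piecewise_sub h hsub r (ψ := φ {i} r)
        ((hφ {i}).comp (measurable_const.prodMk measurable_id))]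
      refine lintegral_congr fun R => lintegral_congr fun Y => ?_
      -- The server `i` is not among those whose residual is kept, so fixing its coordinate to `r`
      -- is invisible here.
      have : (C {i} r).piecewise (fun j => Function.update R i r j - r) Y =
          (C {i} r).piecewise (fun j => R j - r) Y := by
        refine Finset.piecewise_congr _ (fun j hj => ?_) fun j _ => rfl
        rw [Function.update_of_ne (Finset.ne_of_mem_erase (hsub hj))]
      rw [this]
    · exact (hφ {i}).comp (f := fun p : (ι → ℝ≥0∞) × (ι → ℝ≥0∞) => (p.1 i, p.2))
        (((measurable_pi_apply i).comp measurable_fst).prodMk measurable_snd)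
    · exact (hφ {i}).comp (f := fun p : (ι → ℝ≥0∞) × (ι → ℝ≥0∞) =>
        (p.1 i, (C {i} (p.1 i)).piecewise (fun j => p.1 j - p.1 i) p.2))
        (((measurable_pi_apply i).comp measurable_fst).prodMk
        (measurable_residual (hCm {i}) (measurable_pi_apply i)))
  -- Simultaneous completions are a tie, hence negligible.
  · have hnull : κ {R : ι → ℝ≥0∞ | firstSet B D R = S} = 0 := by
      refine measure_mono_null (t := {R | ¬ Function.Injective R}) (fun R hR hinj => ?_)
        (ae_iff.1 ae_injective_pi)
      have := firstSet_card_le_one (B := B) (D := D) hinj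
      have hR' : firstSet B D R = S := hR
      rw [hR'] at this
      omega
    rw [Measure.restrict_eq_zero.2 hnull]
    simp

lemma measure_forall_lt (h : Memoryless ρ) (B : Finset ι) (c : ℝ≥0∞) :
    (Measure.pi fun _ : ι => ρ) {R | ∀ j ∈ B, c < R j} = ρ (Set.Ioi (B.card * c)) := by
  have : {R : ι → ℝ≥0∞ | ∀ j ∈ B, c < R j} =
      Set.univ.pi fun j => if j ∈ B then Set.Ioi c else Set.univ := by
    ext R
    simp only [Set.mem_ofPred_eq, Set.mem_univ_pi]
    refine forall_congr' fun j => ?_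
    by_cases hj : j ∈ B <;> simp [hj]
  rw [this, Measure.pi_pi, ← h.tail_pow]
  have : ∀ j, ρ (if j ∈ B then Set.Ioi c else Set.univ) = if j ∈ B then ρ (Set.Ioi c) else 1 := by
    intro j
    split_ifs <;> simp
  simp only [this]
  rw [Finset.prod_ite_mem, Finset.univ_inter, Finset.prod_const]

/-- The work done until the first completion, continued by a fresh amount of work if there is no
completion, has law `ρ`. -/
noncomputable def glue (B : Finset ι) (D : ℝ≥0∞) (R : ι → ℝ≥0∞) (z : ℝ≥0∞) : ℝ≥0∞ :=
  B.card * firstTime B D R + if firstSet B D R = ∅ then z else 0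

lemma measurable_glue (B : Finset ι) :
    Measurable fun p : ℝ≥0∞ × (ι → ℝ≥0∞) × ℝ≥0∞ => glue B p.1 p.2.1 p.2.2 := by
  have hp : Measurable fun p : ℝ≥0∞ × (ι → ℝ≥0∞) × ℝ≥0∞ => (p.1, p.2.1) :=
    measurable_fst.prodMk (measurable_fst.comp measurable_snd)
  refine (((measurable_firstTime B).comp hp).const_mul _).add (Measurable.ite ?_ ?_ ?_)
  · exact hp (measurableSet_firstSet B ∅)
  · exact measurable_snd.comp measurable_snd
  · exact measurable_const

/-- If `c < |B| D`, exceeding `c` means that all services of `B` exceed `c / |B|`, with probability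
`ρ (Ioi c)` by `Memoryless.tail_pow`. Otherwise it means that no service ends by `D` and that the
fresh work exceeds `c - |B| D`; the two factors multiply to the same tail. With `B` empty no work is
done and only the fresh amount counts. -/
lemma map_glue (h : Memoryless ρ) (B : Finset ι) (D : ℝ≥0∞) :
    ((Measure.pi fun _ : ι => ρ).prod ρ).map (fun p => glue B D p.1 p.2) = ρ := by
  have hm : Measurable fun p : (ι → ℝ≥0∞) × ℝ≥0∞ => glue B D p.1 p.2 :=
    (measurable_glue B).comp (measurable_const.prodMk (measurable_fst.prodMk measurable_snd))
  refine measure_ext_of_Ioi ?_ fun c => ?_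
  · rw [Measure.map_apply hm MeasurableSet.univ]
    simp
  rw [Measure.map_apply hm measurableSet_Ioi]
  by_cases hB : B = ∅
  · subst hB
    have : (fun p : (ι → ℝ≥0∞) × ℝ≥0∞ => glue ∅ D p.1 p.2) ⁻¹' Set.Ioi c =
        Set.univ ×ˢ Set.Ioi c := by
      ext p
      simp [glue, firstSet]
    rw [this, Measure.prod_prod, measure_univ, one_mul]
  have hb0 : (B.card : ℝ≥0∞) ≠ 0 := by simpa using hB
  have hbt : (B.card : ℝ≥0∞) ≠ ⊤ := ENNReal.natCast_ne_top _
  by_cases hc : c < B.card * D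
  · have hcd : c / B.card < D := by
      rw [ENNReal.div_lt_iff (Or.inl hb0) (Or.inl hbt), mul_comm]
      exact hc
    have : (fun p : (ι → ℝ≥0∞) × ℝ≥0∞ => glue B D p.1 p.2) ⁻¹' Set.Ioi c =
        {R | ∀ j ∈ B, c / B.card < R j} ×ˢ Set.univ := by
      ext ⟨R, z⟩
      simp only [Set.mem_preimage, Set.mem_Ioi, Set.mem_prod, Set.mem_ofPred_eq, Set.mem_univ,
        and_true, glue]
      by_cases hS : firstSet B D R = ∅
      · have h1 := firstSet_eq_empty_iff.1 hS
        rw [if_pos hS, firstTime_of_empty hS]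
        exact ⟨fun _ j hj => hcd.trans (h1 j hj), fun _ => hc.trans_le le_self_add⟩
      · rw [if_neg hS, add_zero, mul_comm,
          ← ENNReal.div_lt_iff (Or.inl hb0) (Or.inl hbt)]
        constructor
        · exact fun h1 j hj => h1.trans_le (firstTime_le hj D R)
        · intro h1
          obtain ⟨j, hj⟩ := Finset.nonempty_iff_ne_empty.2 hS
          rw [← eq_firstTime_of_mem hj]
          exact h1 j (Finset.mem_filter.1 hj).1
    rw [this, Measure.prod_prod, measure_univ, mul_one, measure_forall_lt h,
      ENNReal.mul_div_cancel hb0 hbt]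
  · rw [not_lt] at hc
    have : (fun p : (ι → ℝ≥0∞) × ℝ≥0∞ => glue B D p.1 p.2) ⁻¹' Set.Ioi c =
        {R | ∀ j ∈ B, D < R j} ×ˢ Set.Ioi (c - B.card * D) := by
      ext ⟨R, z⟩
      simp only [Set.mem_preimage, Set.mem_Ioi, Set.mem_prod, Set.mem_ofPred_eq, glue]
      rw [← firstSet_eq_empty_iff]
      by_cases hS : firstSet B D R = ∅
      · rw [if_pos hS, firstTime_of_empty hS]
        simp only [hS, true_and]
        -- An infinite product forces `D = ⊤`, and then no service can strictly outlast the horizon.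
        by_cases ht : (B.card : ℝ≥0∞) * D = ⊤
        · have hDt : D = ⊤ := by
            by_contra hne
            exact ENNReal.mul_ne_top hbt hne ht
          obtain ⟨j, hj⟩ := Finset.nonempty_iff_ne_empty.2 hB
          have := firstSet_eq_empty_iff.1 hS j hj
          rw [hDt] at this
          exact absurd this not_top_lt
        · exact (ENNReal.sub_lt_iff_lt_left ht hc).symm
      · rw [if_neg hS, add_zero]
        simp only [hS, false_and, iff_false, not_lt]
        exact (mul_le_mul_right inf_le_left _).trans hc
    rw [this, Measure.prod_prod, measure_forall_lt h, ← h, add_tsub_cancel_of_le hc]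

end FirstCompletion

/-! ### One step of the dynamics, rewritten with residual service times. -/

section Step

variable {m : ℕ} {I : Input} {Ξ : Type*} [MeasurableSpace Ξ]

lemma Input.le_nextArrival (I : Input) (T : ℝ≥0∞) : T ≤ I.nextArrival T := by
  refine le_sInf ?_
  rintro t ⟨i, -, -, h⟩
  exact h.le

lemma Input.nextArrival_mono (I : Input) : Monotone I.nextArrival := by
  intro T T' h
  refine sInf_le_sInf ?_
  rintro t ⟨i, h1, h2, h3⟩
  exact ⟨i, h1, h2, h.trans_lt h3⟩

/-- The servers that are busy after the decision taken at history `h`. -/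
noncomputable def Policy.busy (π : Policy I m Ξ) {k : ℕ} (e : Ξ) (h : Hist m k) :
    Finset (Fin m) :=
  open Classical in
  {j | h.now.time ≠ ⊤ ∧ π.assign k e h j ≠ none}

/-- The servers that continue an ongoing service after the decision taken at history `h`. -/
noncomputable def Policy.continuing (π : Policy I m Ξ) {k : ℕ} (e : Ξ) (h : Hist m k) :
    Finset (Fin m) :=
  open Classical in
  {j | h.now.time ≠ ⊤ ∧ π.assign k e h j ≠ none ∧ π.assign k e h j = h.now.serving j}

/-- The time to the next epoch if there is no service completion before. -/
noncomputable def Policy.horizon (π : Policy I m Ξ) {k : ℕ} (e : Ξ) (h : Hist m k) : ℝ≥0∞ :=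
  min (I.nextArrival h.now.time - h.now.time) (π.review k e h)

/-- The history at the next epoch, if that occurs after a time `l` and with service completions of
the servers in `S`. -/
def Policy.extend (π : Policy I m Ξ) {k : ℕ} (e : Ξ) (h : Hist m k) (l : ℝ≥0∞)
    (S : Finset (Fin m)) : Hist m (k + 1) :=
  Fin.snoc h (h.now.time + l, fun j => if j ∈ S then π.assign k e h j else none,
    fun j => if j ∈ S then none else π.assign k e h j)

/-- The residual service times after the decision of epoch `k`, completed by the fresh service times
of the servers that do not continue an ongoing service. -/
noncomputable def Policy.residual (π : Policy I m Ξ) (w : Outcome m Ξ) (k : ℕ) (j : Fin m) :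
    ℝ≥0∞ :=
  if j ∈ π.continuing w.1 (π.run w k).hist then
    (π.run w k).finish j - (π.run w k).hist.now.time
  else ENNReal.ofReal (w.2 k j)

variable {π : Policy I m Ξ} {w : Outcome m Ξ} {k : ℕ}

lemma Policy.mem_busy {e : Ξ} {h : Hist m k} {j : Fin m} :
    j ∈ π.busy e h ↔ h.now.time ≠ ⊤ ∧ π.assign k e h j ≠ none := by
  simp [Policy.busy]

lemma Policy.mem_continuing {e : Ξ} {h : Hist m k} {j : Fin m} :
    j ∈ π.continuing e h ↔
      h.now.time ≠ ⊤ ∧ π.assign k e h j ≠ none ∧ π.assign k e h j = h.now.serving j := by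
  simp [Policy.continuing]

lemma Policy.now_extend {e : Ξ} {h : Hist m k} {l : ℝ≥0∞} {S : Finset (Fin m)} :
    (π.extend e h l S).now = (h.now.time + l, fun j => if j ∈ S then π.assign k e h j else none,
      fun j => if j ∈ S then none else π.assign k e h j) := by
  simp [Policy.extend, Hist.now]

/-- A server that has just completed is serving nothing, so whatever it does next is a new service.
Hence the kept residuals belong to surviving services, as `lintegral_residual` requires. -/
lemma Policy.continuing_extend_subset {e : Ξ} {h : Hist m k} {l : ℝ≥0∞} {S : Finset (Fin m)} :
    π.continuing e (π.extend e h l S) ⊆ π.busy e h \ S := by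
  intro j hj
  rw [Policy.mem_continuing, Policy.now_extend] at hj
  obtain ⟨h1, h2, h3⟩ := hj
  simp only [Obs.time, Obs.serving] at h1 h3
  rw [Finset.mem_sdiff, Policy.mem_busy]
  by_cases hS : j ∈ S
  · rw [if_pos hS] at h3
    exact absurd h3 h2
  · rw [if_neg hS] at h3
    exact ⟨⟨fun h => h1 (by simp only [Obs.time] at h; rw [h, top_add]), h3 ▸ h2⟩, hS⟩

lemma Policy.time_le_finish (π : Policy I m Ξ) (w : Outcome m Ξ) (k : ℕ) (j : Fin m) :
    (π.run w k).hist.now.time ≤ (π.run w k).finish j := by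
  cases k with
  | zero => simp [Policy.run]
  | succ k =>
    simp only [Policy.run, Hist.now, Fin.snoc_last, Obs.time]
    exact (min_le_right _ _).trans ((min_le_right _ _).trans (iInf_le _ j))

lemma Policy.time_le_newFinish (π : Policy I m Ξ) (w : Outcome m Ξ) (k : ℕ) (j : Fin m) :
    (π.run w k).hist.now.time ≤ π.newFinish w.1 (w.2 k) (π.run w k) j := by
  rw [Policy.newFinish]
  split_ifs
  · exact le_top
  · exact π.time_le_finish w k j
  · exact le_self_add

lemma Policy.time_succ (π : Policy I m Ξ) (w : Outcome m Ξ) (k : ℕ) :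
    (π.run w (k + 1)).hist.now.time = π.nextTime w.1 (w.2 k) (π.run w k) := by
  simp [Policy.run, Hist.now, Obs.time]

lemma Policy.time_le_time_succ (π : Policy I m Ξ) (w : Outcome m Ξ) (k : ℕ) :
    (π.run w k).hist.now.time ≤ (π.run w (k + 1)).hist.now.time := by
  rw [π.time_succ]
  exact le_min (I.le_nextArrival _) (le_min le_self_add (le_iInf (π.time_le_newFinish w k)))

/-- Service times are real, so an ongoing service always has a finite completion time; `⊤` belongs
to idle servers. -/
lemma Policy.finish_ne_top (k : ℕ) (j : Fin m) (ht : (π.run w k).hist.now.time ≠ ⊤)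
    (hs : (π.run w k).hist.now.serving j ≠ none) : (π.run w k).finish j ≠ ⊤ := by
  induction k with
  | zero => simp [Policy.run, Hist.now, Obs.serving] at hs
  | succ k ih =>
    have ht' : (π.run w k).hist.now.time ≠ ⊤ := ne_top_of_le_ne_top ht (π.time_le_time_succ w k)
    have ha : π.assign k w.1 (π.run w k).hist j ≠ none := by
      intro h
      apply hs
      simp only [Policy.run, Hist.now, Fin.snoc_last, Obs.serving, Policy.nextServing]
      rw [h]
      simp
    simp only [Policy.run, Policy.newFinish, ha, if_false]
    split_ifs with h
    · exact ih ht' (h ▸ ha)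
    · exact ENNReal.add_ne_top.2 ⟨ht', ENNReal.ofReal_ne_top⟩

lemma Policy.residual_ne_top (π : Policy I m Ξ) (w : Outcome m Ξ) (k : ℕ) (j : Fin m) :
    π.residual w k j ≠ ⊤ := by
  rw [Policy.residual]
  split_ifs with h
  · obtain ⟨h1, h2, h3⟩ := Policy.mem_continuing.1 h
    exact ENNReal.sub_ne_top (Policy.finish_ne_top k j h1 (h3 ▸ h2))
  · exact ENNReal.ofReal_ne_top

lemma Policy.newFinish_eq (ht : (π.run w k).hist.now.time ≠ ⊤) (j : Fin m) :
    π.newFinish w.1 (w.2 k) (π.run w k) j =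
      if j ∈ π.busy w.1 (π.run w k).hist then (π.run w k).hist.now.time + π.residual w k j
      else ⊤ := by
  rw [Policy.newFinish, Policy.residual]
  by_cases ha : π.assign k w.1 (π.run w k).hist j = none
  · rw [if_pos ha, if_neg (fun h => (Policy.mem_busy.1 h).2 ha)]
  · rw [if_neg ha, if_pos (Policy.mem_busy.2 ⟨ht, ha⟩)]
    by_cases hs : π.assign k w.1 (π.run w k).hist j = (π.run w k).hist.now.serving j
    · rw [if_pos hs, if_pos (Policy.mem_continuing.2 ⟨ht, ha, hs⟩),
        add_tsub_cancel_of_le (π.time_le_finish w k j)]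
    · rw [if_neg hs, if_neg (fun h => hs (Policy.mem_continuing.1 h).2.2)]

/-- The time between epochs `k` and `k + 1`. -/
noncomputable def Policy.gap (π : Policy I m Ξ) (w : Outcome m Ξ) (k : ℕ) : ℝ≥0∞ :=
  firstTime (π.busy w.1 (π.run w k).hist) (π.horizon w.1 (π.run w k).hist) (π.residual w k)

/-- The servers that complete a service at epoch `k + 1`. -/
noncomputable def Policy.completing (π : Policy I m Ξ) (w : Outcome m Ξ) (k : ℕ) :
    Finset (Fin m) :=
  firstSet (π.busy w.1 (π.run w k).hist) (π.horizon w.1 (π.run w k).hist) (π.residual w k)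

lemma Policy.busy_of_top {e : Ξ} {h : Hist m k} (ht : h.now.time = ⊤) : π.busy e h = ∅ := by
  ext j
  simp [Policy.mem_busy, ht]

lemma Policy.nextTime_eq (π : Policy I m Ξ) (w : Outcome m Ξ) (k : ℕ) :
    π.nextTime w.1 (w.2 k) (π.run w k) = (π.run w k).hist.now.time + π.gap w k := by
  by_cases ht : (π.run w k).hist.now.time = ⊤
  · have := π.time_le_time_succ w k
    rw [π.time_succ, ht, top_le_iff] at this
    rw [this, ht, top_add]
  set T := (π.run w k).hist.now.time with hT
  set B := π.busy w.1 (π.run w k).hist with hB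
  have h1 : ⨅ j, π.newFinish w.1 (w.2 k) (π.run w k) j = T + B.inf (π.residual w k) := by
    have hinf : T + B.inf (π.residual w k) = B.inf fun j => T + π.residual w k j := by
      have := Finset.apply_inf_eq_inf_comp (s := B) (f := π.residual w k) (fun x => T + x)
        (fun a b => (min_add_add_left T a b).symm) (by simp)
      exact this
    rw [hinf]
    refine le_antisymm (Finset.le_inf fun j hj => ?_) (le_iInf fun j => ?_)
    · refine (iInf_le _ j).trans ?_
      rw [Policy.newFinish_eq ht, if_pos hj]
    · rw [Policy.newFinish_eq ht]
      split_ifs with hj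
      · exact Finset.inf_le hj
      · exact le_top
  rw [Policy.nextTime, h1, Policy.gap, firstTime, Policy.horizon, ← min_assoc]
  change _ = T + min (min (I.nextArrival T - T) _) _
  rw [← min_add_add_left, ← min_add_add_left, add_tsub_cancel_of_le (I.le_nextArrival T)]

/-- The guard `≠ ⊤` in the dynamics matters only for idle servers, whose finish time `⊤` would
otherwise count as reached; for a completing busy server it holds because residuals are finite. -/
lemma Policy.newFinish_le_iff (π : Policy I m Ξ) (w : Outcome m Ξ) (k : ℕ) (j : Fin m) :
    (π.newFinish w.1 (w.2 k) (π.run w k) j ≤ π.nextTime w.1 (w.2 k) (π.run w k) ∧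
      π.nextTime w.1 (w.2 k) (π.run w k) ≠ ⊤) ↔ j ∈ π.completing w k := by
  by_cases ht : (π.run w k).hist.now.time = ⊤
  · simp [π.nextTime_eq, ht, Policy.completing, Policy.busy_of_top ht, firstSet]
  rw [Policy.newFinish_eq ht, π.nextTime_eq, Policy.completing, firstSet, Finset.mem_filter]
  by_cases hj : j ∈ π.busy w.1 (π.run w k).hist
  · rw [if_pos hj, ENNReal.add_le_add_iff_left ht]
    constructor
    · exact fun h => ⟨hj, h.1⟩
    · rintro ⟨-, h⟩
      refine ⟨h, ENNReal.add_ne_top.2 ⟨ht, ?_⟩⟩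
      exact ne_top_of_le_ne_top (π.residual_ne_top w k j) (firstTime_le hj _ _)
  · simp only [hj, if_false, false_and, iff_false, not_and, not_not]
    exact top_le_iff.1

lemma Policy.run_succ_hist (π : Policy I m Ξ) (w : Outcome m Ξ) (k : ℕ) :
    (π.run w (k + 1)).hist =
      π.extend w.1 (π.run w k).hist (π.gap w k) (π.completing w k) := by
  have hd : ∀ j, π.nextDelivered w.1 (w.2 k) (π.run w k) j =
      if j ∈ π.completing w k then π.assign k w.1 (π.run w k).hist j else none := by
    intro j
    rw [Policy.nextDelivered]
    by_cases hj : j ∈ π.completing w k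
    · rw [if_pos hj, if_pos ((π.newFinish_le_iff w k j).2 hj)]
    · rw [if_neg hj, if_neg (fun h => hj ((π.newFinish_le_iff w k j).1 h))]
  have hs : ∀ j, π.nextServing w.1 (w.2 k) (π.run w k) j =
      if j ∈ π.completing w k then none else π.assign k w.1 (π.run w k).hist j := by
    intro j
    rw [Policy.nextServing, hd]
    by_cases hj : j ∈ π.completing w k
    · have := (Policy.mem_busy.1 (Finset.mem_filter.1 hj).1).2
      simp [hj, this]
    · simp [hj]
  rw [Policy.run, Policy.extend]
  simp only [π.nextTime_eq w k]
  congr 1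
  rw [Prod.mk.injEq, Prod.mk.injEq]
  exact ⟨rfl, funext hd, funext hs⟩

/-- This is the form needed for the induction: old residuals shifted by the gap on the continuing
servers, fresh service times elsewhere. -/
lemma Policy.residual_succ (π : Policy I m Ξ) (w : Outcome m Ξ) (k : ℕ) :
    π.residual w (k + 1) =
      (π.continuing w.1 (π.run w (k + 1)).hist).piecewise
        (fun j => π.residual w k j - π.gap w k) (fun j => ENNReal.ofReal (w.2 (k + 1) j)) := by
  funext j
  rw [Policy.residual, Finset.piecewise]
  split_ifs with hj
  · have hj' := hj
    rw [π.run_succ_hist] at hj'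
    have hb := (Finset.mem_sdiff.1 (Policy.continuing_extend_subset hj')).1
    have ht := (Policy.mem_busy.1 hb).1
    rw [π.time_succ, π.nextTime_eq]
    simp only [Policy.run]
    rw [Policy.newFinish_eq ht, if_pos hb, ENNReal.add_sub_add_eq_sub_left ht]
  · rfl

end Step

/-! ### Measurability of the dynamics. -/

section Measurability

variable {m : ℕ} {I : Input} {Ξ : Type*} [MeasurableSpace Ξ] {α : Type*} [MeasurableSpace α]

/-- The discrete σ-algebra on finite sets. -/
instance instMeasurableSpaceFinset {β : Type*} : MeasurableSpace (Finset β) := ⊤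

instance instDiscreteMeasurableSpaceFinset {β : Type*} : DiscreteMeasurableSpace (Finset β) :=
  ⟨fun _ => trivial⟩

instance instDiscreteMeasurableSpaceOptionNat : DiscreteMeasurableSpace (Option ℕ) :=
  ⟨fun _ => trivial⟩

lemma measurable_finset {β : Type*} [Countable β] {f : α → Finset β}
    (h : ∀ j, MeasurableSet {x | j ∈ f x}) : Measurable f := by
  refine measurable_to_countable' fun S => ?_
  have : f ⁻¹' {S} = ⋂ j, {x | j ∈ f x ↔ j ∈ S} := by
    ext x
    simp [Finset.ext_iff]
  rw [this]
  refine MeasurableSet.iInter fun j => ?_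
  by_cases hj : j ∈ S
  · simpa [hj] using h j
  · simp only [hj, iff_false]
    exact (h j).compl

lemma measurableSet_mem_finset {β : Type*} {f : α → Finset β} (hf : Measurable f) (j : β) :
    MeasurableSet {x | j ∈ f x} :=
  hf (MeasurableSet.of_discrete (s := {S | j ∈ S}))

/-- Sets of servers and counters take countably many values, so they can be frozen when
measurability is checked. -/
lemma measurable_comp_countable {β γ : Type*} [MeasurableSpace β] [Countable β]
    [DiscreteMeasurableSpace β] [MeasurableSpace γ] {δ : Type*} [MeasurableSpace δ]
    {g : β → δ → γ} (hg : ∀ b, Measurable (g b)) {f : α → β} (hf : Measurable f)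
    {x : α → δ} (hx : Measurable x) : Measurable fun a => g (f a) (x a) :=
  (measurable_from_prod_countable_right (f := fun p : β × δ => g p.1 p.2) hg).comp (hf.prodMk hx)

lemma Input.measurable_nextArrival (I : Input) : Measurable I.nextArrival :=
  I.nextArrival_mono.measurable

variable {k : ℕ}

lemma measurable_now : Measurable (Hist.now : Hist m k → Obs m) := measurable_pi_apply _

lemma measurable_now_time : Measurable fun h : Hist m k => h.now.time :=
  measurable_fst.comp measurable_now

lemma measurable_now_serving (j : Fin m) : Measurable fun h : Hist m k => h.now.serving j :=
  (measurable_pi_apply j).comp ((measurable_snd.comp measurable_snd).comp measurable_now)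

lemma measurable_delivered (l : Fin (k + 1)) (j : Fin m) :
    Measurable fun h : Hist m k => (h l).delivered j :=
  (measurable_pi_apply j).comp ((measurable_fst.comp measurable_snd).comp (measurable_pi_apply l))

lemma Policy.measurable_assign_apply (π : Policy I m Ξ) (j : Fin m) :
    Measurable fun p : Ξ × Hist m k => π.assign k p.1 p.2 j :=
  (measurable_pi_apply j).comp (π.measurable_assign k)

lemma measurableSet_time_ne_top : MeasurableSet {p : Ξ × Hist m k | p.2.now.time ≠ ⊤} :=
  (measurable_now_time.comp measurable_snd) (measurableSet_singleton ⊤).compl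

lemma Policy.measurable_busy (π : Policy I m Ξ) :
    Measurable fun p : Ξ × Hist m k => π.busy p.1 p.2 := by
  refine measurable_finset fun j => ?_
  simp only [Policy.mem_busy]
  exact measurableSet_time_ne_top.inter
    (π.measurable_assign_apply j (MeasurableSet.of_discrete (s := {none}ᶜ)))

lemma Policy.measurable_continuing (π : Policy I m Ξ) :
    Measurable fun p : Ξ × Hist m k => π.continuing p.1 p.2 := by
  refine measurable_finset fun j => ?_
  simp only [Policy.mem_continuing]
  refine measurableSet_time_ne_top.inter (MeasurableSet.inter
    (π.measurable_assign_apply j (MeasurableSet.of_discrete (s := {none}ᶜ))) ?_)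
  exact ((π.measurable_assign_apply j).prodMk ((measurable_now_serving j).comp measurable_snd))
    (MeasurableSet.of_discrete (s := {q : Option ℕ × Option ℕ | q.1 = q.2}))

lemma Policy.measurable_horizon (π : Policy I m Ξ) :
    Measurable fun p : Ξ × Hist m k => π.horizon p.1 p.2 := by
  have ht : Measurable fun p : Ξ × Hist m k => p.2.now.time :=
    measurable_now_time.comp measurable_snd
  exact ((I.measurable_nextArrival.comp ht).sub ht).min (π.measurable_review k)

lemma Policy.measurable_extend (π : Policy I m Ξ) (S : Finset (Fin m)) :
    Measurable fun p : (Ξ × Hist m k) × ℝ≥0∞ => π.extend p.1.1 p.1.2 p.2 S := by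
  refine measurable_pi_iff.2 fun i => ?_
  induction i using Fin.lastCases with
  | last =>
    simp only [Policy.extend, Fin.snoc_last]
    refine Measurable.prodMk ?_ (Measurable.prodMk ?_ ?_)
    · exact (measurable_now_time.comp (measurable_snd.comp measurable_fst)).add measurable_snd
    · refine measurable_pi_iff.2 fun j => ?_
      by_cases hj : j ∈ S
      · simp only [hj, if_true]
        exact (π.measurable_assign_apply j).comp measurable_fst
      · simp only [hj, if_false]
        exact measurable_const
    · refine measurable_pi_iff.2 fun j => ?_
      by_cases hj : j ∈ S
      · simp only [hj, if_true]
        exact measurable_const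
      · simp only [hj, if_false]
        exact (π.measurable_assign_apply j).comp measurable_fst
  | cast i =>
    simp only [Policy.extend, Fin.snoc_castSucc]
    exact (measurable_pi_apply i).comp (measurable_snd.comp measurable_fst)

/-- The time to the next epoch as a function of the history and the residuals. -/
noncomputable def Policy.gapOf (π : Policy I m Ξ) (p : (Ξ × Hist m k) × (Fin m → ℝ≥0∞)) : ℝ≥0∞ :=
  firstTime (π.busy p.1.1 p.1.2) (π.horizon p.1.1 p.1.2) p.2

/-- The servers that complete at the next epoch, as a function of the history and the residuals. -/
noncomputable def Policy.completingOf (π : Policy I m Ξ) (p : (Ξ × Hist m k) × (Fin m → ℝ≥0∞)) :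
    Finset (Fin m) :=
  firstSet (π.busy p.1.1 p.1.2) (π.horizon p.1.1 p.1.2) p.2

/-- The history at the next epoch as a function of the history and the residuals. -/
noncomputable def Policy.nextHist (π : Policy I m Ξ) (p : (Ξ × Hist m k) × (Fin m → ℝ≥0∞)) :
    Hist m (k + 1) :=
  π.extend p.1.1 p.1.2 (π.gapOf p) (π.completingOf p)

lemma Policy.measurable_gapOf (π : Policy I m Ξ) :
    Measurable (π.gapOf : (Ξ × Hist m k) × (Fin m → ℝ≥0∞) → ℝ≥0∞) :=
  measurable_comp_countable (g := fun B (q : ℝ≥0∞ × (Fin m → ℝ≥0∞)) => firstTime B q.1 q.2)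
    measurable_firstTime (π.measurable_busy.comp measurable_fst)
    ((π.measurable_horizon.comp measurable_fst).prodMk measurable_snd)

lemma Policy.measurable_completingOf (π : Policy I m Ξ) :
    Measurable (π.completingOf : (Ξ × Hist m k) × (Fin m → ℝ≥0∞) → Finset (Fin m)) :=
  measurable_comp_countable (g := fun B (q : ℝ≥0∞ × (Fin m → ℝ≥0∞)) => firstSet B q.1 q.2)
    (fun B => measurable_to_countable' fun S => measurableSet_firstSet B S)
    (π.measurable_busy.comp measurable_fst)
    ((π.measurable_horizon.comp measurable_fst).prodMk measurable_snd)

lemma Policy.measurable_nextHist (π : Policy I m Ξ) :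
    Measurable (π.nextHist : (Ξ × Hist m k) × (Fin m → ℝ≥0∞) → Hist m (k + 1)) :=
  measurable_comp_countable
    (g := fun S (q : (Ξ × Hist m k) × ℝ≥0∞) => π.extend q.1.1 q.1.2 q.2 S)
    π.measurable_extend π.measurable_completingOf (measurable_fst.prodMk π.measurable_gapOf)

lemma measurable_comp_piecewise_sub {C : α → Finset (Fin m)} (hC : Measurable C)
    {R Y : α → Fin m → ℝ≥0∞} (hR : Measurable R) (hY : Measurable Y)
    {T : α → ℝ≥0∞} (hT : Measurable T) :
    Measurable fun a => (C a).piecewise (fun j => R a j - T a) (Y a) := by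
  refine measurable_pi_iff.2 fun j => ?_
  simp only [Finset.piecewise]
  exact Measurable.ite (measurableSet_mem_finset hC j)
    (((measurable_pi_apply j).comp hR).sub hT) ((measurable_pi_apply j).comp hY)

/-- The visible state: the seed and the history. -/
noncomputable def Policy.visible (π : Policy I m Ξ) (w : Outcome m Ξ) (k : ℕ) : Ξ × Hist m k :=
  (w.1, (π.run w k).hist)

lemma Policy.gap_eq_gapOf (π : Policy I m Ξ) (w : Outcome m Ξ) (k : ℕ) :
    π.gap w k = π.gapOf (π.visible w k, π.residual w k) := rfl

lemma Policy.visible_succ (π : Policy I m Ξ) (w : Outcome m Ξ) (k : ℕ) :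
    π.visible w (k + 1) = (w.1, π.nextHist (π.visible w k, π.residual w k)) := by
  rw [Policy.visible, π.run_succ_hist]
  rfl

lemma measurable_service (k : ℕ) :
    Measurable fun (w : Outcome m Ξ) (j : Fin m) => ENNReal.ofReal (w.2 k j) :=
  measurable_pi_iff.2 fun j => ENNReal.measurable_ofReal.comp
    ((measurable_pi_apply j).comp ((measurable_pi_apply k).comp measurable_snd))

lemma Policy.residual_zero (π : Policy I m Ξ) (w : Outcome m Ξ) :
    π.residual w 0 = fun j => ENNReal.ofReal (w.2 0 j) := by
  funext j
  rw [Policy.residual, if_neg]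
  intro h
  obtain ⟨-, h2, h3⟩ := Policy.mem_continuing.1 h
  exact h2 h3

lemma Policy.measurable_visible_residual (π : Policy I m Ξ) (k : ℕ) :
    Measurable (fun w : Outcome m Ξ => π.visible w k) ∧
      Measurable (fun w : Outcome m Ξ => π.residual w k) := by
  induction k with
  | zero =>
    refine ⟨measurable_fst.prodMk measurable_const, ?_⟩
    simp only [π.residual_zero]
    exact measurable_service 0
  | succ k ih =>
    have h1 : Measurable (fun w : Outcome m Ξ => π.visible w (k + 1)) := by
      simp only [π.visible_succ]
      exact measurable_fst.prodMk (π.measurable_nextHist.comp (ih.1.prodMk ih.2))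
    refine ⟨h1, ?_⟩
    simp only [π.residual_succ]
    have hc := π.measurable_continuing.comp h1
    simp only [Function.comp_def, Policy.visible] at hc
    have hg : Measurable fun w : Outcome m Ξ => π.gap w k := by
      simp only [π.gap_eq_gapOf]
      exact π.measurable_gapOf.comp (ih.1.prodMk ih.2)
    exact measurable_comp_piecewise_sub hc ih.2 (measurable_service (k + 1)) hg

lemma Policy.measurable_visible (π : Policy I m Ξ) (k : ℕ) :
    Measurable (fun w : Outcome m Ξ => π.visible w k) := (π.measurable_visible_residual k).1

lemma Policy.measurable_residual (π : Policy I m Ξ) (k : ℕ) :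
    Measurable (fun w : Outcome m Ξ => π.residual w k) := (π.measurable_visible_residual k).2

end Measurability

/-! ### Causality: what an epoch depends on. -/

section Past

variable {m : ℕ} {I : Input} {Ξ : Type*} [MeasurableSpace Ξ]

/-- The seed and the service times of the services that start before epoch `k`. -/
def past (k : ℕ) (w : Outcome m Ξ) : Outcome m Ξ := (w.1, fun l j => if l < k then w.2 l j else 0)

lemma measurable_past (k : ℕ) : Measurable (past k : Outcome m Ξ → Outcome m Ξ) := by
  refine measurable_fst.prodMk (measurable_pi_iff.2 fun l => measurable_pi_iff.2 fun j => ?_)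
  by_cases h : l < k
  · simp only [h, if_true]
    exact (measurable_pi_apply j).comp ((measurable_pi_apply l).comp measurable_snd)
  · simp only [h, if_false]
    exact measurable_const

lemma Policy.run_past (π : Policy I m Ξ) (w : Outcome m Ξ) {k l : ℕ} (h : l ≤ k) :
    π.run (past k w) l = π.run w l := by
  induction l with
  | zero => rfl
  | succ l ih =>
    have h1 : (past k w).2 l = w.2 l := by
      funext j
      simp only [past]
      rw [if_pos (Nat.lt_of_succ_le h)]
    have h2 : (past k w).1 = w.1 := rfl
    rw [Policy.run, Policy.run, ih (Nat.le_of_succ_le h), h1, h2]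

lemma Policy.visible_past (π : Policy I m Ξ) (w : Outcome m Ξ) {k l : ℕ} (h : l ≤ k) :
    π.visible (past k w) l = π.visible w l := by
  rw [Policy.visible, π.run_past w h]
  rfl

/-- The inequality is strict, unlike for the visible state, because residuals at epoch `l` include
the services started at epoch `l`. -/
lemma Policy.residual_past (π : Policy I m Ξ) (w : Outcome m Ξ) {k l : ℕ} (h : l < k) :
    π.residual (past k w) l = π.residual w l := by
  funext j
  have h1 : (past k w).2 l j = w.2 l j := by
    simp only [past]
    rw [if_pos h]
  have h2 : (past k w).1 = w.1 := rfl
  rw [Policy.residual, Policy.residual, π.run_past w h.le, h1, h2]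

end Past

/-! ### Independence of the residuals from the visible state. -/

section Driven

variable {m : ℕ} {I : Input} {Ξ : Type*} [MeasurableSpace Ξ] {Ω : Type*} [MeasurableSpace Ω]

/-- The service times started at epoch `k` are independent with law `ρ` and independent of the seed
and of the service times started before. -/
structure IsDriven (P : Measure Ω) (W : Ω → Outcome m Ξ) (ρ : Measure ℝ≥0∞) : Prop where
  measurable : Measurable W
  map_past : ∀ k, P.map (fun ω => (past k (W ω), fun j => ENNReal.ofReal ((W ω).2 k j))) =
    (P.map fun ω => past k (W ω)).prod (Measure.pi fun _ => ρ)

/-- Both hypotheses factor the joint law into three pieces up to reassociating the product. It is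
used with the seed as `A`, earlier services as `B` and the services of the current epoch as `C`. -/
lemma indepFun_prodMk_left {α β γ : Type*} [MeasurableSpace α] [MeasurableSpace β]
    [MeasurableSpace γ] {P : Measure Ω} [IsProbabilityMeasure P] {A : Ω → α} {B : Ω → β}
    {C : Ω → γ} (hA : Measurable A) (hB : Measurable B) (hC : Measurable C)
    (h : IndepFun A (fun ω => (B ω, C ω)) P) (h' : IndepFun B C P) :
    IndepFun (fun ω => (A ω, B ω)) C P := by
  have : IsProbabilityMeasure (P.map A) := Measure.isProbabilityMeasure_map hA.aemeasurable
  have : IsProbabilityMeasure (P.map B) := Measure.isProbabilityMeasure_map hB.aemeasurable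
  have : IsProbabilityMeasure (P.map C) := Measure.isProbabilityMeasure_map hC.aemeasurable
  have hAB : IndepFun A B P := h.comp measurable_id measurable_fst
  rw [indepFun_iff_map_prod_eq_prod_map_map hA.aemeasurable (hB.prodMk hC).aemeasurable] at h
  rw [indepFun_iff_map_prod_eq_prod_map_map hB.aemeasurable hC.aemeasurable] at h'
  rw [indepFun_iff_map_prod_eq_prod_map_map hA.aemeasurable hB.aemeasurable] at hAB
  rw [indepFun_iff_map_prod_eq_prod_map_map (hA.prodMk hB).aemeasurable hC.aemeasurable]
  rw [h', ← Measure.prodAssoc_prod, ← hAB] at h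
  have h2 := congrArg (Measure.map MeasurableEquiv.prodAssoc.symm) h
  rw [Measure.map_map MeasurableEquiv.prodAssoc.symm.measurable
      MeasurableEquiv.prodAssoc.measurable,
    Measure.map_map MeasurableEquiv.prodAssoc.symm.measurable (hA.prodMk (hB.prodMk hC)),
    MeasurableEquiv.symm_comp_self, Measure.map_id] at h2
  exact h2

lemma isDriven_of_iIndepFun {P : Measure Ω} [IsProbabilityMeasure P] {μ : ℝ}
    {seed : Ω → Ξ} (hseed : Measurable seed)
    {X : ℕ → Fin m → Ω → ℝ} (hX : ∀ k j, Measurable (X k j))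
    (hX_exp : ∀ k j, P.map (X k j) = expMeasure μ)
    (hX_indep : iIndepFun (fun p : ℕ × Fin m => X p.1 p.2) P)
    (hX_seed : IndepFun seed (fun ω k j => X k j ω) P)
    {W : Ω → Outcome m Ξ} (hW : ∀ ω, W ω = (seed ω, fun k j => X k j ω)) :
    IsDriven P W (serviceLaw μ) := by
  have hXm : Measurable fun ω k j => X k j ω :=
    measurable_pi_iff.2 fun k => measurable_pi_iff.2 fun j => hX k j
  have hWm : Measurable W := by
    have : W = fun ω => (seed ω, fun k j => X k j ω) := funext hW
    rw [this]
    exact hseed.prodMk hXm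
  refine ⟨hWm, fun k => ?_⟩
  set tr : (ℕ → Fin m → ℝ) → (ℕ → Fin m → ℝ) := fun x l j => if l < k then x l j else 0 with htr
  set sv : (ℕ → Fin m → ℝ) → (Fin m → ℝ≥0∞) := fun x j => ENNReal.ofReal (x k j) with hsv
  have htrm : Measurable tr := by
    refine measurable_pi_iff.2 fun l => measurable_pi_iff.2 fun j => ?_
    by_cases h : l < k
    · simp only [htr, h, if_true]
      exact (measurable_pi_apply j).comp (measurable_pi_apply l)
    · simp only [htr, h, if_false]
      exact measurable_const
  have hsvm : Measurable sv := measurable_pi_iff.2 fun j =>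
    ENNReal.measurable_ofReal.comp ((measurable_pi_apply j).comp (measurable_pi_apply k))
  -- The services started before epoch `k` and those of epoch `k` are indexed by disjoint blocks.
  have hind : IndepFun (fun ω => tr fun k j => X k j ω) (fun ω => sv fun k j => X k j ω) P := by
    have hdis : Disjoint (Finset.range k ×ˢ (Finset.univ : Finset (Fin m)))
        (({k} : Finset ℕ) ×ˢ (Finset.univ : Finset (Fin m))) := by
      rw [Finset.disjoint_left]
      rintro ⟨l, j⟩ h1 h2
      simp only [Finset.mem_product, Finset.mem_range, Finset.mem_singleton] at h1 h2
      omega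
    have h0 := hX_indep.indepFun_finset _ _ hdis fun p => hX p.1 p.2
    have hf : Measurable fun (y : (Finset.range k ×ˢ (Finset.univ : Finset (Fin m)) :
        Finset (ℕ × Fin m)) → ℝ) (l : ℕ) (j : Fin m) =>
        if h : l < k then y ⟨(l, j), by simpa using h⟩ else 0 := by
      refine measurable_pi_iff.2 fun l => measurable_pi_iff.2 fun j => ?_
      by_cases h : l < k
      · simp only [h, dif_pos]
        exact measurable_pi_apply _
      · simp only [h, dif_neg, not_false_eq_true]
        exact measurable_const
    have hg : Measurable fun (y : (({k} : Finset ℕ) ×ˢ (Finset.univ : Finset (Fin m)) :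
        Finset (ℕ × Fin m)) → ℝ) (j : Fin m) => ENNReal.ofReal (y ⟨(k, j), by simp⟩) :=
      measurable_pi_iff.2 fun j => ENNReal.measurable_ofReal.comp (measurable_pi_apply _)
    have h1 := h0.comp hf hg
    convert h1 using 1
    · funext ω l j
      simp only [htr, Function.comp]
      split_ifs <;> rfl
    · rfl
  have hlaw : P.map (fun ω => sv fun k j => X k j ω) = Measure.pi fun _ => serviceLaw μ := by
    have h0 : iIndepFun (fun j : Fin m => X k j) P :=
      hX_indep.precomp (g := fun j : Fin m => (k, j)) fun a b h => (Prod.mk.inj h).2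
    have h1 := h0.comp (fun _ => ENNReal.ofReal) fun _ => ENNReal.measurable_ofReal
    have h2 := h1.map_fun_eq_pi_map fun j =>
      (ENNReal.measurable_ofReal.comp (hX k j)).aemeasurable
    refine Eq.trans h2 ?_
    congr 1
    funext j
    rw [← Measure.map_map ENNReal.measurable_ofReal (hX k j), hX_exp]
    rfl
  have hall : IndepFun (fun ω => (seed ω, tr fun k j => X k j ω))
      (fun ω => sv fun k j => X k j ω) P :=
    indepFun_prodMk_left hseed (htrm.comp hXm) (hsvm.comp hXm)
      (hX_seed.comp measurable_id (htrm.prodMk hsvm)) hind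
  have hall' := (indepFun_iff_map_prod_eq_prod_map_map
    (hseed.prodMk (htrm.comp hXm)).aemeasurable (hsvm.comp hXm).aemeasurable).1 hall
  have hall'' := hall'.trans (congrArg _ hlaw)
  simp only [hW]
  exact hall''

variable {P : Measure Ω} [IsProbabilityMeasure P] {W : Ω → Outcome m Ξ} {ρ : Measure ℝ≥0∞}
  [IsProbabilityMeasure ρ]

omit [IsProbabilityMeasure P] in
/-- A function of the past and the fresh service times are independent. -/
lemma IsDriven.map_comp_past (hW : IsDriven P W ρ) [SFinite P] {β : Type*} [MeasurableSpace β]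
    {k : ℕ} {f : Outcome m Ξ → β} (hf : Measurable f) (hfp : ∀ w, f (past k w) = f w) :
    P.map (fun ω => (f (W ω), fun j => ENNReal.ofReal ((W ω).2 k j))) =
      (P.map fun ω => f (W ω)).prod (Measure.pi fun _ => ρ) := by
  have h := congrArg (Measure.map (Prod.map f id)) (hW.map_past k)
  have hp : Measurable fun ω => past k (W ω) := (measurable_past k).comp hW.measurable
  have hs : Measurable fun ω (j : Fin m) => ENNReal.ofReal ((W ω).2 k j) :=
    (measurable_service k).comp hW.measurable
  rw [Measure.map_map (hf.prodMap measurable_id) (hp.prodMk hs),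
    ← Measure.map_prod_map _ _ hf measurable_id, Measure.map_map hf hp, Measure.map_id] at h
  have e1 : (Prod.map f id ∘ fun ω => (past k (W ω), fun j => ENNReal.ofReal ((W ω).2 k j))) =
      fun ω => (f (W ω), fun j => ENNReal.ofReal ((W ω).2 k j)) := by
    funext ω
    simp [hfp]
  have e2 : (f ∘ fun ω => past k (W ω)) = fun ω => f (W ω) := by
    funext ω
    simp [hfp]
  rw [e1, e2] at h
  exact h

/-- At every epoch the residual service times are independent of the visible state, and they are
independent with law `ρ`. -/
theorem Policy.map_visible_residual [NullSingletonClass ρ] (hρ : Memoryless ρ)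
    (hW : IsDriven P W ρ) (π : Policy I m Ξ) (k : ℕ) :
    P.map (fun ω => (π.visible (W ω) k, π.residual (W ω) k)) =
      (P.map fun ω => π.visible (W ω) k).prod (Measure.pi fun _ => ρ) := by
  induction k with
  | zero =>
    simp only [π.residual_zero]
    exact hW.map_comp_past (π.measurable_visible 0) fun w => π.visible_past w le_rfl
  | succ k ih =>
    set Y : Ω → Fin m → ℝ≥0∞ := fun ω j => ENNReal.ofReal ((W ω).2 (k + 1) j) with hY
    have hYm : Measurable Y := (measurable_service (k + 1)).comp hW.measurable
    have hv : Measurable fun ω => π.visible (W ω) k := (π.measurable_visible k).comp hW.measurable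
    have hr : Measurable fun ω => π.residual (W ω) k :=
      (π.measurable_residual k).comp hW.measurable
    have hv' : Measurable fun ω => π.visible (W ω) (k + 1) :=
      (π.measurable_visible (k + 1)).comp hW.measurable
    have hr' : Measurable fun ω => π.residual (W ω) (k + 1) :=
      (π.measurable_residual (k + 1)).comp hW.measurable
    have hnext : P.map (fun ω => (π.visible (W ω) (k + 1), Y ω)) =
        (P.map fun ω => π.visible (W ω) (k + 1)).prod (Measure.pi fun _ => ρ) :=
      hW.map_comp_past (π.measurable_visible (k + 1)) fun w => π.visible_past w le_rfl
    have htriple : P.map (fun ω => ((π.visible (W ω) k, π.residual (W ω) k), Y ω)) =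
        ((P.map fun ω => π.visible (W ω) k).prod (Measure.pi fun _ => ρ)).prod
          (Measure.pi fun _ => ρ) := by
      rw [← ih]
      refine hW.map_comp_past ((π.measurable_visible k).prodMk (π.measurable_residual k))
        fun w => ?_
      rw [π.visible_past w (Nat.le_succ k), π.residual_past w (Nat.lt_succ_self k)]
    -- The service times of epoch `k + 1` already have the desired joint law with the next visible
    -- state. It remains to see that replacing the residuals by these fresh times leaves the joint
    -- law unchanged.
    rw [← hnext]
    refine Measure.ext_of_lintegral _ fun f hf => ?_
    rw [lintegral_map hf (hv'.prodMk hr'), lintegral_map hf (hv'.prodMk hYm)]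
    -- both sides as integrals over the law of the previous state and fresh service times
    have hN : Measurable fun q : (Ξ × Hist m k) × (Fin m → ℝ≥0∞) => (q.1.1, π.nextHist q) :=
      (measurable_fst.comp measurable_fst).prodMk π.measurable_nextHist
    have hF1 : Measurable fun q : ((Ξ × Hist m k) × (Fin m → ℝ≥0∞)) × (Fin m → ℝ≥0∞) =>
        f ((q.1.1.1, π.nextHist q.1),
          (π.continuing q.1.1.1 (π.nextHist q.1)).piecewise
            (fun j => q.1.2 j - π.gapOf q.1) q.2) := by
      refine hf.comp ((hN.comp measurable_fst).prodMk ?_)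
      exact measurable_comp_piecewise_sub
        (π.measurable_continuing.comp (hN.comp measurable_fst))
        (measurable_snd.comp measurable_fst) measurable_snd
        (π.measurable_gapOf.comp measurable_fst)
    have hF2 : Measurable fun q : ((Ξ × Hist m k) × (Fin m → ℝ≥0∞)) × (Fin m → ℝ≥0∞) =>
        f ((q.1.1.1, π.nextHist q.1), q.2) :=
      hf.comp ((hN.comp measurable_fst).prodMk measurable_snd)
    have e1 : ∫⁻ ω, f (π.visible (W ω) (k + 1), π.residual (W ω) (k + 1)) ∂P =
        ∫⁻ q, f ((q.1.1.1, π.nextHist q.1),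
          (π.continuing q.1.1.1 (π.nextHist q.1)).piecewise
            (fun j => q.1.2 j - π.gapOf q.1) q.2)
          ∂(P.map (fun ω => ((π.visible (W ω) k, π.residual (W ω) k), Y ω))) := by
      rw [lintegral_map hF1 ((hv.prodMk hr).prodMk hYm)]
      refine lintegral_congr fun ω => ?_
      have hh : (π.run (W ω) (k + 1)).hist =
          π.nextHist (π.visible (W ω) k, π.residual (W ω) k) := π.run_succ_hist (W ω) k
      rw [π.visible_succ, π.residual_succ, hh, π.gap_eq_gapOf]
      rfl
    have e2 : ∫⁻ ω, f (π.visible (W ω) (k + 1), Y ω) ∂P =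
        ∫⁻ q, f ((q.1.1.1, π.nextHist q.1), q.2)
          ∂(P.map (fun ω => ((π.visible (W ω) k, π.residual (W ω) k), Y ω))) := by
      rw [lintegral_map hF2 ((hv.prodMk hr).prodMk hYm)]
      refine lintegral_congr fun ω => ?_
      rw [π.visible_succ]
      rfl
    rw [e1, e2, htriple, lintegral_prod _ hF1.aemeasurable, lintegral_prod _ hF2.aemeasurable,
      lintegral_prod _ hF1.lintegral_prod_right'.aemeasurable,
      lintegral_prod _ hF2.lintegral_prod_right'.aemeasurable]
    refine lintegral_congr fun x => ?_
    have hext : ∀ S, Measurable fun l : ℝ≥0∞ => (x.1, π.extend x.1 x.2 l S) := fun S =>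
      measurable_const.prodMk ((π.measurable_extend S).comp (measurable_const.prodMk measurable_id))
    -- With the current visible state `x` fixed, the next one is a function of the gap and of the
    -- completing set, and so is the set of continuing servers.
    refine lintegral_residual hρ (π.busy x.1 x.2) (π.horizon x.1 x.2)
      (fun S l => π.continuing x.1 (π.extend x.1 x.2 l S))
      (fun S l => Policy.continuing_extend_subset)
      (fun S j => measurableSet_mem_finset (π.measurable_continuing.comp (hext S)) j)
      (fun S l y => f ((x.1, π.extend x.1 x.2 l S), y)) fun S => ?_
    exact hf.comp (((hext S).comp measurable_fst).prodMk measurable_snd)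

end Driven

/-! ### Bookkeeping of the work between deliveries. -/

section Record

variable {m : ℕ} {I : Input} {Ξ : Type*} [MeasurableSpace Ξ]

/-- The history before the current epoch. -/
def Hist.prev {k : ℕ} (h : Hist m (k + 1)) : Hist m k := fun i => h i.castSucc

/-- The number `g` of deliveries in a history, together with the amounts of work: entry `i < g` is the
work done by the servers between the deliveries number `i` and `i + 1`, and entry `g` is the work done
since the last delivery. -/
noncomputable def Policy.record (π : Policy I m Ξ) :
    (k : ℕ) → Ξ × Hist m k → ℕ × (ℕ → ℝ≥0∞)
  | 0, _ => (0, 0)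
  | k + 1, p =>
    ((π.record k (p.1, p.2.prev)).1 +
        ({j | p.2.now.delivered j ≠ none} : Finset (Fin m)).card,
      Function.update (π.record k (p.1, p.2.prev)).2 (π.record k (p.1, p.2.prev)).1
        ((π.record k (p.1, p.2.prev)).2 (π.record k (p.1, p.2.prev)).1 +
          (π.busy p.1 p.2.prev).card * (p.2.now.time - p.2.prev.now.time)))

lemma measurable_prev {k : ℕ} : Measurable (Hist.prev : Hist m (k + 1) → Hist m k) :=
  measurable_pi_iff.2 fun i => measurable_pi_apply i.castSucc

lemma measurable_update_nat : Measurable fun p : ℕ × (ℕ → ℝ≥0∞) × ℝ≥0∞ =>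
    Function.update p.2.1 p.1 p.2.2 :=
  measurable_comp_countable (g := fun (i : ℕ) (q : (ℕ → ℝ≥0∞) × ℝ≥0∞) => Function.update q.1 i q.2)
    (fun _ => measurable_update') measurable_fst measurable_snd

lemma measurable_eval_nat : Measurable fun p : ℕ × (ℕ → ℝ≥0∞) => p.2 p.1 :=
  measurable_comp_countable (g := fun (i : ℕ) (q : ℕ → ℝ≥0∞) => q i)
    measurable_pi_apply measurable_fst measurable_snd

lemma Policy.measurable_record (π : Policy I m Ξ) (k : ℕ) : Measurable (π.record k) := by
  induction k with
  | zero => exact measurable_const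
  | succ k ih =>
    have hp : Measurable fun p : Ξ × Hist m (k + 1) => (p.1, p.2.prev) :=
      measurable_fst.prodMk (measurable_prev.comp measurable_snd)
    have hr := ih.comp hp
    have hn : Measurable fun p : Ξ × Hist m (k + 1) =>
        ({j | p.2.now.delivered j ≠ none} : Finset (Fin m)) := by
      refine measurable_finset fun j => ?_
      simp only [Finset.mem_filter, Finset.mem_univ, true_and]
      exact ((measurable_delivered (Fin.last (k + 1)) j).comp measurable_snd)
        (MeasurableSet.of_discrete (s := {none}ᶜ))
    have hc : Measurable (Finset.card : Finset (Fin m) → ℕ) := measurable_from_top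
    have hb : Measurable fun p : Ξ × Hist m (k + 1) =>
        ((π.busy p.1 p.2.prev).card : ℝ≥0∞) :=
      (measurable_from_top (f := fun S : Finset (Fin m) => (S.card : ℝ≥0∞))).comp
        (π.measurable_busy.comp hp)
    have ht : Measurable fun p : Ξ × Hist m (k + 1) => p.2.now.time - p.2.prev.now.time :=
      (measurable_now_time.comp measurable_snd).sub
        (measurable_now_time.comp (measurable_prev.comp measurable_snd))
    simp only [Policy.record]
    refine Measurable.prodMk ?_ ?_
    · exact (measurable_fst.comp hr).add (hc.comp hn)
    · exact measurable_update_nat.comp ((measurable_fst.comp hr).prodMk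
        ((measurable_snd.comp hr).prodMk ((measurable_eval_nat.comp hr).add (hb.mul ht))))

lemma Policy.prev_extend {π : Policy I m Ξ} {k : ℕ} {e : Ξ} {h : Hist m k} {l : ℝ≥0∞}
    {S : Finset (Fin m)} : (π.extend e h l S).prev = h := by
  funext i
  simp [Policy.extend, Hist.prev]

/-- The record at epoch `k` of a realization. -/
noncomputable def Policy.count (π : Policy I m Ξ) (w : Outcome m Ξ) (k : ℕ) : ℕ :=
  (π.record k (π.visible w k)).1

/-- The amounts of work at epoch `k` of a realization. -/
noncomputable def Policy.work (π : Policy I m Ξ) (w : Outcome m Ξ) (k : ℕ) : ℕ → ℝ≥0∞ :=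
  (π.record k (π.visible w k)).2

lemma Policy.completing_subset_busy (π : Policy I m Ξ) (w : Outcome m Ξ) (k : ℕ) :
    π.completing w k ⊆ π.busy w.1 (π.run w k).hist := Finset.filter_subset _ _

lemma Policy.prev_run_succ (π : Policy I m Ξ) (w : Outcome m Ξ) (k : ℕ) :
    (π.run w (k + 1)).hist.prev = (π.run w k).hist := by
  rw [π.run_succ_hist, Policy.prev_extend]

lemma Policy.delivered_succ (π : Policy I m Ξ) (w : Outcome m Ξ) (k : ℕ) (j : Fin m) :
    (π.run w (k + 1)).hist.now.delivered j =
      if j ∈ π.completing w k then π.assign k w.1 (π.run w k).hist j else none := by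
  rw [π.run_succ_hist, Policy.now_extend]
  rfl

lemma Policy.serving_succ (π : Policy I m Ξ) (w : Outcome m Ξ) (k : ℕ) (j : Fin m) :
    (π.run w (k + 1)).hist.now.serving j =
      if j ∈ π.completing w k then none else π.assign k w.1 (π.run w k).hist j := by
  rw [π.run_succ_hist, Policy.now_extend]
  rfl

lemma Policy.time_succ_eq (π : Policy I m Ξ) (w : Outcome m Ξ) (k : ℕ) :
    (π.run w (k + 1)).hist.now.time = (π.run w k).hist.now.time + π.gap w k := by
  rw [π.time_succ, π.nextTime_eq]

lemma Policy.count_succ (π : Policy I m Ξ) (w : Outcome m Ξ) (k : ℕ) :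
    π.count w (k + 1) = π.count w k + (π.completing w k).card := by
  simp only [Policy.count, Policy.record, Policy.visible, π.prev_run_succ]
  congr 2
  ext j
  simp only [Finset.mem_filter, Finset.mem_univ, true_and, π.delivered_succ]
  by_cases hj : j ∈ π.completing w k
  · simp only [hj, if_true, iff_true]
    exact (Policy.mem_busy.1 (π.completing_subset_busy w k hj)).2
  · simp [hj]

lemma Policy.work_succ (π : Policy I m Ξ) (w : Outcome m Ξ) (k : ℕ) :
    π.work w (k + 1) = Function.update (π.work w k) (π.count w k)
      (π.work w k (π.count w k) + (π.busy w.1 (π.run w k).hist).card * π.gap w k) := by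
  simp only [Policy.count, Policy.work, Policy.record, Policy.visible, π.prev_run_succ,
    π.time_succ_eq]
  congr 2
  by_cases ht : (π.run w k).hist.now.time = ⊤
  · simp [Policy.busy_of_top ht]
  · rw [ENNReal.add_sub_cancel_left ht]

/-- The amounts of work between deliveries, continued by fresh amounts. -/
noncomputable def combine (r : ℕ × (ℕ → ℝ≥0∞)) (Z : ℕ → ℝ≥0∞) (i : ℕ) : ℝ≥0∞ :=
  if i < r.1 then r.2 i else r.2 i + Z i

lemma measurable_combine : Measurable fun p : (ℕ × (ℕ → ℝ≥0∞)) × (ℕ → ℝ≥0∞) =>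
    combine p.1 p.2 := by
  refine measurable_pi_iff.2 fun i => ?_
  refine Measurable.ite ?_ ?_ ?_
  · exact (measurable_fst.comp measurable_fst) (MeasurableSet.of_discrete (s := Set.Ioi i))
  · exact (measurable_pi_apply i).comp (measurable_snd.comp measurable_fst)
  · exact ((measurable_pi_apply i).comp (measurable_snd.comp measurable_fst)).add
      ((measurable_pi_apply i).comp measurable_snd)

/-- A step changes only the entry of the current delivery interval: the work of the gap is added,
and the fresh amount is kept exactly when nothing is delivered, which is `glue`. Two simultaneous
deliveries would close the following entry at zero work, hence the hypothesis on the completing set.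
-/
lemma Policy.combine_record_succ (π : Policy I m Ξ) (w : Outcome m Ξ) (k : ℕ)
    (h : (π.completing w k).card ≤ 1) (Z : ℕ → ℝ≥0∞) :
    combine (π.count w (k + 1), π.work w (k + 1)) Z =
      combine (π.count w k, π.work w k) (Function.update Z (π.count w k)
        (glue (π.busy w.1 (π.run w k).hist) (π.horizon w.1 (π.run w k).hist) (π.residual w k)
          (Z (π.count w k)))) := by
  funext i
  simp only [combine, π.count_succ, π.work_succ]
  set g := π.count w k
  by_cases hi : i = g
  · rw [hi]
    simp only [Function.update_self, lt_irrefl, if_false, glue]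
    change (if g < g + (π.completing w k).card then _ else _) =
      _ + (_ * π.gap w k + if π.completing w k = ∅ then _ else _)
    by_cases hS : π.completing w k = ∅
    · simp [hS, add_assoc]
    · have : 0 < (π.completing w k).card := Finset.card_pos.2 (Finset.nonempty_iff_ne_empty.2 hS)
      rw [if_pos (by omega), if_neg hS, add_zero]
  · rw [Function.update_of_ne hi, Function.update_of_ne hi]
    by_cases hlt : i < g
    · rw [if_pos hlt, if_pos (by omega)]
    · rw [if_neg hlt, if_neg (by omega)]

end Record

/-! ### The law of the amounts of work, common to all policies. -/

section WorkLaw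

variable {m : ℕ} {I : Input} {Ξ : Type*} [MeasurableSpace Ξ] {Ω : Type*} [MeasurableSpace Ω]
  {P : Measure Ω} [IsProbabilityMeasure P] {W : Ω → Outcome m Ξ} {ρ : Measure ℝ≥0∞}
  [IsProbabilityMeasure ρ] [NullSingletonClass ρ]

lemma Policy.ae_completing_card_le_one (hρ : Memoryless ρ) (hW : IsDriven P W ρ)
    (π : Policy I m Ξ) : ∀ᵐ ω ∂P, ∀ k, (π.completing (W ω) k).card ≤ 1 := by
  rw [ae_all_iff]
  intro k
  have hv : Measurable fun ω => π.visible (W ω) k := (π.measurable_visible k).comp hW.measurable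
  have hr : Measurable fun ω => π.residual (W ω) k :=
    (π.measurable_residual k).comp hW.measurable
  have : IsProbabilityMeasure (P.map fun ω => π.visible (W ω) k) :=
    Measure.isProbabilityMeasure_map hv.aemeasurable
  have h := congrArg (Measure.map Prod.snd) (π.map_visible_residual hρ hW k)
  rw [Measure.map_map measurable_snd (hv.prodMk hr), Measure.map_snd_prod, measure_univ,
    one_smul] at h
  have h2 : ∀ᵐ R ∂(P.map fun ω => π.residual (W ω) k), Function.Injective R := by
    have h' : (P.map fun ω => π.residual (W ω) k) = Measure.pi fun _ => ρ := h
    rw [h']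
    exact ae_injective_pi
  filter_upwards [ae_of_ae_map hr.aemeasurable h2] with ω hω
  exact firstSet_card_le_one hω

/-- The amounts of work between successive deliveries are independent with law `ρ`, under every
policy. -/
theorem Policy.map_combine_record (hρ : Memoryless ρ) (hW : IsDriven P W ρ) (π : Policy I m Ξ)
    (k : ℕ) :
    (P.prod (Measure.infinitePi fun _ : ℕ => ρ)).map
        (fun p => combine (π.count (W p.1) k, π.work (W p.1) k) p.2) =
      Measure.infinitePi fun _ : ℕ => ρ := by
  set ν : Measure (ℕ → ℝ≥0∞) := Measure.infinitePi fun _ : ℕ => ρ with hν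
  have hrec : ∀ k, Measurable fun p : Ω × (ℕ → ℝ≥0∞) =>
      combine (π.count (W p.1) k, π.work (W p.1) k) p.2 := fun k =>
    measurable_combine.comp (((π.measurable_record k).comp ((π.measurable_visible k).comp
      (hW.measurable.comp measurable_fst))).prodMk measurable_snd)
  induction k with
  | zero =>
    have : (fun p : Ω × (ℕ → ℝ≥0∞) => combine (π.count (W p.1) 0, π.work (W p.1) 0) p.2) =
        Prod.snd := by
      funext p i
      simp [combine, Policy.count, Policy.work, Policy.record]
    rw [this, Measure.map_snd_prod, measure_univ, one_smul]
  | succ k ih =>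
    -- It suffices that one more epoch does not change the law of the completed sequence.
    refine Eq.trans (Measure.ext_of_lintegral _ fun f hf => ?_) ih
    have hfk : ∀ k, Measurable fun p : Ω × (ℕ → ℝ≥0∞) =>
        f (combine (π.count (W p.1) k, π.work (W p.1) k) p.2) := fun k => hf.comp (hrec k)
    rw [lintegral_map hf (hrec (k + 1)), lintegral_map hf (hrec k),
      lintegral_prod _ (hfk (k + 1)).aemeasurable, lintegral_prod _ (hfk k).aemeasurable]
    have hv : Measurable fun ω => π.visible (W ω) k := (π.measurable_visible k).comp hW.measurable
    have hr : Measurable fun ω => π.residual (W ω) k :=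
      (π.measurable_residual k).comp hW.measurable
    -- the integrand as a function of the visible state, the residuals and the fresh work
    have hgl : Measurable fun q : ((Ξ × Hist m k) × (Fin m → ℝ≥0∞)) × ℝ≥0∞ =>
        glue (π.busy q.1.1.1 q.1.1.2) (π.horizon q.1.1.1 q.1.1.2) q.1.2 q.2 :=
      measurable_comp_countable
        (g := fun B (u : ℝ≥0∞ × (Fin m → ℝ≥0∞) × ℝ≥0∞) => glue B u.1 u.2.1 u.2.2)
        measurable_glue (π.measurable_busy.comp (measurable_fst.comp measurable_fst))
        ((π.measurable_horizon.comp (measurable_fst.comp measurable_fst)).prodMk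
          ((measurable_snd.comp measurable_fst).prodMk measurable_snd))
    have hrx : Measurable fun q : ((Ξ × Hist m k) × (Fin m → ℝ≥0∞)) × (ℕ → ℝ≥0∞) =>
        π.record k q.1.1 := (π.measurable_record k).comp (measurable_fst.comp measurable_fst)
    have hF : Measurable fun q : ((Ξ × Hist m k) × (Fin m → ℝ≥0∞)) × (ℕ → ℝ≥0∞) =>
        f (combine (π.record k q.1.1) (Function.update q.2 (π.record k q.1.1).1
          (glue (π.busy q.1.1.1 q.1.1.2) (π.horizon q.1.1.1 q.1.1.2) q.1.2
            (q.2 (π.record k q.1.1).1)))) := by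
      refine hf.comp (measurable_combine.comp (hrx.prodMk (measurable_update_nat.comp
        ((measurable_fst.comp hrx).prodMk (measurable_snd.prodMk (hgl.comp
          (measurable_fst.prodMk (measurable_eval_nat.comp
            ((measurable_fst.comp hrx).prodMk measurable_snd)))))))))
    have e1 : ∫⁻ ω, ∫⁻ Z, f (combine (π.count (W ω) (k + 1), π.work (W ω) (k + 1)) Z) ∂ν ∂P =
        ∫⁻ q, ∫⁻ Z, f (combine (π.record k q.1) (Function.update Z (π.record k q.1).1
          (glue (π.busy q.1.1 q.1.2) (π.horizon q.1.1 q.1.2) q.2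
            (Z (π.record k q.1).1)))) ∂ν
          ∂(P.map (fun ω => (π.visible (W ω) k, π.residual (W ω) k))) := by
      rw [lintegral_map hF.lintegral_prod_right' (hv.prodMk hr)]
      refine lintegral_congr_ae ?_
      filter_upwards [π.ae_completing_card_le_one hρ hW] with ω hω
      refine lintegral_congr fun Z => ?_
      rw [π.combine_record_succ (W ω) k (hω k) Z]
      rfl
    have hG : Measurable fun q : (Ξ × Hist m k) × (ℕ → ℝ≥0∞) =>
        f (combine (π.record k q.1) q.2) :=
      hf.comp (measurable_combine.comp
        (((π.measurable_record k).comp measurable_fst).prodMk measurable_snd))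
    have e2 : ∫⁻ ω, ∫⁻ Z, f (combine (π.count (W ω) k, π.work (W ω) k) Z) ∂ν ∂P =
        ∫⁻ x, ∫⁻ Z, f (combine (π.record k x) Z) ∂ν ∂(P.map (fun ω => π.visible (W ω) k)) := by
      rw [lintegral_map hG.lintegral_prod_right' hv]
      rfl
    refine e1.trans (Eq.trans ?_ e2.symm)
    rw [π.map_visible_residual hρ hW k, lintegral_prod _ hF.lintegral_prod_right'.aemeasurable]
    refine lintegral_congr fun x => ?_
    set r := π.record k x with hr'
    have hFx : Measurable fun Z : ℕ → ℝ≥0∞ => f (combine r Z) :=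
      hf.comp (measurable_combine.comp (measurable_const.prodMk measurable_id))
    have hupd : Measurable fun p : ℝ≥0∞ × (ℕ → ℝ≥0∞) =>
        f (combine r (Function.update p.2 r.1 p.1)) :=
      hFx.comp (measurable_update'.comp (measurable_snd.prodMk measurable_fst))
    have hglx : Measurable fun p : (Fin m → ℝ≥0∞) × ℝ≥0∞ =>
        glue (π.busy x.1 x.2) (π.horizon x.1 x.2) p.1 p.2 :=
      (measurable_glue _).comp (measurable_const.prodMk (measurable_fst.prodMk measurable_snd))
    -- The fresh amount in the current entry is independent of the other entries and may be
    -- integrated separately.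
    have h1 : ∀ R : Fin m → ℝ≥0∞, ∫⁻ Z, f (combine r (Function.update Z r.1
          (glue (π.busy x.1 x.2) (π.horizon x.1 x.2) R (Z r.1)))) ∂ν =
        ∫⁻ z, ∫⁻ Z, f (combine r (Function.update Z r.1
          (glue (π.busy x.1 x.2) (π.horizon x.1 x.2) R z))) ∂ν ∂ρ := by
      intro R
      rw [hν, lintegral_update_infinitePi r.1]
      · simp only [Function.update_self, Function.update_idem]
      · exact hupd.comp ((hglx.comp (measurable_const.prodMk (measurable_pi_apply r.1))).prodMk
          measurable_id)
    calc ∫⁻ R, ∫⁻ Z, f (combine r (Function.update Z r.1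
            (glue (π.busy x.1 x.2) (π.horizon x.1 x.2) R (Z r.1)))) ∂ν
            ∂(Measure.pi fun _ => ρ)
        = ∫⁻ R, ∫⁻ z, ∫⁻ Z, f (combine r (Function.update Z r.1
            (glue (π.busy x.1 x.2) (π.horizon x.1 x.2) R z))) ∂ν ∂ρ
            ∂(Measure.pi fun _ => ρ) := lintegral_congr h1
      _ = ∫⁻ p, ∫⁻ Z, f (combine r (Function.update Z r.1
            (glue (π.busy x.1 x.2) (π.horizon x.1 x.2) p.1 p.2))) ∂ν
            ∂((Measure.pi fun _ => ρ).prod ρ) :=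
          (lintegral_prod _ (hupd.lintegral_prod_right'.comp hglx).aemeasurable).symm
      _ = ∫⁻ y, ∫⁻ Z, f (combine r (Function.update Z r.1 y)) ∂ν ∂ρ := by
          -- Work during the gap, continued afresh if there is no delivery, is again a fresh amount
          -- of law `ρ`.
          conv_rhs => rw [← map_glue hρ (π.busy x.1 x.2) (π.horizon x.1 x.2)]
          rw [lintegral_map hupd.lintegral_prod_right' hglx]
      _ = ∫⁻ Z, f (combine r Z) ∂ν := by
          rw [hν, lintegral_update_infinitePi r.1 hFx]

end WorkLaw

/-! ### Counting packets and busy servers along one sample path. -/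

section Path

variable {m : ℕ} {I : Input} {Ξ : Type*} [MeasurableSpace Ξ]

/-- The time of epoch `k`. -/
noncomputable def Policy.time (π : Policy I m Ξ) (w : Outcome m Ξ) (k : ℕ) : ℝ≥0∞ :=
  (π.obs w k).time

/-- The packets that arrive up to time `T`. -/
def Input.arrived (I : Input) (T : ℝ≥0∞) : Set ℕ := {i | (i : ℕ∞) < I.n ∧ (I.arr i : ℝ≥0∞) ≤ T}

/-- The packets delivered up to epoch `k`. -/
def Policy.deliveredSet (π : Policy I m Ξ) (w : Outcome m Ξ) (k : ℕ) : Set ℕ :=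
  {i | ∃ l ≤ k, ∃ j, (π.obs w l).delivered j = some i}

/-- The packets in service after the decision of epoch `k`. -/
def Policy.served (π : Policy I m Ξ) (w : Outcome m Ξ) (k : ℕ) : Set ℕ :=
  {i | ∃ j, π.decision w k j = some i}

variable (π : Policy I m Ξ) (w : Outcome m Ξ)

lemma Policy.time_zero : π.time w 0 = 0 := rfl

lemma Policy.time_add_gap (k : ℕ) : π.time w (k + 1) = π.time w k + π.gap w k :=
  π.time_succ_eq w k

lemma Policy.time_mono : Monotone (π.time w) :=
  monotone_nat_of_le_succ fun k => π.time_le_time_succ w k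

lemma Policy.time_ne_top_of_le {k l : ℕ} (h : k ≤ l) (hl : π.time w l ≠ ⊤) : π.time w k ≠ ⊤ :=
  ne_top_of_le_ne_top hl (π.time_mono w h)

lemma Policy.time_succ_le_nextArrival (k : ℕ) :
    π.time w (k + 1) ≤ I.nextArrival (π.time w k) := by
  have h := π.time_succ w k
  change π.time w (k + 1) = _ at h
  rw [h]
  exact min_le_left _ _

lemma Policy.hist_apply (k : ℕ) (l : Fin (k + 1)) : (π.run w k).hist l = π.obs w l := by
  induction k with
  | zero =>
    obtain rfl : l = Fin.last 0 := Fin.ext (by have := l.2; simp)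
    rfl
  | succ k ih =>
    induction l using Fin.lastCases with
    | last => rfl
    | cast l =>
      have h := congrFun (π.prev_run_succ w k) l
      rw [ih] at h
      exact h

lemma Policy.inSystem_run (k : ℕ) :
    I.inSystem (π.run w k).hist = I.arrived (π.time w k) \ π.deliveredSet w k := by
  ext i
  simp only [Input.inSystem, Input.arrived, Policy.deliveredSet, Set.mem_sdiff, Set.mem_ofPred_eq,
    π.hist_apply]
  constructor
  · rintro ⟨h1, h2, h3⟩
    refine ⟨⟨h1, h2⟩, ?_⟩
    rintro ⟨l, hl, j, hj⟩
    exact h3 ⟨l, Nat.lt_succ_of_le hl⟩ j hj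
  · rintro ⟨⟨h1, h2⟩, h3⟩
    exact ⟨h1, h2, fun l j hj => h3 ⟨l, Nat.le_of_lt_succ l.2, j, hj⟩⟩

lemma Policy.mem_completing_iff_delivered {k : ℕ} {j : Fin m} {i : ℕ} :
    (π.obs w (k + 1)).delivered j = some i ↔
      j ∈ π.completing w k ∧ π.decision w k j = some i := by
  have h := π.delivered_succ w k j
  change (π.obs w (k + 1)).delivered j = if _ then π.decision w k j else none at h
  rw [h]
  split_ifs with hj <;> simp [hj]

lemma Policy.deliveredSet_zero : π.deliveredSet w 0 = ∅ := by
  ext i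
  simp only [Policy.deliveredSet, Set.mem_ofPred_eq, Set.mem_empty_iff_false, iff_false]
  rintro ⟨l, hl, j, hj⟩
  obtain rfl : l = 0 := by omega
  have h0 : (π.obs w 0).delivered j = none := rfl
  simp [h0] at hj

/-- The packets delivered at epoch `k + 1`. -/
def Policy.newlyDelivered (k : ℕ) : Set ℕ :=
  {i | ∃ j ∈ π.completing w k, π.decision w k j = some i}

lemma Policy.deliveredSet_succ (k : ℕ) :
    π.deliveredSet w (k + 1) = π.deliveredSet w k ∪ π.newlyDelivered w k := by
  ext i
  simp only [Policy.deliveredSet, Policy.newlyDelivered, Set.mem_ofPred_eq, Set.mem_union]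
  constructor
  · rintro ⟨l, hl, j, hj⟩
    rcases Nat.lt_or_ge l (k + 1) with h | h
    · exact Or.inl ⟨l, by omega, j, hj⟩
    · obtain rfl : l = k + 1 := by omega
      obtain ⟨h1, h2⟩ := (π.mem_completing_iff_delivered w).1 hj
      exact Or.inr ⟨j, h1, h2⟩
  · rintro (⟨l, hl, j, hj⟩ | ⟨j, h1, h2⟩)
    · exact ⟨l, by omega, j, hj⟩
    · exact ⟨k + 1, le_rfl, j, (π.mem_completing_iff_delivered w).2 ⟨h1, h2⟩⟩

lemma Policy.time_ne_top_of_mem_completing {k : ℕ} {j : Fin m} (h : j ∈ π.completing w k) :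
    π.time w k ≠ ⊤ := (Policy.mem_busy.1 (π.completing_subset_busy w k h)).1

lemma Policy.served_subset_inSystem {k : ℕ} (ht : π.time w k ≠ ⊤) :
    π.served w k ⊆ I.inSystem (π.run w k).hist := by
  rintro i ⟨j, hj⟩
  exact π.assign_mem k w.1 _ ht j i hj

lemma Policy.newlyDelivered_subset_inSystem (k : ℕ) :
    π.newlyDelivered w k ⊆ I.inSystem (π.run w k).hist := by
  rintro i ⟨j, h1, h2⟩
  exact π.served_subset_inSystem w (π.time_ne_top_of_mem_completing w h1) ⟨j, h2⟩

lemma Input.arrived_mono (I : Input) : Monotone I.arrived := fun _ _ h _ hi => ⟨hi.1, hi.2.trans h⟩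

lemma Input.arrived_finite (I : Input) {T : ℝ≥0∞} (hT : T ≠ ⊤) : (I.arrived T).Finite := by
  lift T to ℝ≥0 using hT
  refine (I.finite_arrivals T).subset ?_
  rintro i ⟨h1, h2⟩
  exact ⟨h1, ENNReal.coe_le_coe.1 h2⟩

lemma Input.ncard_arrived (I : Input) (T : ℝ≥0) : (I.arrived T).ncard = I.arrivalCount T := by
  rw [Input.arrivalCount]
  congr 1
  ext i
  simp [Input.arrived]

lemma Policy.deliveredSet_subset_arrived (k : ℕ) :
    π.deliveredSet w k ⊆ I.arrived (π.time w k) := by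
  induction k with
  | zero => simp [π.deliveredSet_zero]
  | succ k ih =>
    rw [π.deliveredSet_succ]
    refine Set.union_subset (ih.trans (I.arrived_mono (π.time_mono w (Nat.le_succ k)))) ?_
    refine (π.newlyDelivered_subset_inSystem w k).trans ?_
    rw [π.inSystem_run]
    exact Set.sdiff_subset.trans (I.arrived_mono (π.time_mono w (Nat.le_succ k)))

lemma ncard_assigned {a : Fin m → Option ℕ} (B : Finset (Fin m)) (hB : ∀ j ∈ B, a j ≠ none)
    (hinj : ∀ j j' i, a j = some i → a j' = some i → j = j') :
    {i | ∃ j ∈ B, a j = some i}.ncard = B.card := by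
  have h : (some '' {i | ∃ j ∈ B, a j = some i} : Set (Option ℕ)) = a '' (B : Set (Fin m)) := by
    ext o
    constructor
    · rintro ⟨i, ⟨j, hj, hji⟩, rfl⟩
      exact ⟨j, hj, hji⟩
    · rintro ⟨j, hj, rfl⟩
      obtain ⟨i, hi⟩ := Option.ne_none_iff_exists'.1 (hB j hj)
      exact ⟨i, ⟨j, hj, hi⟩, hi.symm⟩
  rw [← Set.ncard_image_of_injective _ (Option.some_injective ℕ), h, Set.InjOn.ncard_image,
    Set.ncard_coe_finset]
  intro j hj j' _ he
  obtain ⟨i, hi⟩ := Option.ne_none_iff_exists'.1 (hB j hj)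
  exact hinj j j' i hi (he ▸ hi)

lemma Policy.ncard_newlyDelivered (k : ℕ) :
    (π.newlyDelivered w k).ncard = (π.completing w k).card := by
  by_cases hne : (π.completing w k).Nonempty
  · obtain ⟨j, hj⟩ := hne
    exact ncard_assigned _
      (fun j hj => (Policy.mem_busy.1 (π.completing_subset_busy w k hj)).2)
      (π.assign_inj k w.1 _ (π.time_ne_top_of_mem_completing w hj))
  · rw [Finset.not_nonempty_iff_eq_empty] at hne
    simp [Policy.newlyDelivered, hne]

lemma Policy.newlyDelivered_finite (k : ℕ) : (π.newlyDelivered w k).Finite := by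
  have : π.newlyDelivered w k ⊆ ⋃ j, {i | π.decision w k j = some i} := by
    rintro i ⟨j, -, h⟩
    exact Set.mem_iUnion.2 ⟨j, h⟩
  refine (Set.finite_iUnion fun j => ?_).subset this
  refine Set.Subsingleton.finite fun i hi i' hi' => ?_
  exact Option.some_injective _ (Eq.trans (Eq.symm hi) hi')

lemma Policy.deliveredSet_finite_ncard (k : ℕ) :
    (π.deliveredSet w k).Finite ∧ (π.deliveredSet w k).ncard = π.count w k := by
  induction k with
  | zero => simp [π.deliveredSet_zero, Policy.count, Policy.record]
  | succ k ih =>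
    rw [π.deliveredSet_succ, π.count_succ, ← ih.2, ← π.ncard_newlyDelivered]
    refine ⟨ih.1.union (π.newlyDelivered_finite w k),
      Set.ncard_union_eq ?_ ih.1 (π.newlyDelivered_finite w k)⟩
    refine Set.disjoint_right.2 fun i hi => ?_
    have := π.newlyDelivered_subset_inSystem w k hi
    rw [π.inSystem_run] at this
    exact this.2

lemma Policy.ncard_inSystem (k : ℕ) :
    (I.inSystem (π.run w k).hist).ncard = (I.arrived (π.time w k)).ncard - π.count w k := by
  obtain ⟨hf, hc⟩ := π.deliveredSet_finite_ncard w k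
  rw [π.inSystem_run, Set.ncard_sdiff (π.deliveredSet_subset_arrived w k) hf, hc]

lemma Policy.ncard_served {k : ℕ} (ht : π.time w k ≠ ⊤) :
    (π.served w k).ncard = (π.busy w.1 (π.run w k).hist).card := by
  rw [← ncard_assigned (a := π.decision w k) (π.busy w.1 (π.run w k).hist)
    (fun j hj => (Policy.mem_busy.1 hj).2) (π.assign_inj k w.1 _ ht)]
  congr 1
  ext i
  constructor
  · rintro ⟨j, hj⟩
    refine ⟨j, Policy.mem_busy.2 ⟨ht, ?_⟩, hj⟩
    change π.decision w k j ≠ none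
    simp [hj]
  · rintro ⟨j, -, hj⟩
    exact ⟨j, hj⟩

lemma Policy.inSystem_finite {k : ℕ} (ht : π.time w k ≠ ⊤) :
    (I.inSystem (π.run w k).hist).Finite := by
  rw [π.inSystem_run]
  exact (I.arrived_finite ht).subset Set.sdiff_subset

/-- This bound and its equality case `Policy.busy_card_eq` are all that the comparison uses about
the choice of packets. -/
lemma Policy.busy_card_le {k : ℕ} (ht : π.time w k ≠ ⊤) :
    (π.busy w.1 (π.run w k).hist).card ≤
      min m ((I.arrived (π.time w k)).ncard - π.count w k) := by
  refine le_min ((Finset.card_le_univ _).trans (by simp)) ?_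
  rw [← π.ncard_inSystem w k, ← π.ncard_served w ht]
  exact Set.ncard_le_ncard (π.served_subset_inSystem w ht) (π.inSystem_finite w ht)

lemma Policy.busy_card_eq {k : ℕ} (ht : π.time w k ≠ ⊤)
    (hwc : ∀ j, π.decision w k j = none → π.waiting w k = ∅) :
    (π.busy w.1 (π.run w k).hist).card =
      min m ((I.arrived (π.time w k)).ncard - π.count w k) := by
  refine le_antisymm (π.busy_card_le w ht) ?_
  -- If a server idles, every packet in the system is in service; otherwise all `m` servers are
  -- busy.
  by_cases h : ∃ j, π.decision w k j = none
  · obtain ⟨j, hj⟩ := h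
    have hw := hwc j hj
    refine (min_le_right _ _).trans ?_
    rw [← π.ncard_inSystem w k, ← π.ncard_served w ht]
    refine Set.ncard_le_ncard (fun i hi => ?_)
      ((π.inSystem_finite w ht).subset (π.served_subset_inSystem w ht))
    by_contra hns
    have : i ∈ π.waiting w k := ⟨hi, fun j hj => hns ⟨j, hj⟩⟩
    rw [hw] at this
    exact this
  · push Not at h
    refine (min_le_left _ _).trans ?_
    have : π.busy w.1 (π.run w k).hist = Finset.univ := by
      ext j
      simp only [Policy.mem_busy, Finset.mem_univ, iff_true]
      exact ⟨ht, h j⟩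
    rw [this]
    simp

lemma Policy.count_mono : Monotone (π.count w) :=
  monotone_nat_of_le_succ fun k => by
    rw [π.count_succ]
    exact Nat.le_add_right _ _

lemma Policy.work_mono : Monotone (π.work w) :=
  monotone_nat_of_le_succ fun k i => by
    rw [π.work_succ]
    by_cases hi : i = π.count w k
    · rw [hi, Function.update_self]
      exact le_self_add
    · rw [Function.update_of_ne hi]

/-- Only the entry of the current delivery interval is ever modified, so entries below the count are
final. -/
lemma Policy.work_stable {k l : ℕ} (h : k ≤ l) {i : ℕ} (hi : i < π.count w k) :
    π.work w l i = π.work w k i := by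
  induction l, h using Nat.le_induction with
  | base => rfl
  | succ l hl ih =>
    rw [π.work_succ, Function.update_of_ne, ih]
    have := π.count_mono w hl
    omega

lemma Policy.work_eq_zero {k i : ℕ} (hi : π.count w k < i) : π.work w k i = 0 := by
  induction k with
  | zero => rfl
  | succ k ih =>
    have := π.count_succ w k
    rw [π.work_succ, Function.update_of_ne (by omega)]
    exact ih (by omega)

lemma Policy.completion_le_iff {k : ℕ} {t : ℝ≥0∞} (h1 : π.time w k ≤ t)
    (h2 : t < π.time w (k + 1)) (i : ℕ) : π.completion w i ≤ t ↔ i ∈ π.deliveredSet w k := by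
  constructor
  · intro h
    by_contra hn
    refine absurd (h.trans_lt h2) (not_lt.2 (le_sInf ?_))
    rintro _ ⟨l, j, hj, rfl⟩
    refine π.time_mono w ?_
    by_contra hl
    exact hn ⟨l, by omega, j, hj⟩
  · rintro ⟨l, hl, j, hj⟩
    have hle : π.completion w i ≤ π.time w l := sInf_le ⟨l, j, hj, rfl⟩
    exact hle.trans ((π.time_mono w hl).trans h1)

lemma Policy.deliveredCount_eq_count {k : ℕ} {t : ℝ≥0} (h1 : π.time w k ≤ t)
    (h2 : (t : ℝ≥0∞) < π.time w (k + 1)) : π.deliveredCount w t = π.count w k := by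
  rw [← (π.deliveredSet_finite_ncard w k).2, Policy.deliveredCount]
  congr 1
  ext i
  simp only [Set.mem_ofPred_eq, π.completion_le_iff w h1 h2]
  exact ⟨fun h => h.2, fun h => ⟨(π.deliveredSet_subset_arrived w k h).1, h⟩⟩

lemma Policy.exists_epoch {K : ℕ} {t : ℝ≥0∞} (h : t < π.time w K) :
    ∃ k < K, π.time w k ≤ t ∧ t < π.time w (k + 1) := by
  induction K with
  | zero => simp [π.time_zero] at h
  | succ K ih =>
    by_cases hK : t < π.time w K
    · obtain ⟨k, hk, h1, h2⟩ := ih hK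
      exact ⟨k, by omega, h1, h2⟩
    · exact ⟨K, Nat.lt_succ_self K, not_lt.1 hK, h⟩

/-- A packet is delivered after its arrival. -/
lemma Policy.arr_le_completion (i : ℕ) : (I.arr i : ℝ≥0∞) ≤ π.completion w i := by
  refine le_sInf ?_
  rintro _ ⟨l, j, hj, rfl⟩
  exact (π.deliveredSet_subset_arrived w l ⟨l, le_rfl, j, hj⟩).2

end Path

/-! ### The maximal work available, and the ideal system that uses all of it. -/

section Capacity

/-- The times in `[a, t)`. -/
def timesBetween (a : ℝ≥0) (t : ℝ≥0∞) : Set ℝ := {s | (a : ℝ) ≤ s ∧ ENNReal.ofReal s < t}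

lemma measurableSet_timesBetween (a : ℝ≥0) (t : ℝ≥0∞) : MeasurableSet (timesBetween a t) :=
  measurableSet_Ici.inter (ENNReal.measurable_ofReal measurableSet_Iio)

lemma volume_timesBetween (a : ℝ≥0) (t : ℝ≥0∞) : volume (timesBetween a t) = t - a := by
  induction t using ENNReal.recTopCoe with
  | top =>
    have : timesBetween a ⊤ = Set.Ici (a : ℝ) := by
      ext s
      simp [timesBetween]
    rw [this, Real.volume_Ici, ENNReal.top_sub_coe]
  | coe t =>
    have : timesBetween a t = Set.Ico (a : ℝ) t := by
      ext s
      simp only [timesBetween, Set.mem_ofPred_eq, Set.mem_Ico]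
      refine and_congr_right fun h => ?_
      rw [← ENNReal.ofReal_coe_nnreal, ENNReal.ofReal_lt_ofReal_iff_of_nonneg (a.2.trans h)]
    rw [this, Real.volume_Ico, ENNReal.ofReal_sub _ a.coe_nonneg]
    simp

variable (I : Input) (m : ℕ)

/-- The largest possible number of busy servers at time `s` when `i` packets have been delivered. -/
noncomputable def rate (i : ℕ) (s : ℝ≥0) : ℕ := min m (I.arrivalCount s - i)

/-- The largest possible amount of work up to time `t` if `i` packets are delivered all the time. -/
noncomputable def capacity (i : ℕ) (t : ℝ≥0∞) : ℝ≥0∞ :=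
  ∫⁻ s in timesBetween 0 t, (rate I m i s.toNNReal : ℝ≥0∞)

lemma Input.arrivalCount_mono : Monotone I.arrivalCount := by
  intro s t h
  rw [← I.ncard_arrived, ← I.ncard_arrived]
  exact Set.ncard_le_ncard (I.arrived_mono (ENNReal.coe_le_coe.2 h))
    (I.arrived_finite ENNReal.coe_ne_top)

lemma rate_mono (i : ℕ) : Monotone (rate I m i) := fun _ _ h =>
  min_le_min_left m (Nat.sub_le_sub_right (I.arrivalCount_mono h) i)

lemma timesBetween_subset {t t' : ℝ≥0∞} (a : ℝ≥0) (h : t ≤ t') :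
    timesBetween a t ⊆ timesBetween a t' := fun _ hs => ⟨hs.1, hs.2.trans_le h⟩

lemma capacity_mono (i : ℕ) : Monotone (capacity I m i) := fun _ _ h =>
  lintegral_mono_set (timesBetween_subset 0 h)

lemma capacity_ne_top (i : ℕ) {t : ℝ≥0∞} (ht : t ≠ ⊤) : capacity I m i t ≠ ⊤ := by
  have : capacity I m i t ≤ ∫⁻ _ in timesBetween 0 t, (m : ℝ≥0∞) := by
    refine lintegral_mono fun s => ?_
    exact Nat.cast_le.2 (min_le_left m _)
  refine ne_top_of_le_ne_top ?_ this
  rw [setLIntegral_const, volume_timesBetween]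
  exact ENNReal.mul_ne_top (ENNReal.natCast_ne_top m) (ENNReal.sub_ne_top ht)

lemma capacity_eq_add (i : ℕ) {a : ℝ≥0} {t : ℝ≥0∞} (h : (a : ℝ≥0∞) ≤ t) :
    capacity I m i t = capacity I m i a +
      ∫⁻ s in timesBetween a t, (rate I m i s.toNNReal : ℝ≥0∞) := by
  have hu : timesBetween 0 t = timesBetween 0 a ∪ timesBetween a t := by
    ext s
    simp only [timesBetween, Set.mem_ofPred_eq, Set.mem_union, NNReal.coe_zero]
    constructor
    · rintro ⟨h1, h2⟩
      rcases lt_or_ge s (a : ℝ) with hs | hs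
      · left
        refine ⟨h1, ?_⟩
        rw [← ENNReal.ofReal_coe_nnreal]
        exact (ENNReal.ofReal_lt_ofReal_iff_of_nonneg h1).2 hs
      · exact Or.inr ⟨hs, h2⟩
    · rintro (⟨h1, h2⟩ | ⟨h1, h2⟩)
      · exact ⟨h1, h2.trans_le h⟩
      · exact ⟨a.2.trans h1, h2⟩
  rw [capacity, hu, lintegral_union (measurableSet_timesBetween a t)]
  · rfl
  · refine Set.disjoint_left.2 fun s h1 h2 => ?_
    have := h1.2
    rw [← ENNReal.ofReal_coe_nnreal, ENNReal.ofReal_lt_ofReal_iff_of_nonneg h1.1] at this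
    exact absurd h2.1 (not_le.2 this)

lemma capacity_add_of_const (i : ℕ) {a : ℝ≥0} {t : ℝ≥0∞} (h : (a : ℝ≥0∞) ≤ t)
    (hc : ∀ s : ℝ≥0, a ≤ s → (s : ℝ≥0∞) < t → rate I m i s = rate I m i a) :
    capacity I m i t = capacity I m i a + rate I m i a * (t - a) := by
  rw [capacity_eq_add I m i h, ← volume_timesBetween, ← setLIntegral_const]
  congr 1
  refine setLIntegral_congr_fun (measurableSet_timesBetween a t) fun s hs => ?_
  rw [hc s.toNNReal (NNReal.le_toNNReal_of_coe_le hs.1) hs.2]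

/-- From a time with a packet available and `m > 0`, the maximal rate stays at least `1`. So
capacity then increases strictly and `idealTime` is not held back by a flat stretch. -/
lemma capacity_add_le (i : ℕ) {a : ℝ≥0} {t : ℝ≥0∞} (h : (a : ℝ≥0∞) ≤ t)
    (hc : 1 ≤ rate I m i a) : capacity I m i a + (t - a) ≤ capacity I m i t := by
  rw [capacity_eq_add I m i h, ← volume_timesBetween]
  gcongr
  rw [← setLIntegral_one]
  refine setLIntegral_mono' (measurableSet_timesBetween a t) fun s hs => ?_
  exact Nat.one_le_cast.2 (hc.trans (rate_mono I m i (NNReal.le_toNNReal_of_coe_le hs.1)))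

/-- The delivery times of a work-conserving system in which `E i` is the amount of work between the
deliveries number `i` and `i + 1`. -/
noncomputable def idealTime (E : ℕ → ℝ≥0∞) : ℕ → ℝ≥0∞
  | 0 => 0
  -- The strict inequality picks the latest time compatible with the work `E i`: an amount `0` does
  -- not allow a delivery while no packet is available. If the target is never exceeded the time is
  -- `⊤`.
  | i + 1 => sInf {t | capacity I m i (idealTime E i) + E i < capacity I m i t}

/-- The number of deliveries up to time `t` in the work-conserving system driven by `E`. -/
noncomputable def idealCount (E : ℕ → ℝ≥0∞) (t : ℝ≥0) : ℕ :=
  ({i ∈ Finset.range (I.arrivalCount t) | idealTime I m E (i + 1) ≤ t} : Finset ℕ).card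

lemma idealTime_mono (E : ℕ → ℝ≥0∞) : Monotone (idealTime I m E) :=
  monotone_nat_of_le_succ fun i => le_sInf fun _ ht =>
    ((capacity_mono I m i).reflect_lt (le_self_add.trans_lt ht)).le

lemma measurable_idealTime (i : ℕ) : Measurable fun E : ℕ → ℝ≥0∞ => idealTime I m E i := by
  induction i with
  | zero => exact measurable_const
  | succ i ih =>
    have hm : Monotone fun y : ℝ≥0∞ => sInf {t | y < capacity I m i t} := fun y y' h =>
      sInf_le_sInf fun t ht => h.trans_lt ht
    exact hm.measurable.comp
      (((capacity_mono I m i).measurable.comp ih).add (measurable_pi_apply i))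

lemma measurable_idealCount (t : ℝ≥0) : Measurable fun E : ℕ → ℝ≥0∞ => idealCount I m E t := by
  simp only [idealCount, Finset.card_filter]
  refine Finset.measurable_sum _ fun i _ => ?_
  exact Measurable.ite ((measurable_idealTime I m (i + 1)) measurableSet_Iic)
    measurable_const measurable_const

end Capacity

/-! ### Pathwise comparison with the ideal system. -/

section Comparison

variable {m : ℕ} {I : Input} {Ξ : Type*} [MeasurableSpace Ξ] (π : Policy I m Ξ) (w : Outcome m Ξ)

lemma Policy.arrived_eq_of_lt {k : ℕ} {s : ℝ≥0∞} (h1 : π.time w k ≤ s)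
    (h2 : s < π.time w (k + 1)) : I.arrived s = I.arrived (π.time w k) := by
  refine Set.Subset.antisymm (fun i hi => ?_) (I.arrived_mono h1)
  refine ⟨hi.1, ?_⟩
  by_contra hlt
  have h3 : I.nextArrival (π.time w k) ≤ I.arr i := sInf_le ⟨i, hi.1, rfl, not_le.1 hlt⟩
  exact absurd (((π.time_succ_le_nextArrival w k).trans h3).trans hi.2) (not_le.2 h2)

/-- Every arrival is an epoch, so for a fixed number of deliveries the maximal rate is constant
between epochs. -/
lemma Policy.capacity_succ {k : ℕ} (ht : π.time w k ≠ ⊤) (i : ℕ) :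
    capacity I m i (π.time w (k + 1)) = capacity I m i (π.time w k) +
      (min m ((I.arrived (π.time w k)).ncard - i) : ℕ) * π.gap w k := by
  obtain ⟨a, ha⟩ : ∃ a : ℝ≥0, (a : ℝ≥0∞) = π.time w k := ⟨_, ENNReal.coe_toNNReal ht⟩
  have hle := π.time_mono w (Nat.le_succ k)
  have h := capacity_add_of_const I m i (a := a) (t := π.time w (k + 1)) (ha ▸ hle) ?_
  · rw [ha] at h
    rw [h, rate, ← I.ncard_arrived, ha, π.time_add_gap, ENNReal.add_sub_cancel_left ht]
  · intro s h1 h2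
    rw [rate, rate, ← I.ncard_arrived, ← I.ncard_arrived, ha,
      π.arrived_eq_of_lt w (ha ▸ ENNReal.coe_le_coe.2 h1) h2]

/-- No policy delivers earlier than the work-conserving system with the same amounts of work. -/
lemma Policy.idealTime_le (hc : ∀ k, (π.completing w k).card ≤ 1) (E : ℕ → ℝ≥0∞) {k : ℕ}
    (ht : π.time w k ≠ ⊤) (hE : ∀ i < π.count w k, E i = π.work w k i) :
    idealTime I m E (π.count w k) ≤ π.time w k ∧
      capacity I m (π.count w k) (idealTime I m E (π.count w k)) + π.work w k (π.count w k) ≤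
        capacity I m (π.count w k) (π.time w k) := by
  induction k with
  | zero => simp [Policy.count, Policy.work, Policy.record, idealTime, π.time_zero]
  | succ k ih =>
    have ht' := π.time_ne_top_of_le w (Nat.le_succ k) ht
    have hmono := π.count_mono w (Nat.le_succ k)
    have hsucc := π.count_succ w k
    obtain ⟨h1, h2⟩ := ih ht' fun i hi => by
      rw [hE i (lt_of_lt_of_le hi hmono), π.work_stable w (Nat.le_succ k) hi]
    set g := π.count w k with hg
    have hw : π.work w (k + 1) g =
        π.work w k g + (π.busy w.1 (π.run w k).hist).card * π.gap w k := by
      rw [π.work_succ, Function.update_self]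
    have hcap : capacity I m g (idealTime I m E g) + π.work w (k + 1) g ≤
        capacity I m g (π.time w (k + 1)) := by
      rw [hw, π.capacity_succ w ht', ← add_assoc]
      gcongr
      exact π.busy_card_le w ht'
    rcases Nat.le_one_iff_eq_zero_or_eq_one.1 (hc k) with h0 | h0
    · have hg' : π.count w (k + 1) = g := by omega
      rw [hg']
      exact ⟨h1.trans (π.time_mono w (Nat.le_succ k)), hcap⟩
    · have hg' : π.count w (k + 1) = g + 1 := by omega
      have hle : idealTime I m E (g + 1) ≤ π.time w (k + 1) := by
        obtain ⟨a, ha⟩ : ∃ a : ℝ≥0, (a : ℝ≥0∞) = π.time w (k + 1) :=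
          ⟨_, ENNReal.coe_toNNReal ht⟩
        have hrate : 1 ≤ rate I m g a := by
          have hb : 1 ≤ (π.busy w.1 (π.run w k).hist).card :=
            h0 ▸ Finset.card_le_card (π.completing_subset_busy w k)
          refine (hb.trans (π.busy_card_le w ht')).trans ?_
          rw [rate, ← I.ncard_arrived, ha]
          refine min_le_min_left m (Nat.sub_le_sub_right (Set.ncard_le_ncard
            (I.arrived_mono (π.time_mono w (Nat.le_succ k))) (I.arrived_finite ht)) _)
        -- The work done is only known to be at most the capacity at the delivery time, whereas
        -- `idealTime` asks for a strict excess; an extra time `ε` provides it, since a packet was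
        -- available.
        refine ENNReal.le_of_forall_pos_le_add fun ε hε _ => sInf_le ?_
        have h3 := capacity_add_le I m g (a := a) (t := π.time w (k + 1) + ε)
          (ha ▸ le_self_add) hrate
        rw [ha, ENNReal.add_sub_cancel_left ht] at h3
        rw [Set.mem_ofPred_eq, hE g (by omega)]
        refine (hcap.trans_lt ?_).trans_le h3
        exact ENNReal.lt_add_right (capacity_ne_top I m g ht) (by simpa using hε.ne')
      rw [hg']
      refine ⟨hle, ?_⟩
      -- The new delivery interval starts with no work, so the second claim reduces to monotonicity
      -- of capacity.
      rw [π.work_succ, Function.update_of_ne (by omega), π.work_eq_zero w (by omega), add_zero]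
      exact (capacity_mono I m (g + 1)) hle

variable {π w}

lemma Policy.capacity_succ_of_workConserving {k : ℕ} (ht : π.time w k ≠ ⊤)
    (hwc : ∀ j, π.decision w k j = none → π.waiting w k = ∅) :
    capacity I m (π.count w k) (π.time w (k + 1)) = capacity I m (π.count w k) (π.time w k) +
      (π.busy w.1 (π.run w k).hist).card * π.gap w k := by
  rw [π.capacity_succ w ht, π.busy_card_eq w ht hwc]

lemma le_idealTime_succ {E : ℕ → ℝ≥0∞} {i : ℕ} {t : ℝ≥0∞}
    (h : capacity I m i t ≤ capacity I m i (idealTime I m E i) + E i) :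
    t ≤ idealTime I m E (i + 1) :=
  le_sInf fun _ hs => ((capacity_mono I m i).reflect_lt (h.trans_lt hs)).le

/-- The reverse of the capacity bound in `Policy.idealTime_le`: under work conservation the work
done grows exactly like the capacity. -/
lemma Policy.capacity_le (hc : ∀ k, (π.completing w k).card ≤ 1)
    (hwc : ∀ k, π.time w k ≠ ⊤ → ∀ j, π.decision w k j = none → π.waiting w k = ∅)
    {E : ℕ → ℝ≥0∞} {k : ℕ} (ht : π.time w k ≠ ⊤) (hE : ∀ i < π.count w k, E i = π.work w k i) :
    capacity I m (π.count w k) (π.time w k) ≤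
      capacity I m (π.count w k) (idealTime I m E (π.count w k)) +
        π.work w k (π.count w k) := by
  induction k with
  | zero => simp [Policy.count, Policy.work, Policy.record, idealTime, π.time_zero]
  | succ k ih =>
    have ht' := π.time_ne_top_of_le w (Nat.le_succ k) ht
    have hmono := π.count_mono w (Nat.le_succ k)
    have hsucc := π.count_succ w k
    have h1 := ih ht' fun i hi => by
      rw [hE i (lt_of_lt_of_le hi hmono), π.work_stable w (Nat.le_succ k) hi]
    set g := π.count w k with hg
    have hcap : capacity I m g (π.time w (k + 1)) ≤
        capacity I m g (idealTime I m E g) + π.work w (k + 1) g := by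
      rw [π.work_succ, Function.update_self, Policy.capacity_succ_of_workConserving ht' (hwc k ht'),
        ← add_assoc]
      gcongr
    rcases Nat.le_one_iff_eq_zero_or_eq_one.1 (hc k) with h0 | h0
    · have hg' : π.count w (k + 1) = g := by omega
      rw [hg']
      exact hcap
    · have hg' : π.count w (k + 1) = g + 1 := by omega
      rw [hg']
      refine le_add_right ((capacity_mono I m (g + 1)) (le_idealTime_succ ?_))
      rw [hE g (by omega)]
      exact hcap

/-- A work-conserving policy delivers no later than the work-conserving system with the same amounts
of work. -/
lemma Policy.time_le_idealTime (hc : ∀ k, (π.completing w k).card ≤ 1)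
    (hwc : ∀ k, π.time w k ≠ ⊤ → ∀ j, π.decision w k j = none → π.waiting w k = ∅)
    {E : ℕ → ℝ≥0∞} {k : ℕ} (ht : π.time w k ≠ ⊤) (hE : ∀ i < π.count w k, E i = π.work w k i)
    (hE' : π.work w (k + 1) (π.count w k) ≤ E (π.count w k)) :
    π.time w (k + 1) ≤ idealTime I m E (π.count w k + 1) := by
  refine le_idealTime_succ ?_
  rw [π.work_succ, Function.update_self] at hE'
  rw [Policy.capacity_succ_of_workConserving ht (hwc k ht)]
  refine (add_le_add_left (Policy.capacity_le hc hwc ht hE) _).trans ?_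
  rw [add_assoc]
  gcongr

lemma combine_of_lt {r : ℕ × (ℕ → ℝ≥0∞)} {Z : ℕ → ℝ≥0∞} {i : ℕ} (h : i < r.1) :
    combine r Z i = r.2 i := if_pos h

lemma le_combine (r : ℕ × (ℕ → ℝ≥0∞)) (Z : ℕ → ℝ≥0∞) (i : ℕ) : r.2 i ≤ combine r Z i := by
  rw [combine]
  split_ifs
  · exact le_rfl
  · exact le_self_add

lemma Policy.combine_of_lt_count {k K : ℕ} (hk : k ≤ K) (Z : ℕ → ℝ≥0∞) {i : ℕ}
    (hi : i < π.count w k) : combine (π.count w K, π.work w K) Z i = π.work w k i := by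
  rw [combine_of_lt (r := (π.count w K, π.work w K)) (lt_of_lt_of_le hi (π.count_mono w hk))]
  exact π.work_stable w hk hi

lemma Policy.deliveredCount_le_arrivalCount (π : Policy I m Ξ) (w : Outcome m Ξ) (t : ℝ≥0) :
    π.deliveredCount w t ≤ I.arrivalCount t := by
  refine Set.ncard_le_ncard ?_ (I.finite_arrivals t)
  rintro i ⟨h1, h2⟩
  exact ⟨h1, ENNReal.coe_le_coe.1 ((π.arr_le_completion w i).trans h2)⟩

/-- The first `K` epochs cover time `t`, and the entries of work closed by then no longer change; so
the arbitrary continuation `Z` is harmless. -/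
lemma Policy.deliveredCount_le_idealCount (hc : ∀ k, (π.completing w k).card ≤ 1) {K : ℕ}
    {t : ℝ≥0} (ht : (t : ℝ≥0∞) < π.time w K) (Z : ℕ → ℝ≥0∞) :
    π.deliveredCount w t ≤ idealCount I m (combine (π.count w K, π.work w K) Z) t := by
  obtain ⟨k, hk, h1, h2⟩ := π.exists_epoch w ht
  have hd := π.deliveredCount_eq_count w h1 h2
  have hA := π.deliveredCount_le_arrivalCount w t
  rw [hd] at hA ⊢
  have hle := (π.idealTime_le w hc (combine (π.count w K, π.work w K) Z)
    (ne_top_of_le_ne_top ENNReal.coe_ne_top h1)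
    fun i hi => Policy.combine_of_lt_count hk.le Z hi).1
  have hsub : Finset.range (π.count w k) ⊆
      ({i ∈ Finset.range (I.arrivalCount t) |
        idealTime I m (combine (π.count w K, π.work w K) Z) (i + 1) ≤ t} : Finset ℕ) := by
    intro i hi
    rw [Finset.mem_range] at hi
    refine Finset.mem_filter.2 ⟨Finset.mem_range.2 (hi.trans_le hA), ?_⟩
    exact ((idealTime_mono I m _ (Nat.succ_le_of_lt hi)).trans hle).trans h1
  have := Finset.card_le_card hsub
  rw [Finset.card_range] at this
  exact this

/-- The current interval is still open at `t`, so its completed entry is at least the work done up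
to the next epoch; the next ideal delivery is therefore later than `t`. -/
lemma Policy.idealCount_le_deliveredCount (hc : ∀ k, (π.completing w k).card ≤ 1)
    (hwc : ∀ k, π.time w k ≠ ⊤ → ∀ j, π.decision w k j = none → π.waiting w k = ∅) {K : ℕ}
    {t : ℝ≥0} (ht : (t : ℝ≥0∞) < π.time w K) (Z : ℕ → ℝ≥0∞) :
    idealCount I m (combine (π.count w K, π.work w K) Z) t ≤ π.deliveredCount w t := by
  obtain ⟨k, hk, h1, h2⟩ := π.exists_epoch w ht
  rw [π.deliveredCount_eq_count w h1 h2]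
  have hle := Policy.time_le_idealTime hc hwc (E := combine (π.count w K, π.work w K) Z)
    (ne_top_of_le_ne_top ENNReal.coe_ne_top h1)
    (fun i hi => Policy.combine_of_lt_count hk.le Z hi)
    ((π.work_mono w (Nat.succ_le_of_lt hk) _).trans (le_combine _ Z _))
  have hsub : ({i ∈ Finset.range (I.arrivalCount t) |
        idealTime I m (combine (π.count w K, π.work w K) Z) (i + 1) ≤ t} : Finset ℕ) ⊆
      Finset.range (π.count w k) := by
    intro i hi
    rw [Finset.mem_range]
    by_contra hlt
    have h3 := (Finset.mem_filter.1 hi).2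
    have h4 := idealTime_mono I m (combine (π.count w K, π.work w K) Z)
      (by omega : π.count w k + 1 ≤ i + 1)
    exact absurd ((hle.trans h4).trans h3) (not_le.2 h2)
  have := Finset.card_le_card hsub
  rw [Finset.card_range] at this
  exact this

end Comparison

/-! ### Measurability of the counts, and `N = A - γ`. -/

section CountMeasurability

variable {m : ℕ} {I : Input} {Ξ : Type*} [MeasurableSpace Ξ] (π : Policy I m Ξ)

lemma Policy.measurable_obs (k : ℕ) : Measurable fun w : Outcome m Ξ => π.obs w k :=
  measurable_now.comp (measurable_snd.comp (π.measurable_visible k))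

lemma Policy.measurable_time (k : ℕ) : Measurable fun w : Outcome m Ξ => π.time w k :=
  measurable_fst.comp (π.measurable_obs k)

lemma Policy.completion_eq_iInf (w : Outcome m Ξ) (i : ℕ) :
    π.completion w i =
      ⨅ k, ⨅ j, if (π.obs w k).delivered j = some i then π.time w k else ⊤ := by
  refine le_antisymm (le_iInf fun k => le_iInf fun j => ?_) (le_sInf ?_)
  · split_ifs with h
    · exact sInf_le ⟨k, j, h, rfl⟩
    · exact le_top
  · rintro _ ⟨k, j, h, rfl⟩
    refine (iInf_le _ k).trans ((iInf_le _ j).trans ?_)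
    rw [if_pos h]
    rfl

lemma Policy.measurable_completion (i : ℕ) :
    Measurable fun w : Outcome m Ξ => π.completion w i := by
  simp only [π.completion_eq_iInf]
  refine Measurable.iInf fun k => Measurable.iInf fun j => Measurable.ite ?_ (π.measurable_time k)
    measurable_const
  exact ((measurable_pi_apply j).comp ((measurable_fst.comp measurable_snd).comp
    (π.measurable_obs k))) (MeasurableSet.of_discrete (s := {some i}))

lemma Policy.deliveredCount_eq_sum (w : Outcome m Ξ) (t : ℝ≥0) :
    π.deliveredCount w t =
      ∑ i ∈ (I.finite_arrivals t).toFinset, if π.completion w i ≤ t then 1 else 0 := by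
  rw [← Finset.card_filter, ← Set.ncard_coe_finset, Policy.deliveredCount]
  congr 1
  ext i
  simp only [Set.mem_ofPred_eq, Finset.coe_filter, Set.Finite.mem_toFinset]
  exact ⟨fun h => ⟨⟨h.1, ENNReal.coe_le_coe.1 ((π.arr_le_completion w i).trans h.2)⟩, h.2⟩,
    fun h => ⟨h.1.1, h.2⟩⟩

lemma Policy.measurable_deliveredCount (t : ℝ≥0) :
    Measurable fun w : Outcome m Ξ => π.deliveredCount w t := by
  simp only [π.deliveredCount_eq_sum]
  refine Finset.measurable_sum _ fun i _ => ?_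
  exact Measurable.ite ((π.measurable_completion i) measurableSet_Iic) measurable_const
    measurable_const

lemma Policy.queueLength_eq_sub (w : Outcome m Ξ) (t : ℝ≥0) :
    π.queueLength w t = I.arrivalCount t - π.deliveredCount w t := by
  have hsub : {i : ℕ | (i : ℕ∞) < I.n ∧ π.completion w i ≤ t} ⊆
      {i : ℕ | (i : ℕ∞) < I.n ∧ I.arr i ≤ t} := fun i hi =>
    ⟨hi.1, ENNReal.coe_le_coe.1 ((π.arr_le_completion w i).trans hi.2)⟩
  rw [Input.arrivalCount, Policy.deliveredCount,
    ← Set.ncard_sdiff hsub ((I.finite_arrivals t).subset hsub), Policy.queueLength]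
  congr 1
  ext i
  simp only [Set.mem_ofPred_eq, Set.mem_sdiff, not_and, not_le]
  exact ⟨fun h => ⟨⟨h.1, h.2.1⟩, fun _ => h.2.2⟩, fun h => ⟨h.1.1, h.1.2, h.2 h.1.1⟩⟩

end CountMeasurability

/-! ### From pathwise bounds to stochastic order, throughput and delay. -/

section StochasticOrder

variable {m : ℕ} {I : Input} {Ξ : Type*} [MeasurableSpace Ξ] {Ω : Type*} [MeasurableSpace Ω]
  {P : Measure Ω} [IsProbabilityMeasure P] {W : Ω → Outcome m Ξ} {ρ : Measure ℝ≥0∞}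
  [IsProbabilityMeasure ρ] [NullSingletonClass ρ]

lemma measurableSet_of_finite_pi_nat {ι : Type*} [Finite ι] (U : Set (ι → ℕ)) : MeasurableSet U :=
  (Set.to_countable U).measurableSet

-- The comparison works with finitely many epochs; admissibility makes the probability that they do
-- not reach beyond `T` vanish.
omit [IsProbabilityMeasure P] in
lemma Policy.tendsto_measure_time_le [IsFiniteMeasure P] (hWm : Measurable W) (π : Policy I m Ξ)
    (hπ : π.Admissible P W) (T : ℝ≥0) :
    Tendsto (fun K => P {ω | π.time (W ω) K ≤ T}) atTop (𝓝 0) := by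
  have hz : P (⋂ K, {ω | π.time (W ω) K ≤ T}) = 0 := by
    have hsub : (⋂ K, {ω | π.time (W ω) K ≤ T}) ⊆
        {ω | ¬ Tendsto (fun k => π.time (W ω) k) atTop (𝓝 ⊤)} := ?_
    · exact measure_mono_null hsub (ae_iff.1 hπ)
    intro ω hω hlim
    obtain ⟨K, hK⟩ := (hlim.eventually (lt_mem_nhds (ENNReal.coe_lt_top (r := T)))).exists
    exact absurd (Set.mem_iInter.1 hω K) (not_le.2 hK)
  rw [← hz]
  refine tendsto_measure_iInter_atTop (fun K => ?_) ?_ ⟨0, measure_ne_top _ _⟩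
  · exact (((π.measurable_time K).comp hWm) measurableSet_Iic).nullMeasurableSet
  · intro K K' h ω hω
    exact (π.time_mono (W ω) h).trans hω

lemma le_of_tendsto_add_zero {a b : ℝ≥0∞} {u : ℕ → ℝ≥0∞} (hu : Tendsto u atTop (𝓝 0))
    (h : ∀ K, a ≤ b + u K) : a ≤ b := by
  have := ge_of_tendsto' (hu.const_add b) h
  rwa [add_zero] at this

lemma exists_forall_le {ι : Type*} [Finite ι] (t : ι → ℝ≥0) : ∃ T, ∀ l, t l ≤ T := by
  obtain ⟨T, hT⟩ := (Set.finite_range t).bddAbove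
  exact ⟨T, fun l => hT ⟨l, rfl⟩⟩

lemma Policy.measure_combine_preimage (hρ : Memoryless ρ) (hW : IsDriven P W ρ)
    (π : Policy I m Ξ) (K : ℕ) {A : Set (ℕ → ℝ≥0∞)} (hA : MeasurableSet A) :
    (P.prod (Measure.infinitePi fun _ : ℕ => ρ))
        {p | combine (π.count (W p.1) K, π.work (W p.1) K) p.2 ∈ A} =
      (Measure.infinitePi fun _ : ℕ => ρ) A := by
  have hm : Measurable fun p : Ω × (ℕ → ℝ≥0∞) =>
      combine (π.count (W p.1) K, π.work (W p.1) K) p.2 :=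
    measurable_combine.comp (((π.measurable_record K).comp ((π.measurable_visible K).comp
      (hW.measurable.comp measurable_fst))).prodMk measurable_snd)
  conv_rhs => rw [← π.map_combine_record hρ hW K]
  rw [Measure.map_apply hm hA]
  rfl

variable {ι : Type*} [Finite ι]

lemma measurableSet_idealCount_mem (t : ι → ℝ≥0) (U : Set (ι → ℕ)) :
    MeasurableSet {E : ℕ → ℝ≥0∞ | (fun l => idealCount I m E (t l)) ∈ U} :=
  (measurable_pi_iff.2 fun l => measurable_idealCount I m (t l))
    (measurableSet_of_finite_pi_nat U)

/-- The pathwise bound holds off a null set and off the event that `K` epochs do not pass `T`. The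
bounding process has a law that does not depend on `K`, so `K → ∞` removes the error. -/
lemma Policy.measure_deliveredCount_le (hρ : Memoryless ρ) (hW : IsDriven P W ρ)
    (π : Policy I m Ξ) (hπ : π.Admissible P W) (t : ι → ℝ≥0) {U : Set (ι → ℕ)}
    (hU : IsUpperSet U) :
    P {ω | (fun l => π.deliveredCount (W ω) (t l)) ∈ U} ≤
      (Measure.infinitePi fun _ : ℕ => ρ) {E | (fun l => idealCount I m E (t l)) ∈ U} := by
  set ν : Measure (ℕ → ℝ≥0∞) := Measure.infinitePi fun _ : ℕ => ρ
  obtain ⟨T, hT⟩ := exists_forall_le t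
  refine le_of_tendsto_add_zero (π.tendsto_measure_time_le hW.measurable hπ T) fun K => ?_
  set N : Set Ω := {ω | ¬ ∀ k, (π.completing (W ω) k).card ≤ 1} with hN
  have hN0 : P N = 0 := ae_iff.1 (π.ae_completing_card_le_one hρ hW)
  rw [← π.measure_combine_preimage hρ hW K (measurableSet_idealCount_mem t U)]
  have hprod : ∀ A : Set Ω, (P.prod ν) (A ×ˢ Set.univ) = P A := fun A => by
    rw [Measure.prod_prod, measure_univ, mul_one]
  rw [← hprod, ← hprod {ω | π.time (W ω) K ≤ T}]
  have hNp : (P.prod ν) (N ×ˢ Set.univ) = 0 := by rw [hprod, hN0]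
  rw [← add_zero (_ + _), ← hNp]
  refine (measure_mono ?_).trans ((measure_union_le _ _).trans
    (add_le_add_left (measure_union_le _ _) _))
  rintro ⟨ω, Z⟩ ⟨hω, -⟩
  by_cases h1 : ω ∈ N
  · exact Or.inr ⟨h1, trivial⟩
  by_cases h2 : π.time (W ω) K ≤ T
  · exact Or.inl (Or.inr ⟨h2, trivial⟩)
  refine Or.inl (Or.inl (hU (fun l => ?_) hω))
  exact Policy.deliveredCount_le_idealCount (not_not.1 h1)
    ((ENNReal.coe_le_coe.2 (hT l)).trans_lt (not_le.1 h2)) Z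

lemma Policy.le_measure_deliveredCount (hρ : Memoryless ρ) (hW : IsDriven P W ρ)
    (π : Policy I m Ξ) (hπ : π.Admissible P W) (hwc : π.WorkConserving P W) (t : ι → ℝ≥0)
    {U : Set (ι → ℕ)} (hU : IsUpperSet U) :
    (Measure.infinitePi fun _ : ℕ => ρ) {E | (fun l => idealCount I m E (t l)) ∈ U} ≤
      P {ω | (fun l => π.deliveredCount (W ω) (t l)) ∈ U} := by
  set ν : Measure (ℕ → ℝ≥0∞) := Measure.infinitePi fun _ : ℕ => ρ
  obtain ⟨T, hT⟩ := exists_forall_le t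
  refine le_of_tendsto_add_zero (π.tendsto_measure_time_le hW.measurable hπ T) fun K => ?_
  set N : Set Ω := {ω | ¬ ((∀ k, (π.completing (W ω) k).card ≤ 1) ∧
    ∀ k, π.time (W ω) k ≠ ⊤ → ∀ j, π.decision (W ω) k j = none →
      π.waiting (W ω) k = ∅)} with hN
  have hN0 : P N = 0 := ae_iff.1 ((π.ae_completing_card_le_one hρ hW).and hwc)
  rw [← π.measure_combine_preimage hρ hW K (measurableSet_idealCount_mem t U)]
  have hprod : ∀ A : Set Ω, (P.prod ν) (A ×ˢ Set.univ) = P A := fun A => by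
    rw [Measure.prod_prod, measure_univ, mul_one]
  rw [← hprod, ← hprod {ω | π.time (W ω) K ≤ T}]
  have hNp : (P.prod ν) (N ×ˢ Set.univ) = 0 := by rw [hprod, hN0]
  rw [← add_zero (_ + _), ← hNp]
  refine (measure_mono ?_).trans ((measure_union_le _ _).trans
    (add_le_add_left (measure_union_le _ _) _))
  rintro ⟨ω, Z⟩ hω
  by_cases h1 : ω ∈ N
  · exact Or.inr ⟨h1, trivial⟩
  by_cases h2 : π.time (W ω) K ≤ T
  · exact Or.inl (Or.inr ⟨h2, trivial⟩)
  refine Or.inl (Or.inl ⟨hU (fun l => ?_) hω, trivial⟩)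
  exact Policy.idealCount_le_deliveredCount (not_not.1 h1).1 (not_not.1 h1).2
    ((ENNReal.coe_le_coe.2 (hT l)).trans_lt (not_le.1 h2)) Z

/-- The delivery process of a work-conserving policy is stochastically largest. -/
theorem Policy.measure_deliveredCount_mono (hρ : Memoryless ρ) (hW : IsDriven P W ρ)
    {π π' : Policy I m Ξ} (hπ : π.Admissible P W) (hwc : π.WorkConserving P W)
    (hπ' : π'.Admissible P W) (t : ι → ℝ≥0) {U : Set (ι → ℕ)} (hU : IsUpperSet U) :
    P {ω | (fun l => π'.deliveredCount (W ω) (t l)) ∈ U} ≤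
      P {ω | (fun l => π.deliveredCount (W ω) (t l)) ∈ U} :=
  (π'.measure_deliveredCount_le hρ hW hπ' t hU).trans
    (π.le_measure_deliveredCount hρ hW hπ hwc t hU)

omit [Finite ι] in
lemma Policy.measurable_deliveredCount_comp (hWm : Measurable W) (π : Policy I m Ξ) (t : ι → ℝ≥0) :
    Measurable fun ω (l : ι) => π.deliveredCount (W ω) (t l) :=
  measurable_pi_iff.2 fun l => (π.measurable_deliveredCount (t l)).comp hWm

omit [Finite ι] in
lemma Policy.measurable_deliveredCount_process (hWm : Measurable W) (π : Policy I m Ξ) :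
    Measurable fun ω (t : ℝ≥0) => π.deliveredCount (W ω) t :=
  measurable_pi_iff.2 fun t => (π.measurable_deliveredCount t).comp hWm

/-- All work-conserving policies have the same delivery process in law. -/
theorem Policy.identDistrib_deliveredCount (hρ : Memoryless ρ) (hW : IsDriven P W ρ)
    {π π' : Policy I m Ξ} (hπ : π.Admissible P W) (hwc : π.WorkConserving P W)
    (hπ' : π'.Admissible P W) (hwc' : π'.WorkConserving P W) :
    IdentDistrib (fun ω (t : ℝ≥0) => π.deliveredCount (W ω) t)
      (fun ω (t : ℝ≥0) => π'.deliveredCount (W ω) t) P P := by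
  refine (identDistrib_iff_forall_finset_identDistrib
    (π.measurable_deliveredCount_process hW.measurable).aemeasurable
    (π'.measurable_deliveredCount_process hW.measurable).aemeasurable).2 fun J => ?_
  have hm : ∀ π : Policy I m Ξ, Measurable fun ω (l : J) => π.deliveredCount (W ω) l :=
    fun π => π.measurable_deliveredCount_comp hW.measurable _
  refine ⟨(hm π).aemeasurable, (hm π').aemeasurable, ?_⟩
  change P.map (fun ω (l : J) => π.deliveredCount (W ω) l) =
    P.map (fun ω (l : J) => π'.deliveredCount (W ω) l)
  have hup : ∀ U : Set (J → ℕ), IsUpperSet U →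
      P.map (fun ω (l : J) => π.deliveredCount (W ω) l) U =
      P.map (fun ω (l : J) => π'.deliveredCount (W ω) l) U := by
    intro U hU
    rw [Measure.map_apply (hm π) (measurableSet_of_finite_pi_nat U),
      Measure.map_apply (hm π') (measurableSet_of_finite_pi_nat U)]
    exact le_antisymm (Policy.measure_deliveredCount_mono hρ hW hπ' hwc' hπ (fun l : J => l.1) hU)
      (Policy.measure_deliveredCount_mono hρ hW hπ hwc hπ' (fun l : J => l.1) hU)
  have : IsProbabilityMeasure (P.map (fun ω (l : J) => π.deliveredCount (W ω) l)) :=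
    Measure.isProbabilityMeasure_map (hm π).aemeasurable
  have : IsProbabilityMeasure (P.map (fun ω (l : J) => π'.deliveredCount (W ω) l)) :=
    Measure.isProbabilityMeasure_map (hm π').aemeasurable
  refine Measure.ext_of_singleton fun x => ?_
  -- A point is a difference of two upper sets, so agreement on upper sets determines a law on this
  -- countable space.
  have hx : ({x} : Set (J → ℕ)) = Set.Ici x \ Set.Ioi x := by
    ext y
    simp only [Set.mem_singleton_iff, Set.mem_sdiff, Set.mem_Ici, Set.mem_Ioi]
    constructor
    · rintro rfl
      exact ⟨le_rfl, lt_irrefl _⟩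
    · rintro ⟨h1, h2⟩
      exact (eq_of_le_of_not_lt h1 h2).symm
  rw [hx, measure_sdiff Set.Ioi_subset_Ici_self
      (measurableSet_of_finite_pi_nat _).nullMeasurableSet (measure_ne_top _ _),
    measure_sdiff Set.Ioi_subset_Ici_self
      (measurableSet_of_finite_pi_nat _).nullMeasurableSet (measure_ne_top _ _),
    hup _ (isUpperSet_Ici x), hup _ (isUpperSet_Ioi x)]

theorem Policy.identDistrib_queueLength_deliveredCount (hρ : Memoryless ρ) (hW : IsDriven P W ρ)
    {π π' : Policy I m Ξ} (hπ : π.Admissible P W) (hwc : π.WorkConserving P W)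
    (hπ' : π'.Admissible P W) (hwc' : π'.WorkConserving P W) :
    IdentDistrib (fun ω (t : ℝ≥0) => (π.queueLength (W ω) t, π.deliveredCount (W ω) t))
      (fun ω (t : ℝ≥0) => (π'.queueLength (W ω) t, π'.deliveredCount (W ω) t)) P P := by
  have h := Policy.identDistrib_deliveredCount hρ hW hπ hwc hπ' hwc'
  have hu : Measurable fun (g : ℝ≥0 → ℕ) (t : ℝ≥0) => (I.arrivalCount t - g t, g t) :=
    measurable_pi_iff.2 fun t => (measurable_from_top (f := fun n : ℕ =>
      (I.arrivalCount t - n, n))).comp (measurable_pi_apply t)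
  have h2 := h.comp hu
  simp only [Policy.queueLength_eq_sub]
  exact h2

omit [IsProbabilityMeasure P] in
lemma lintegral_natCast_eq_tsum {X : Ω → ℕ} (hX : Measurable X) :
    ∫⁻ ω, (X ω : ℝ≥0∞) ∂P = ∑' n : ℕ, P {ω | n < X ω} := by
  have h1 : ∀ ω, (X ω : ℝ≥0∞) = ∑' n : ℕ, {ω | n < X ω}.indicator (fun _ => (1 : ℝ≥0∞)) ω := by
    intro ω
    rw [tsum_eq_sum (s := Finset.range (X ω))]
    · rw [Finset.sum_congr rfl (g := fun _ => (1 : ℝ≥0∞))]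
      · simp
      · intro n hn
        exact Set.indicator_of_mem (s := {ω | n < X ω}) (Finset.mem_range.1 hn) _
    · intro n hn
      exact Set.indicator_of_notMem (s := {ω | n < X ω}) (fun h => hn (Finset.mem_range.2 h)) _
  have hms : ∀ n : ℕ, MeasurableSet {ω | n < X ω} := fun n =>
    hX (MeasurableSet.of_discrete (s := Set.Ioi n))
  simp only [h1]
  rw [lintegral_tsum fun n => (measurable_const.indicator (hms n)).aemeasurable]
  refine tsum_congr fun n => ?_
  rw [lintegral_indicator (hms n), setLIntegral_one]

omit [IsProbabilityMeasure P] in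
lemma StochLE.lintegral_le {X Y : ℝ≥0 → Ω → ℕ} (h : StochLE P X Y) (t : ℝ≥0)
    (hX : Measurable (X t)) (hY : Measurable (Y t)) :
    ∫⁻ ω, (X t ω : ℝ≥0∞) ∂P ≤ ∫⁻ ω, (Y t ω : ℝ≥0∞) ∂P := by
  rw [lintegral_natCast_eq_tsum hX, lintegral_natCast_eq_tsum hY]
  refine ENNReal.tsum_le_tsum fun n => ?_
  have := h 1 (fun _ => t) (Subsingleton.strictMono _) {u | n < u 0}
    fun u u' huu' hu => lt_of_lt_of_le hu (huu' 0)
  exact this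

theorem Policy.throughputOptimal_of_workConserving (hρ : Memoryless ρ) (hW : IsDriven P W ρ)
    {π : Policy I m Ξ} (hπ : π.Admissible P W) (hwc : π.WorkConserving P W) :
    π.ThroughputOptimal P W := by
  intro π' hπ'
  have h : StochLE P (fun t ω => π'.deliveredCount (W ω) t)
      (fun t ω => π.deliveredCount (W ω) t) := fun r t _ U hU =>
    Policy.measure_deliveredCount_mono hρ hW hπ hwc hπ' t hU
  have h2 : ∀ T : ℝ≥0, π'.throughput P W T ≤ π.throughput P W T := fun T =>
    ENNReal.div_le_div_right (h.lintegral_le T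
      ((π'.measurable_deliveredCount T).comp hW.measurable)
      ((π.measurable_deliveredCount T).comp hW.measurable)) _
  exact ⟨h, fun T _ => h2 T, liminf_le_liminf (Eventually.of_forall h2),
    limsup_le_limsup (Eventually.of_forall h2)⟩

/-- The expected delays, truncated at `T`, add up to the integral of the expected queue length. -/
lemma Policy.tsum_delay_eq (hWm : Measurable W) (π : Policy I m Ξ) (T : ℝ≥0∞) :
    (open Classical in ∑' i : ℕ, if (i : ℕ∞) < I.n then
        ∫⁻ ω, (min (π.completion (W ω) i) T - I.arr i) ∂P else 0) =
      ∫⁻ s in timesBetween 0 T, ∫⁻ ω, (π.queueLength (W ω) s.toNNReal : ℝ≥0∞) ∂P := by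
  classical
  -- The section of `A i` at `ω` consists of the times before `T` that packet `i` spends in the
  -- system: its length is the truncated delay, and counting over `i` at a fixed time gives the
  -- queue length. Tonelli does the rest.
  set A : ℕ → Set (Ω × ℝ) := fun i => {p | (i : ℕ∞) < I.n ∧
    p.2 ∈ timesBetween (I.arr i) (min (π.completion (W p.1) i) T)} with hA
  have hAm : ∀ i, MeasurableSet (A i) := by
    intro i
    by_cases hi : (i : ℕ∞) < I.n
    · simp only [hA, hi, true_and, timesBetween, Set.mem_ofPred_eq]
      refine MeasurableSet.inter (measurable_snd measurableSet_Ici) (measurableSet_lt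
        (ENNReal.measurable_ofReal.comp measurable_snd) (Measurable.min ?_ measurable_const))
      exact (π.measurable_completion i).comp (hWm.comp measurable_fst)
    · simp [hA, hi]
  have hGm : ∀ i, Measurable ((A i).indicator (fun _ => (1 : ℝ≥0∞))) := fun i =>
    measurable_const.indicator (hAm i)
  have h1 : ∀ i : ℕ, (if (i : ℕ∞) < I.n then
        ∫⁻ ω, (min (π.completion (W ω) i) T - I.arr i) ∂P else 0) =
      ∫⁻ ω, ∫⁻ s, (A i).indicator (fun _ => (1 : ℝ≥0∞)) (ω, s) ∂volume ∂P := by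
    intro i
    by_cases hi : (i : ℕ∞) < I.n
    · rw [if_pos hi]
      refine lintegral_congr fun ω => ?_
      rw [← volume_timesBetween, ← setLIntegral_one,
        ← lintegral_indicator (measurableSet_timesBetween _ _)]
      refine lintegral_congr fun s => ?_
      simp only [Set.indicator, hA, Set.mem_ofPred_eq, hi, true_and]
    · rw [if_neg hi]
      simp [hA, hi]
  have h2 : ∀ ω s, ∑' i, (A i).indicator (fun _ => (1 : ℝ≥0∞)) (ω, s) =
      (timesBetween 0 T).indicator (fun s => (π.queueLength (W ω) s.toNNReal : ℝ≥0∞)) s := by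
    intro ω s
    by_cases hs : s ∈ timesBetween 0 T
    · rw [Set.indicator_of_mem hs, Policy.queueLength]
      have hfin : {i : ℕ | (i : ℕ∞) < I.n ∧ I.arr i ≤ s.toNNReal ∧
          (s.toNNReal : ℝ≥0∞) < π.completion (W ω) i}.Finite :=
        (I.finite_arrivals s.toNNReal).subset fun i hi => ⟨hi.1, hi.2.1⟩
      have hmem : ∀ i, (ω, s) ∈ A i ↔ i ∈ hfin.toFinset := by
        intro i
        simp only [hA, timesBetween, Set.mem_ofPred_eq, Set.Finite.mem_toFinset, lt_min_iff]
        rw [Real.le_toNNReal_iff_coe_le hs.1]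
        exact ⟨fun h => ⟨h.1, h.2.1, h.2.2.1⟩, fun h => ⟨h.1, h.2.1, h.2.2, hs.2⟩⟩
      rw [Set.ncard_eq_toFinset_card _ hfin, tsum_eq_sum (s := hfin.toFinset)]
      · rw [Finset.sum_congr rfl (g := fun _ => (1 : ℝ≥0∞))]
        · simp
        · intro i hi
          exact Set.indicator_of_mem ((hmem i).2 hi) _
      · intro i hi
        exact Set.indicator_of_notMem (fun h => hi ((hmem i).1 h)) _
    · rw [Set.indicator_of_notMem hs]
      refine ENNReal.tsum_eq_zero.2 fun i => Set.indicator_of_notMem (fun h => hs ?_) _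
      exact ⟨(I.arr i).2.trans h.2.1, h.2.2.trans_le (min_le_right _ _)⟩
  have hswap : ∀ i, ∫⁻ ω, ∫⁻ s, (A i).indicator (fun _ => (1 : ℝ≥0∞)) (ω, s) ∂volume ∂P =
      ∫⁻ s, ∫⁻ ω, (A i).indicator (fun _ => (1 : ℝ≥0∞)) (ω, s) ∂P ∂volume := fun i =>
    lintegral_lintegral_swap (hGm i).aemeasurable
  simp only [h1, hswap]
  rw [← lintegral_tsum fun i => (hGm i).lintegral_prod_left'.aemeasurable,
    ← lintegral_indicator (measurableSet_timesBetween 0 T)]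
  refine lintegral_congr fun s => ?_
  have hGs : ∀ i, Measurable fun ω => (A i).indicator (fun _ => (1 : ℝ≥0∞)) (ω, s) := fun i =>
    (hGm i).comp (measurable_id.prodMk measurable_const)
  rw [← lintegral_tsum fun i => (hGs i).aemeasurable]
  simp only [h2]
  by_cases hs : s ∈ timesBetween 0 T
  · simp only [Set.indicator_of_mem hs]
  · simp only [Set.indicator_of_notMem hs, lintegral_zero]

theorem Policy.meanDelayOptimal_of_workConserving (hρ : Memoryless ρ) (hW : IsDriven P W ρ)
    {π : Policy I m Ξ} (hπ : π.Admissible P W) (hwc : π.WorkConserving P W) :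
    π.MeanDelayOptimal P W := by
  classical
  intro π' hπ'
  have h : StochLE P (fun t ω => π.queueLength (W ω) t)
      (fun t ω => π'.queueLength (W ω) t) := by
    intro r t _ U hU
    simp only [Policy.queueLength_eq_sub]
    -- Since `N = A - γ` decreases in `γ`, the event that `N` avoids an upper set is an upper event
    -- for `γ`.
    set V : Set (Fin r → ℕ) := {g | (fun l => I.arrivalCount (t l) - g l) ∉ U} with hV
    have hVu : IsUpperSet V := fun g g' hgg' hg hg' =>
      hg (hU (fun l => Nat.sub_le_sub_left (hgg' l) _) hg')
    have hle := Policy.measure_deliveredCount_mono hρ hW hπ hwc hπ' t hVu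
    have hms : ∀ π : Policy I m Ξ,
        MeasurableSet {ω | (fun l => π.deliveredCount (W ω) (t l)) ∈ V} := fun π =>
      (π.measurable_deliveredCount_comp hW.measurable t) (measurableSet_of_finite_pi_nat V)
    have hcompl : ∀ π : Policy I m Ξ,
        {ω | (fun l => I.arrivalCount (t l) - π.deliveredCount (W ω) (t l)) ∈ U} =
          {ω | (fun l => π.deliveredCount (W ω) (t l)) ∈ V}ᶜ := by
      intro π
      ext ω
      simp [hV]
    rw [hcompl, hcompl, prob_compl_eq_one_sub (hms π), prob_compl_eq_one_sub (hms π')]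
    exact tsub_le_tsub_left hle 1
  have hqm : ∀ (π : Policy I m Ξ) (t : ℝ≥0), Measurable fun ω => π.queueLength (W ω) t := by
    intro π t
    simp only [Policy.queueLength_eq_sub]
    exact (measurable_from_top (f := fun n : ℕ => I.arrivalCount t - n)).comp
      ((π.measurable_deliveredCount t).comp hW.measurable)
  have hsum : ∀ T : ℝ≥0∞, (∑' i : ℕ, if (i : ℕ∞) < I.n then
        ∫⁻ ω, (min (π.completion (W ω) i) T - I.arr i) ∂P else 0) ≤
      ∑' i : ℕ, if (i : ℕ∞) < I.n then
        ∫⁻ ω, (min (π'.completion (W ω) i) T - I.arr i) ∂P else 0 := by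
    intro T
    have e1 := π.tsum_delay_eq (P := P) hW.measurable T
    have e2 := π'.tsum_delay_eq (P := P) hW.measurable T
    convert lintegral_mono (μ := volume.restrict (timesBetween 0 T)) (fun s : ℝ =>
      h.lintegral_le s.toNNReal (hqm π s.toNNReal) (hqm π' s.toNNReal)) using 1
  have hmean : ∀ T : ℝ≥0, π.meanDelayUpTo P W T ≤ π'.meanDelayUpTo P W T := by
    intro T
    -- A packet arriving after `T` contributes zero by truncated subtraction, so the restriction to
    -- arrivals up to `T` can be dropped.
    have hdrop : ∀ π : Policy I m Ξ, ∀ i : ℕ, (if (i : ℕ∞) < I.n ∧ I.arr i ≤ T then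
        ∫⁻ ω, (min (π.completion (W ω) i) T - I.arr i) ∂P else 0) =
        if (i : ℕ∞) < I.n then
          ∫⁻ ω, (min (π.completion (W ω) i) T - I.arr i) ∂P else 0 := by
      intro π i
      by_cases hi : (i : ℕ∞) < I.n
      · by_cases ha : I.arr i ≤ T
        · simp [hi, ha]
        · have hz : ∀ ω, min (π.completion (W ω) i) (T : ℝ≥0∞) - I.arr i = 0 := fun ω =>
            tsub_eq_zero_of_le ((min_le_right _ _).trans
              (ENNReal.coe_le_coe.2 (not_le.1 ha).le))
          simp [hz]
      · simp [hi]
    have := hsum T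
    simp only [← hdrop] at this
    exact ENNReal.div_le_div_right this _
  have htot : π.totalDelay P W ≤ π'.totalDelay P W := by
    have := hsum ⊤
    simp only [min_top_right] at this
    exact this
  exact ⟨h, hmean, liminf_le_liminf (Eventually.of_forall hmean),
    limsup_le_limsup (Eventually.of_forall hmean), htot,
    fun n _ => ENNReal.div_le_div_right htot _⟩

end StochasticOrder

/-! ### Policies without reviews have finitely many epochs in bounded time. -/

section Admissibility

variable {m : ℕ} {I : Input} {Ξ : Type*} [MeasurableSpace Ξ] {Ω : Type*} [MeasurableSpace Ω]
  {P : Measure Ω} {W : Ω → Outcome m Ξ}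

/-- Local finiteness: only finitely many arrivals lie below the infimum plus one, so the infimum is
attained. -/
lemma Input.exists_arr_eq_nextArrival (I : Input) {T : ℝ≥0∞} (h : I.nextArrival T ≠ ⊤) :
    ∃ i : ℕ, (i : ℕ∞) < I.n ∧ T < I.arr i ∧ I.nextArrival T = I.arr i := by
  set v := I.nextArrival T with hv
  have hlt : sInf {t : ℝ≥0∞ | ∃ i : ℕ, (i : ℕ∞) < I.n ∧ t = I.arr i ∧ T < t} < v + 1 :=
    ENNReal.lt_add_right h one_ne_zero
  obtain ⟨_, ⟨i₀, hi₀, rfl, hT⟩, hi₀v⟩ := sInf_lt_iff.1 hlt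
  have hfin : {i ∈ I.arrived (v + 1) | T < I.arr i}.Finite :=
    (I.arrived_finite (by simp [h])).subset fun i hi => hi.1
  obtain ⟨i, hi, hmin⟩ := Set.exists_min_image _ I.arr hfin ⟨i₀, ⟨hi₀, hi₀v.le⟩, hT⟩
  refine ⟨i, hi.1.1, hi.2, le_antisymm (sInf_le ⟨i, hi.1.1, rfl, hi.2⟩) (le_sInf ?_)⟩
  rintro _ ⟨i', hi', rfl, hT'⟩
  by_cases hle : (I.arr i' : ℝ≥0∞) ≤ v + 1
  · exact ENNReal.coe_le_coe.2 (hmin i' ⟨⟨hi', hle⟩, hT'⟩)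
  · exact hi.1.2.trans (not_le.1 hle).le

/-- If no reviews are scheduled, every epoch brings an arrival or a delivery. -/
lemma Policy.arrived_add_count_lt (π : Policy I m Ξ) (w : Outcome m Ξ) {k : ℕ}
    (ht : π.time w (k + 1) ≠ ⊤) (hr : π.review k w.1 (π.run w k).hist = ⊤) :
    (I.arrived (π.time w k)).ncard + π.count w k <
      (I.arrived (π.time w (k + 1))).ncard + π.count w (k + 1) := by
  have ht' := π.time_ne_top_of_le w (Nat.le_succ k) ht
  have hsub := I.arrived_mono (π.time_mono w (Nat.le_add_right k 1))
  have hle := Set.ncard_le_ncard hsub (I.arrived_finite ht)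
  have hcount := π.count_succ w k
  by_cases hc : π.completing w k = ∅
  · have hgap : π.gap w k = I.nextArrival (π.time w k) - π.time w k := by
      have h1 : π.gap w k = π.horizon w.1 (π.run w k).hist := firstTime_of_empty hc
      rw [h1, Policy.horizon, hr, min_top_right]
      rfl
    have htime : π.time w (k + 1) = I.nextArrival (π.time w k) := by
      rw [π.time_add_gap, hgap, add_tsub_cancel_of_le (I.le_nextArrival _)]
    obtain ⟨i, hi, hlt, heq⟩ := I.exists_arr_eq_nextArrival (htime ▸ ht)
    have hss : I.arrived (π.time w k) ⊂ I.arrived (π.time w (k + 1)) := by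
      refine Set.ssubset_iff_of_subset hsub |>.2 ⟨i, ⟨hi, ?_⟩, fun h => absurd h.2 (not_le.2 hlt)⟩
      rw [htime, heq]
    have := Set.ncard_lt_ncard hss (I.arrived_finite ht)
    omega
  · have : 0 < (π.completing w k).card := Finset.card_pos.2 (Finset.nonempty_iff_ne_empty.2 hc)
    omega

/-- Each epoch adds an arrival or a delivery, while up to time `T` the two counts together are at
most twice the number of arrivals. -/
lemma Policy.tendsto_time_of_review_eq_top (π : Policy I m Ξ) (w : Outcome m Ξ)
    (hr : ∀ k, π.time w k ≠ ⊤ → π.review k w.1 (π.run w k).hist = ⊤) :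
    Tendsto (π.time w) atTop (𝓝 ⊤) := by
  rw [ENNReal.tendsto_nhds_top_iff_nnreal]
  intro T
  suffices h : ∃ K, (T : ℝ≥0∞) < π.time w K by
    obtain ⟨K, hK⟩ := h
    filter_upwards [eventually_ge_atTop K] with k hk
    exact hK.trans_le (π.time_mono w hk)
  by_contra hcon
  push Not at hcon
  have hnt : ∀ k, π.time w k ≠ ⊤ := fun k => ne_top_of_le_ne_top ENNReal.coe_ne_top (hcon k)
  have hgrow : ∀ k, k ≤ (I.arrived (π.time w k)).ncard + π.count w k := by
    intro k
    induction k with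
    | zero => exact Nat.zero_le _
    | succ k ih =>
      have := π.arrived_add_count_lt w (hnt (k + 1)) (hr k (hnt k))
      omega
  have hbound : ∀ k, (I.arrived (π.time w k)).ncard + π.count w k ≤
      2 * (I.arrived T).ncard := by
    intro k
    have h1 := Set.ncard_le_ncard (I.arrived_mono (hcon k)) (I.arrived_finite ENNReal.coe_ne_top)
    have h2 := Set.ncard_le_ncard (π.deliveredSet_subset_arrived w k) (I.arrived_finite (hnt k))
    rw [(π.deliveredSet_finite_ncard w k).2] at h2
    omega
  have h1 := hgrow (2 * (I.arrived T).ncard + 1)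
  have h2 := hbound (2 * (I.arrived T).ncard + 1)
  omega

lemma Policy.IsPrmpLGFS.admissible {π : Policy I m Ξ} (h : π.IsPrmpLGFS P W) :
    π.Admissible P W := by
  filter_upwards [h] with ω hω
  exact π.tendsto_time_of_review_eq_top (W ω) fun k hk => (hω k hk).1

lemma Policy.IsPrmpLGFS.workConserving {π : Policy I m Ξ} (h : π.IsPrmpLGFS P W) :
    π.WorkConserving P W := by
  filter_upwards [h] with ω hω k hk
  exact (hω k hk).2.1

end Admissibility

/-! ### Construction of a prmp-LGFS policy. -/

section Existence

variable {m : ℕ} {I : Input} {Ξ : Type*} [MeasurableSpace Ξ]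

lemma exists_top_subset {κ : Type*} [LinearOrder κ] (f : ℕ → κ) (S : Finset ℕ) {n : ℕ}
    (hn : n ≤ S.card) : ∃ T ⊆ S, T.card = n ∧ ∀ x ∈ T, ∀ y ∈ S, y ∉ T → f y ≤ f x := by
  induction n with
  | zero => exact ⟨∅, Finset.empty_subset _, rfl, by simp⟩
  | succ n ih =>
    obtain ⟨T, hTS, hT, hmax⟩ := ih (by omega)
    have hne : (S \ T).Nonempty := by
      rw [← Finset.card_pos, Finset.card_sdiff_of_subset hTS]
      omega
    obtain ⟨y₀, hy₀, hy₀max⟩ := Finset.exists_max_image (S \ T) f hne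
    rw [Finset.mem_sdiff] at hy₀
    refine ⟨insert y₀ T, Finset.insert_subset hy₀.1 hTS, ?_, ?_⟩
    · rw [Finset.card_insert_of_notMem hy₀.2, hT]
    · intro x hx y hy hyT
      rw [Finset.mem_insert, not_or] at hyT
      rcases Finset.mem_insert.1 hx with rfl | hx
      · exact hy₀max y (Finset.mem_sdiff.2 ⟨hy, hyT.2⟩)
      · exact hmax x hx y hy hyT.2

/-- A set of at most `m` packets can be distributed over the servers without moving packets that are
in service. -/
lemma exists_assignment (T : Finset ℕ) (hT : T.card ≤ m) (s : Fin m → Option ℕ)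
    (hs : ∀ j j' i, s j = some i → s j' = some i → j = j') :
    ∃ a : Fin m → Option ℕ, (∀ j i, a j = some i → i ∈ T) ∧
      (∀ j j' i, a j = some i → a j' = some i → j = j') ∧
      (∀ i ∈ T, ∃ j, a j = some i) ∧ (∀ j i, i ∈ T → s j = some i → a j = some i) ∧
      (∀ j, a j = none → T.card < m) := by
  classical
  -- Padding `T` with idle tokens to exactly `m` elements turns the assignment into a bijection that
  -- extends the one given by the services to be kept.
  set t : Finset (ℕ ⊕ ℕ) := T.disjSum (Finset.range (m - T.card)) with ht
  have htc : Fintype.card (Fin m) = t.card := by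
    rw [ht, Finset.card_disjSum, Finset.card_range, Fintype.card_fin]
    omega
  set f : Fin m → ℕ ⊕ ℕ := fun j => (s j).elim (Sum.inr 0) Sum.inl with hf
  set J : Finset (Fin m) := {j | ∃ i ∈ T, s j = some i} with hJ
  have hfJ : ∀ j ∈ J, ∃ i ∈ T, s j = some i ∧ f j = Sum.inl i := by
    intro j hj
    obtain ⟨i, hi, hji⟩ := (Finset.mem_filter.1 hj).2
    exact ⟨i, hi, hji, by simp [hf, hji]⟩
  obtain ⟨g, hg⟩ := Finset.exists_equiv_extend_of_card_eq htc (s := J) (f := f) (by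
      intro x hx
      obtain ⟨j, hj, rfl⟩ := Finset.mem_image.1 hx
      obtain ⟨i, hi, -, hfi⟩ := hfJ j hj
      rw [hfi]
      exact Finset.inl_mem_disjSum.2 hi) (by
      intro j hj j' hj' he
      obtain ⟨i, -, hji, hfi⟩ := hfJ j hj
      obtain ⟨i', -, hji', hfi'⟩ := hfJ j' hj'
      rw [hfi, hfi'] at he
      obtain rfl := Sum.inl_injective he
      exact hs j j' i hji hji')
  have ha : ∀ j i, (g j : ℕ ⊕ ℕ).getLeft? = some i ↔ (g j : ℕ ⊕ ℕ) = Sum.inl i := fun j i =>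
    Sum.getLeft?_eq_some_iff
  refine ⟨fun j => (g j : ℕ ⊕ ℕ).getLeft?, fun j i h => ?_, fun j j' i h h' => ?_, fun i hi => ?_,
    fun j i hi hji => ?_, fun j h => ?_⟩
  · have := (g j).2
    rw [(ha j i).1 h] at this
    exact Finset.inl_mem_disjSum.1 this
  · exact g.injective (Subtype.ext (((ha j i).1 h).trans ((ha j' i).1 h').symm))
  · refine ⟨g.symm ⟨Sum.inl i, Finset.inl_mem_disjSum.2 hi⟩, (ha _ i).2 ?_⟩
    rw [Equiv.apply_symm_apply]
  · refine (ha j i).2 ?_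
    rw [hg j (Finset.mem_filter.2 ⟨Finset.mem_univ j, i, hi, hji⟩)]
    simp [hf, hji]
  · obtain ⟨y, hy⟩ := Sum.isRight_iff.1 (Sum.getLeft?_eq_none_iff.1 h)
    have := (g j).2
    rw [hy, Finset.inr_mem_disjSum, Finset.mem_range] at this
    omega

/-- The requirements of the preemptive Last Generated First Served rule on the assignment `a`, when
`S` is the set of packets in the system and `s` the packets under service. -/
structure IsLGFSAssignment (I : Input) (S : Finset ℕ) (s a : Fin m → Option ℕ) : Prop where
  idle : ∀ j, a j = none → ∀ i ∈ S, ∃ j', a j' = some i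
  fresh : ∀ j i, a j = some i → ∀ i' ∈ S, (∀ j', a j' ≠ some i') → I.gen i' ≤ I.gen i
  preempt : ∀ j i, s j = some i → a j = some i ∨
    ((∀ j', a j' ≠ some i) ∧ ∃ i', a j = some i' ∧ I.gen i < I.gen i')

lemma exists_isLGFSAssignment (I : Input) (S : Finset ℕ) (s : Fin m → Option ℕ) :
    ∃ a : Fin m → Option ℕ, (∀ j i, a j = some i → i ∈ S) ∧
      (∀ j j' i, a j = some i → a j' = some i → j = j') ∧
      ((∀ j j' i, s j = some i → s j' = some i → j = j') → (∀ j i, s j = some i → i ∈ S) →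
        IsLGFSAssignment I S s a) := by
  classical
  by_cases hs : ∀ j j' i, s j = some i → s j' = some i → j = j'
  swap
  -- A history in which two servers hold the same packet does not occur at a finite epoch of a run;
  -- idling is a legal choice there.
  · exact ⟨fun _ => none, by simp, by simp, fun h => absurd h hs⟩
  -- Ties in generation time are broken in favour of packets in service, so that a service is
  -- interrupted only for a strictly fresher packet.
  set key : ℕ → ℝ≥0 ×ₗ ℕ := fun i => toLex (I.gen i, if ∃ j, s j = some i then 1 else 0) with hkey
  obtain ⟨T, hTS, hTc, hmax⟩ := exists_top_subset key S (min_le_right m S.card)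
  obtain ⟨a, h1, h2, h3, h4, h5⟩ := exists_assignment T (hTc ▸ min_le_left _ _) s hs
  have hfull : ∀ j, a j = none → T = S := fun j hj => by
    have := h5 j hj
    exact Finset.eq_of_subset_of_card_le hTS (by omega)
  have hout : ∀ i, (∀ j', a j' ≠ some i) → i ∉ T := fun i hi hiT => by
    obtain ⟨j, hj⟩ := h3 i hiT
    exact hi j hj
  refine ⟨a, fun j i h => hTS (h1 j i h), h2, fun _ hsS => ⟨?_, ?_, ?_⟩⟩
  · intro j hj i hi
    rw [← hfull j hj] at hi
    exact h3 i hi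
  · intro j i hji i' hi' hun
    have := hmax i (h1 j i hji) i' hi' (hout i' hun)
    rcases Prod.Lex.le_iff.1 this with h | h
    · exact h.le
    · exact h.1.le
  · intro j i hji
    by_cases hiT : i ∈ T
    · exact Or.inl (h4 j i hiT hji)
    · right
      refine ⟨fun j' hj' => hiT (h1 j' i hj'), ?_⟩
      obtain ⟨i', hi'⟩ : ∃ i', a j = some i' := by
        rw [← Option.ne_none_iff_exists']
        intro hnone
        exact hiT (hfull j hnone ▸ hsS j i hji)
      refine ⟨i', hi', ?_⟩
      rcases Prod.Lex.le_iff.1 (hmax i' (h1 j i' hi') i (hsS j i hji) hiT) with h | h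
      · exact h
      -- With equal generation times, `i'` must also have been in service; a selected packet keeps
      -- its server, so that server is `j` and `i' = i`, although `i` was not selected.
      · exfalso
        have hi1 : ∃ j, s j = some i := ⟨j, hji⟩
        have hle := h.2
        simp only [hkey, ofLex_toLex, if_pos hi1] at hle
        have hserved : ∃ j', s j' = some i' := by
          by_contra hn
          rw [if_neg hn] at hle
          omega
        obtain ⟨j', hj'⟩ := hserved
        have hjj := h2 j j' i' hi' (h4 j' i' (h1 j i' hi') hj')
        rw [← hjj, hji] at hj'
        obtain rfl := Option.some_injective _ hj'
        exact hiT (h1 j i hi')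

/-- The finite set of packets in the system. -/
noncomputable def Input.systemFinset (I : Input) {k : ℕ} (h : Hist m k) : Finset ℕ :=
  open Classical in
  if ht : h.now.time ≠ ⊤ then
    ((I.arrived_finite ht).subset
      (fun _ hi => ⟨hi.1, hi.2.1⟩ : I.inSystem h ⊆ I.arrived h.now.time)).toFinset
  else ∅

lemma Input.mem_systemFinset {k : ℕ} {h : Hist m k} {i : ℕ} :
    i ∈ I.systemFinset h ↔ h.now.time ≠ ⊤ ∧ i ∈ I.inSystem h := by
  rw [Input.systemFinset]
  split_ifs with ht
  · simp [ht]
  · simp [ht]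

lemma Input.measurable_systemFinset (I : Input) (k : ℕ) :
    Measurable (I.systemFinset : Hist m k → Finset ℕ) := by
  refine measurable_finset fun i => ?_
  simp only [Input.mem_systemFinset, Input.inSystem, Set.mem_ofPred_eq]
  refine MeasurableSet.inter (measurable_now_time (measurableSet_singleton ⊤).compl)
    (MeasurableSet.inter (MeasurableSet.const _) (MeasurableSet.inter
      (measurable_now_time measurableSet_Ici) ?_))
  have : {h : Hist m k | ∀ l j, (h l).delivered j ≠ some i} =
      ⋂ l, ⋂ j, {h | (h l).delivered j ≠ some i} := by
    ext h
    simp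
  change MeasurableSet {h : Hist m k | ∀ l j, (h l).delivered j ≠ some i}
  rw [this]
  exact MeasurableSet.iInter fun l => MeasurableSet.iInter fun j =>
    measurable_delivered l j (MeasurableSet.of_discrete (s := {some i}ᶜ))

/-- A preemptive Last Generated First Served policy. -/
noncomputable def lgfsPolicy (I : Input) (m : ℕ) (Ξ : Type*) [MeasurableSpace Ξ] :
    Policy I m Ξ where
  assign _ _ h := (exists_isLGFSAssignment I (I.systemFinset h) h.now.serving).choose
  review _ _ _ := ⊤
  measurable_assign k := by
    have hs : Measurable fun p : Ξ × Hist m k => (I.systemFinset p.2, p.2.now.serving) :=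
      ((I.measurable_systemFinset k).comp measurable_snd).prodMk
        ((measurable_snd.comp measurable_snd).comp (measurable_now.comp measurable_snd))
    -- The choice depends only on the packets in the system and in service, which take countably
    -- many values, so any selection is measurable.
    exact (measurable_of_countable fun q : Finset ℕ × (Fin m → Option ℕ) =>
      (exists_isLGFSAssignment I q.1 q.2).choose).comp hs
  measurable_review _ := measurable_const
  review_pos _ _ _ := ENNReal.zero_lt_top
  assign_mem k e h _ j i hji := (Input.mem_systemFinset.1
    ((exists_isLGFSAssignment I (I.systemFinset h) h.now.serving).choose_spec.1 j i hji)).2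
  assign_inj k e h _ :=
    (exists_isLGFSAssignment I (I.systemFinset h) h.now.serving).choose_spec.2.1

lemma Policy.serving_mem_inSystem (π : Policy I m Ξ) (w : Outcome m Ξ) {k : ℕ}
    (ht : π.time w k ≠ ⊤) {j : Fin m} {i : ℕ}
    (h : (π.run w k).hist.now.serving j = some i) : i ∈ I.inSystem (π.run w k).hist := by
  cases k with
  | zero =>
    have h0 : (π.run w 0).hist.now.serving j = none := rfl
    simp [h0] at h
  | succ k =>
    have ht' := π.time_ne_top_of_le w (Nat.le_succ k) ht
    rw [π.serving_succ] at h
    split_ifs at h with hj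
    have hi := π.served_subset_inSystem w ht' ⟨j, h⟩
    rw [π.inSystem_run] at hi ⊢
    refine ⟨I.arrived_mono (π.time_mono w (Nat.le_succ k)) hi.1, ?_⟩
    rw [π.deliveredSet_succ]
    rintro (hd | ⟨j', hj', hd⟩)
    · exact hi.2 hd
    · exact hj ((π.assign_inj k w.1 _ ht' j j' i h hd) ▸ hj')

lemma Policy.serving_injective (π : Policy I m Ξ) (w : Outcome m Ξ) {k : ℕ}
    (ht : π.time w k ≠ ⊤) (j j' : Fin m) (i : ℕ)
    (h : (π.run w k).hist.now.serving j = some i)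
    (h' : (π.run w k).hist.now.serving j' = some i) : j = j' := by
  cases k with
  | zero =>
    have h0 : (π.run w 0).hist.now.serving j = none := rfl
    simp [h0] at h
  | succ k =>
    rw [π.serving_succ] at h h'
    split_ifs at h h'
    exact π.assign_inj k w.1 _ (π.time_ne_top_of_le w (Nat.le_succ k) ht) j j' i h h'

theorem isPrmpLGFS_lgfsPolicy {Ω : Type*} [MeasurableSpace Ω] (P : Measure Ω)
    (W : Ω → Outcome m Ξ) : (lgfsPolicy I m Ξ).IsPrmpLGFS P W := by
  refine Eventually.of_forall fun ω k ht => ⟨rfl, ?_⟩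
  set π := lgfsPolicy I m Ξ with hπ
  set w := W ω
  have ht' : (π.run w k).hist.now.time ≠ ⊤ := ht
  have hmem : ∀ i, i ∈ I.systemFinset (π.run w k).hist ↔ i ∈ I.inSystem (π.run w k).hist :=
    fun i => Input.mem_systemFinset.trans (and_iff_right ht')
  have hA : IsLGFSAssignment I (I.systemFinset (π.run w k).hist) (π.run w k).hist.now.serving
      (π.decision w k) :=
    (exists_isLGFSAssignment I (I.systemFinset (π.run w k).hist)
      (π.run w k).hist.now.serving).choose_spec.2.2 (π.serving_injective w ht)
      fun j i h => (hmem i).2 (π.serving_mem_inSystem w ht h)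
  refine ⟨fun j hj => ?_, fun j i hj i' hi' => ?_, fun j i hj => ?_⟩
  · refine Set.eq_empty_iff_forall_notMem.2 fun i hi => ?_
    obtain ⟨j', hj'⟩ := hA.idle j hj i ((hmem i).2 hi.1)
    exact hi.2 j' hj'
  · exact hA.fresh j i hj i' ((hmem i').2 hi'.1) hi'.2
  · rcases hA.preempt j i hj with h | ⟨h1, h2⟩
    · exact Or.inl h
    · exact Or.inr ⟨⟨π.serving_mem_inSystem w ht hj, h1⟩, h2⟩

end Existence

end UpdateSystem

theorem theorem2 {Ω Ξ : Type*} [MeasurableSpace Ω] [MeasurableSpace Ξ]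
    (P : Measure Ω) [IsProbabilityMeasure P]
    (m : ℕ) (I : UpdateSystem.Input) (μ : ℝ) (hμ : 0 < μ)
    (seed : Ω → Ξ) (hseed : Measurable seed)
    (X : ℕ → Fin m → Ω → ℝ) (hX : ∀ k j, Measurable (X k j))
    (hX_exp : ∀ k j, P.map (X k j) = expMeasure μ)
    (hX_indep : iIndepFun (fun p : ℕ × Fin m => X p.1 p.2) P)
    (hX_seed : IndepFun seed (fun ω k j => X k j ω) P)
    (W : Ω → UpdateSystem.Outcome m Ξ) (hW : ∀ ω, W ω = (seed ω, fun k j => X k j ω)) :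
    (∃ π : UpdateSystem.Policy I m Ξ, π.IsPrmpLGFS P W) ∧
    (∀ π : UpdateSystem.Policy I m Ξ, π.IsPrmpLGFS P W →
      π.Admissible P W ∧ π.WorkConserving P W ∧
      π.ThroughputOptimal P W ∧ π.MeanDelayOptimal P W) ∧
    (∀ π π' : UpdateSystem.Policy I m Ξ,
      π.Admissible P W → π.WorkConserving P W → π'.Admissible P W → π'.WorkConserving P W →
      IdentDistrib
        (fun ω (t : ℝ≥0) => (π.queueLength (W ω) t, π.deliveredCount (W ω) t))
        (fun ω (t : ℝ≥0) => (π'.queueLength (W ω) t, π'.deliveredCount (W ω) t)) P P) ∧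
    (∀ π : UpdateSystem.Policy I m Ξ, π.Admissible P W → π.WorkConserving P W →
      π.ThroughputOptimal P W ∧ π.MeanDelayOptimal P W) := by
  have hprob := UpdateSystem.isProbabilityMeasure_serviceLaw hμ
  have hnull := UpdateSystem.nullSingletonClass_serviceLaw hμ
  have hρ := UpdateSystem.memoryless_serviceLaw hμ
  have hD := UpdateSystem.isDriven_of_iIndepFun hseed hX hX_exp hX_indep hX_seed hW
  have hopt : ∀ π : UpdateSystem.Policy I m Ξ, π.Admissible P W → π.WorkConserving P W →
      π.ThroughputOptimal P W ∧ π.MeanDelayOptimal P W := fun π h1 h2 =>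
    ⟨UpdateSystem.Policy.throughputOptimal_of_workConserving hρ hD h1 h2,
      UpdateSystem.Policy.meanDelayOptimal_of_workConserving hρ hD h1 h2⟩
  refine ⟨⟨_, UpdateSystem.isPrmpLGFS_lgfsPolicy P W⟩, fun π h => ?_, fun π π' h1 h2 h3 h4 => ?_,
    hopt⟩
  · exact ⟨h.admissible, h.workConserving, hopt π h.admissible h.workConserving⟩
  · exact UpdateSystem.Policy.identDistrib_queueLength_deliveredCount hρ hD h1 h2 h3 h4
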